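/- **Proposition (Reduction principle).** Let $(M,\omega)$ be a connected symplectic manifold (finite-dimensional, smooth, Hausdorff, second countable, with $\omega$ a smooth closed non-degenerate $2$-form), and let $G$ be a connected (finite-dimensional) Lie group acting smoothly and properly on $M$ by symplectic diffeomorphisms, i.e. $g^*\omega=\omega$ for all $g\in G$. Let $H\subset G$ be a principal isotropy group of the action, i.e. $H=G_x$ for some $x\in M$ which has a neighbourhood $U$ such that for every $y\in U$ there is $g\in G$ with $G_x\subset G_{gy}$. Put $$M^H=\{x\in M: G_x=H\},\qquad L=N(H)/H,$$ where $N(H)$ is the normalizer of $H$ in $G$; the group $L$ acts on $M^H$ by $(nH)\cdot x=nx$. Then $M^H$ is a symplectic submanifold of $M$, and $$G \text{ acts coisotropically on } M \iff L \text{ acts coisotropically on } M^H .$$ Here a submanifold $S$ of a symplectic manifold $(N,\omega)$ is called coisotropic if for every $x\in S$ $$(T_xS)^{\perp_\omega}=\{v\in T_xN:\ \omega(v,w)=0 \text{ for all } w\in T_xS\}\subset T_xS,$$ and a group is said to act coisotropically on $N$ if there is an open dense subset $U\subset N$ such that the orbit of every $x\in U$ is a coisotropic submanifold of $N$; $M^H$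 carries the restriction of $\omega$. -/

import Mathlib

open scoped Manifold ContDiff Topology

namespace SymplecticAction

noncomputable section Forms

variable {E : Type*} [NormedAddCommGroup E] [NormedSpace ℝ E]
  {M : Type*} [TopologicalSpace M] [ChartedSpace E M]

/-- The expression of a field of alternating `2`-forms on `M` in the chart around `p`, i.e. its
pullback along the inverse of that chart (meaningful on the target of the chart). -/
def chartForm (Ω : ∀ x : M, TangentSpace 𝓘(ℝ, E) x [⋀^Fin 2]→L[ℝ] ℝ) (p : M) :
    E → E [⋀^Fin 2]→L[ℝ] ℝ := fun y =>
  (Ω ((extChartAt 𝓘(ℝ, E) p).symm y)).compContinuousLinearMap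
    (mfderiv 𝓘(ℝ, E) 𝓘(ℝ, E) (extChartAt 𝓘(ℝ, E) p).symm y)

/-- A symplectic form: a smooth, closed, non-degenerate differential `2`-form on `M`. -/
structure IsSymplecticForm (Ω : ∀ x : M, TangentSpace 𝓘(ℝ, E) x [⋀^Fin 2]→L[ℝ] ℝ) : Prop where
  smooth : ∀ p : M, ContDiffOn ℝ ∞ (chartForm Ω p) (extChartAt 𝓘(ℝ, E) p).target
  closed : ∀ p : M, ∀ y ∈ (extChartAt 𝓘(ℝ, E) p).target, extDeriv (chartForm Ω p) y = 0
  nondegenerate : ∀ (x : M) (v : TangentSpace 𝓘(ℝ, E) x),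
    (∀ w : TangentSpace 𝓘(ℝ, E) x, Ω x ![v, w] = 0) → v = 0

/-- A subset `S` of `M` is an (embedded) submanifold: around each of its points there is a smooth
chart of `M` in which `S` is a linear subspace. -/
def IsSubmanifold (S : Set M) : Prop :=
  ∀ x ∈ S, ∃ e ∈ IsManifold.maximalAtlas 𝓘(ℝ, E) ∞ M, x ∈ e.source ∧
    ∃ F : Submodule ℝ E, e '' (e.source ∩ S) = e.target ∩ (F : Set E)

/-- The tangent space `T_x S` of a submanifold `S` of `M` at a point `x` of `S`, as a subset
of `T_x M`: the velocities at `x` of the smooth curves of `M` that run inside `S`. -/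
def tangentSet (S : Set M) (x : M) : Set (TangentSpace 𝓘(ℝ, E) x) :=
  {v | ∃ γ : ℝ → M, ContMDiff 𝓘(ℝ, ℝ) 𝓘(ℝ, E) ∞ γ ∧ (∀ t, γ t ∈ S) ∧
    tangentMap 𝓘(ℝ, ℝ) 𝓘(ℝ, E) γ ⟨0, (1 : ℝ)⟩ = (⟨x, v⟩ : TangentBundle 𝓘(ℝ, E) M)}

/-- `N` is a symplectic submanifold of `(M, Ω)`: a submanifold to which `Ω` restricts as a
non-degenerate form. (Smoothness and closedness of the restriction are automatic.) -/
def IsSymplecticSubmanifold (Ω : ∀ x : M, TangentSpace 𝓘(ℝ, E) x [⋀^Fin 2]→L[ℝ] ℝ)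
    (N : Set M) : Prop :=
  IsSubmanifold (E := E) N ∧ ∀ x ∈ N, ∀ v ∈ tangentSet (E := E) N x,
    (∀ w ∈ tangentSet (E := E) N x, Ω x ![v, w] = 0) → v = 0

/-- `S` is a coisotropic submanifold of the symplectic submanifold `N` of `(M, Ω)`: it is a
submanifold contained in `N`, and the `Ω`-orthogonal of `T_x S` inside `T_x N` is contained in
`T_x S` for all `x ∈ S`. -/
def IsCoisotropicIn (Ω : ∀ x : M, TangentSpace 𝓘(ℝ, E) x [⋀^Fin 2]→L[ℝ] ℝ)
    (N S : Set M) : Prop :=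
  S ⊆ N ∧ IsSubmanifold (E := E) S ∧ ∀ x ∈ S, ∀ v ∈ tangentSet (E := E) N x,
    (∀ w ∈ tangentSet (E := E) S x, Ω x ![v, w] = 0) → v ∈ tangentSet (E := E) S x

/-- `S` is a coisotropic submanifold of `(M, Ω)`. -/
def IsCoisotropic (Ω : ∀ x : M, TangentSpace 𝓘(ℝ, E) x [⋀^Fin 2]→L[ℝ] ℝ)
    (S : Set M) : Prop :=
  IsSubmanifold (E := E) S ∧ ∀ x ∈ S, ∀ v : TangentSpace 𝓘(ℝ, E) x,
    (∀ w ∈ tangentSet (E := E) S x, Ω x ![v, w] = 0) → v ∈ tangentSet (E := E) S x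

/-- The action of `G` on `M` preserves `Ω`: `g^* Ω = Ω` for all `g`. -/
def IsSymplecticAction (G : Type*) [Group G] [MulAction G M]
    (Ω : ∀ x : M, TangentSpace 𝓘(ℝ, E) x [⋀^Fin 2]→L[ℝ] ℝ) : Prop :=
  ∀ (g : G) (x : M), (Ω (g • x)).compContinuousLinearMap
    (mfderiv 𝓘(ℝ, E) 𝓘(ℝ, E) (fun y : M => g • y) x) = Ω x

/-- `G` acts coisotropically on `(M, Ω)`: for all `x` in some open dense subset of `M` the
orbit `G x` is a coisotropic submanifold of `M`. -/
def ActsCoisotropically (G : Type*) [Group G] [MulAction G M]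
    (Ω : ∀ x : M, TangentSpace 𝓘(ℝ, E) x [⋀^Fin 2]→L[ℝ] ℝ) : Prop :=
  ∃ U : Set M, IsOpen U ∧ Dense U ∧ ∀ x ∈ U, IsCoisotropic Ω (MulAction.orbit G x)

/-- The group `L` acts coisotropically on the symplectic submanifold `N` of `(M, Ω)` (with the
symplectic form restricted from `M`): for all `x` in some open dense subset of `N` the
orbit `L x` is a coisotropic submanifold of `N`. -/
def ActsCoisotropicallyOn (L : Type*) [Group L] (N : Set M) [MulAction L N]
    (Ω : ∀ x : M, TangentSpace 𝓘(ℝ, E) x [⋀^Fin 2]→L[ℝ] ℝ) : Prop :=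
  ∃ U : Set N, IsOpen U ∧ Dense U ∧
    ∀ x ∈ U, IsCoisotropicIn Ω N (Subtype.val '' MulAction.orbit L x)

end Forms

section Actions

variable {G : Type*} [Group G] (M : Type*) [MulAction G M]

/-- The set `M^H = {x ∈ M : G_x = H}`. -/
def isotropyStratum (H : Subgroup G) : Set M :=
  {x | MulAction.stabilizer G x = H}

/-- `H` is a principal isotropy group of the action of `G` on `M`: `H = G_x` for a point `x` on a
principal orbit, i.e. for all `y` near `x` the group `G_x` is contained in the isotropy group of
some point of the orbit `G y` (equivalently, is conjugate to a subgroup of `G_y`). -/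
def IsPrincipalIsotropy [TopologicalSpace M] (H : Subgroup G) : Prop :=
  ∃ x : M, MulAction.stabilizer G x = H ∧
    ∀ᶠ y in 𝓝 x, ∃ g : G, MulAction.stabilizer G x ≤ MulAction.stabilizer G (g • y)

/-- The group `N(H)/H`. -/
abbrev NormalizerQuotient (H : Subgroup G) : Type _ :=
  ↥(Subgroup.normalizer (H : Set G)) ⧸ H.subgroupOf (Subgroup.normalizer (H : Set G))

variable {M}

theorem smul_mem_isotropyStratum {H : Subgroup G} {n : G}
    (hn : n ∈ Subgroup.normalizer (H : Set G)) {x : M} (hx : x ∈ isotropyStratum M H) :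
    n • x ∈ isotropyStratum M H := by
  have hx' : MulAction.stabilizer G x = H := hx
  change MulAction.stabilizer G (n • x) = H
  ext g
  have h1 : g ∈ MulAction.stabilizer G (n • x) ↔ n⁻¹ * g * n ∈ MulAction.stabilizer G x := by
    simp only [MulAction.mem_stabilizer_iff, mul_smul, inv_smul_eq_iff]
  rw [h1, hx']
  have h2 := Subgroup.mem_normalizer_iff.mp hn (n⁻¹ * g * n)
  have h3 : n * (n⁻¹ * g * n) * n⁻¹ = g := by group
  rw [h3] at h2
  exact h2

/-- `N(H)` acts on `M^H`, by restricting the action of `G` on `M`. -/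
instance normalizerAction (H : Subgroup G) :
    MulAction ↥(Subgroup.normalizer (H : Set G)) ↥(isotropyStratum M H) where
  smul n x := ⟨(n : G) • (x : M), smul_mem_isotropyStratum n.2 x.2⟩
  one_smul x := Subtype.ext (one_smul G (x : M))
  mul_smul m n x := Subtype.ext (mul_smul (m : G) (n : G) (x : M))

/-- The homomorphism from `N(H)/H` to the permutations of `M^H` induced by the action of `N(H)`,
under which `H` acts trivially. -/
def quotientPermHom (H : Subgroup G) :
    NormalizerQuotient H →* Equiv.Perm ↥(isotropyStratum M H) :=
  QuotientGroup.lift _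
    (MulAction.toPermHom ↥(Subgroup.normalizer (H : Set G)) ↥(isotropyStratum M H)) (by
      intro n hn
      ext x
      have hx : MulAction.stabilizer G (x : M) = H := x.2
      have h : (n : G) ∈ MulAction.stabilizer G (x : M) := by
        rw [hx]
        exact Subgroup.mem_subgroupOf.mp hn
      exact h)

/-- The induced action of `L = N(H)/H` on `M^H`. -/
instance quotientAction (H : Subgroup G) :
    MulAction (NormalizerQuotient H) ↥(isotropyStratum M H) :=
  MulAction.compHom ↥(isotropyStratum M H) (quotientPermHom (M := M) H)

theorem mk_smul_coe (H : Subgroup G) (n : ↥(Subgroup.normalizer (H : Set G)))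
    (x : ↥(isotropyStratum M H)) :
    (((QuotientGroup.mk n : NormalizerQuotient H) • x : ↥(isotropyStratum M H)) : M)
      = (n : G) • (x : M) :=
  rfl

end Actions

end SymplecticAction

/-! Everything is read off in a linear slice. Near `x` there is a chart in which the compact group
`G_x` acts by a representation `ρ`, the orbit `G x` is an invariant subspace `T`, and an invariant
complement `S` of `T` meets all nearby orbits (`exists_linearSlice`). An isotropy group near `x`
that contains `G_x` equals it, because it lies in a conjugate of `G_x` and no isotropy group
properly contains a conjugate of itself (`stabilizer_le_of_smul_le`). Hence, near `x`, the set
`M^{G_x}` is the fixed subspace of `ρ`, and its intersection with the orbit is the fixed part of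
`T`.

The rest is linear algebra with the averaging projection `A` of `ρ`, which satisfies `ω(v, A w) =
ω(v, w)` for fixed `v`. It shows that the fixed subspace is symplectic, and that a coisotropic `T`
has a fixed part that is coisotropic in the fixed subspace (`mem_of_coisotropic`). For the converse,
on a principal orbit `ρ` is trivial on `S`, hence modulo `T`. If `v` is orthogonal to `T`, then so
is `A v`, which therefore lies in `T` by hypothesis; and `v` agrees with `A v` modulo `T`
(`mem_of_coisotropic_fixed`).

To pass between dense subsets of `M` and of `M^H`, the principal orbit theorem is proved
(`exists_le_stabilizer_smul`): points with isotropy conjugate to `H` are dense, and `H` is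
subconjugate to every isotropy group. Moreover the `L`-orbits are exactly the intersections of `M^H`
with the `G`-orbits (`image_val_orbit_normalizerQuotient`). -/

namespace SymplecticAction

set_option linter.unusedSectionVars false

open Set Filter MeasureTheory

/-! ### Smooth inverse function theorem -/

section LocalInverse

variable {X Y : Type*} [NormedAddCommGroup X] [NormedSpace ℝ X] [CompleteSpace X]
  [NormedAddCommGroup Y] [NormedSpace ℝ Y]

/-- Smooth inverse function theorem: a smooth map with invertible derivative at `a` restricts to
a diffeomorphism between open neighbourhoods. -/
theorem exists_local_diffeo {f : X → Y} {U : Set X} {a : X} (hU : IsOpen U) (ha : a ∈ U)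
    (hf : ContDiffOn ℝ ∞ f U) (f' : X ≃L[ℝ] Y) (hf' : HasFDerivAt f (f' : X →L[ℝ] Y) a) :
    ∃ e : OpenPartialHomeomorph X Y, a ∈ e.source ∧ e.source ⊆ U ∧ (∀ u, e u = f u) ∧
      ContDiffOn ℝ ∞ e e.source ∧ ContDiffOn ℝ ∞ e.symm e.target := by
  have hfa : ContDiffAt ℝ ∞ f a := hf.contDiffAt (hU.mem_nhds ha)
  have hs : HasStrictFDerivAt f (f' : X →L[ℝ] Y) a := hfa.hasStrictFDerivAt' hf' (by simp)
  have hcont : ContinuousOn (fderiv ℝ f) U := hf.continuousOn_fderiv_of_isOpen hU (by simp)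
  -- On this set the derivative stays invertible, so the inverse is smooth on the whole target and
  -- not only at `f a`.
  have hV : IsOpen (U ∩ fderiv ℝ f ⁻¹' range ((↑) : (X ≃L[ℝ] Y) → X →L[ℝ] Y)) :=
    hcont.isOpen_inter_preimage hU ContinuousLinearEquiv.isOpen
  set V := U ∩ fderiv ℝ f ⁻¹' range ((↑) : (X ≃L[ℝ] Y) → X →L[ℝ] Y) with hVdef
  set e₀ := hs.toOpenPartialHomeomorph f with he₀
  have hcoe : ∀ u, e₀ u = f u := fun u => by
    rw [he₀, HasStrictFDerivAt.toOpenPartialHomeomorph_coe]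
  have hsrc : (e₀.restrOpen V hV).source = e₀.source ∩ V := rfl
  refine ⟨e₀.restrOpen V hV, ?_, ?_, ?_, ?_, ?_⟩
  · rw [hsrc]
    exact ⟨hs.mem_toOpenPartialHomeomorph_source, ha, f', hf'.fderiv.symm⟩
  · rw [hsrc]
    exact fun u hu => hu.2.1
  · exact hcoe
  · refine (hf.mono ?_).congr fun u _ => hcoe u
    rw [hsrc]
    exact fun u hu => hu.2.1
  · intro w hw
    set e := e₀.restrOpen V hV
    have hu : e.symm w ∈ e.source := e.map_target hw
    have hu' : e.symm w ∈ e₀.source ∩ V := hu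
    obtain ⟨g', hg'⟩ := hu'.2.2
    have hcd : ContDiffAt ℝ ∞ f (e.symm w) := hf.contDiffAt (hU.mem_nhds hu'.2.1)
    have hfe : (e : X → Y) = f := funext hcoe
    refine (e.contDiffAt_symm (f₀' := g') hw ?_ ?_).contDiffWithinAt
    · rw [hfe, hg']
      exact (hcd.differentiableAt (by simp)).hasFDerivAt
    · rw [hfe]
      exact hcd

end LocalInverse

/-! ### Smoothness of integrals over a compact space -/

section ParametricIntegral

open MeasureTheory

variable {K : Type*} [TopologicalSpace K] [CompactSpace K] [MeasurableSpace K]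
  [OpensMeasurableSpace K] (μ : Measure K) [IsFiniteMeasureOnCompacts μ]
  {E F : Type*} [NormedAddCommGroup E] [NormedSpace ℝ E]
  [NormedAddCommGroup F] [NormedSpace ℝ F] [CompleteSpace F]

theorem integrable_of_continuous {f : K → F} (hf : Continuous f) : Integrable f μ :=
  hf.integrable_of_hasCompactSupport (HasCompactSupport.of_compactSpace f)

theorem continuous_section {f : K → E → F} {U : Set E}
    (hf : ContinuousOn (fun q : K × E => f q.1 q.2) (univ ×ˢ U)) {v : E} (hv : v ∈ U) :
    Continuous fun k => f k v :=
  hf.comp_continuous (f := fun k : K => (k, v)) (by fun_prop) fun _ => ⟨mem_univ _, hv⟩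

/-- Differentiation under an integral over a compact space. -/
theorem hasFDerivAt_integral_of_compact {f : K → E → F} {f' : K → E → E →L[ℝ] F} {U : Set E}
    (hU : IsOpen U) (hf : ContinuousOn (fun q : K × E => f q.1 q.2) (univ ×ˢ U))
    (hf' : ContinuousOn (fun q : K × E => f' q.1 q.2) (univ ×ˢ U))
    (hd : ∀ k, ∀ v ∈ U, HasFDerivAt (f k) (f' k v) v) {v : E} (hv : v ∈ U) :
    HasFDerivAt (fun w => ∫ k, f k w ∂μ) (∫ k, f' k v ∂μ) v := by
  have hc' := continuous_section hf' hv
  obtain ⟨C, hC⟩ := (isCompact_univ (X := K)).exists_bound_of_continuousOn hc'.continuousOn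
  -- By compactness of `K`, the bound `C` valid at `v` survives as `C + 1` on one neighbourhood of
  -- `v` for all `k`; this constant is the dominating function.
  have hev : ∀ᶠ w in 𝓝 v, ∀ k ∈ (univ : Set K), ‖f' k w‖ < C + 1 := by
    refine isCompact_univ.eventually_forall_of_forall_eventually fun k _ => ?_
    have hca : ContinuousAt (fun q : K × E => f' q.1 q.2) (k, v) :=
      hf'.continuousAt ((isOpen_univ.prod hU).mem_nhds ⟨mem_univ _, hv⟩)
    have hlt : ‖f' k v‖ < C + 1 := (hC k (mem_univ _)).trans_lt (lt_add_one C)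
    exact (continuous_swap.tendsto (v, k)).eventually (hca.norm.eventually (gt_mem_nhds hlt))
  refine hasFDerivAt_integral_of_dominated_of_fderiv_le (F := fun w k => f k w)
    (F' := fun w k => f' k w) (bound := fun _ => C + 1)
    (s := {w | w ∈ U ∧ ∀ k ∈ (univ : Set K), ‖f' k w‖ < C + 1}) ?_ ?_ ?_ ?_ ?_ ?_ ?_
  · exact (hU.eventually_mem hv).and hev
  · filter_upwards [hU.mem_nhds hv] with w hw
    exact (integrable_of_continuous μ (continuous_section hf hw)).1
  · exact integrable_of_continuous μ (continuous_section hf hv)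
  · exact (integrable_of_continuous μ hc').1
  · exact ae_of_all _ fun k w hw => (hw.2 k (mem_univ _)).le
  · exact integrable_of_continuous μ continuous_const
  · exact ae_of_all _ fun k w hw => hd k w hw.1

/-- The integral over a compact space of a family of functions, smooth in the variable with
jointly continuous derivatives, is smooth. -/
theorem contDiffOn_integral_of_compact {f : K → E → F} {U : Set E} (hU : IsOpen U)
    (hf : ∀ k, ContDiffOn ℝ ∞ (f k) U)
    (hc : ∀ n : ℕ, ContinuousOn (fun q : K × E => iteratedFDeriv ℝ n (f q.1) q.2) (univ ×ˢ U)) :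
    ContDiffOn ℝ ∞ (fun v => ∫ k, f k v ∂μ) U := by
  have hstep : ∀ (n : ℕ), ∀ v ∈ U, HasFDerivAt (fun w => ∫ k, iteratedFDeriv ℝ n (f k) w ∂μ)
      (∫ k, (iteratedFDeriv ℝ (n + 1) (f k) v).curryLeft ∂μ) v := by
    intro n v hv
    refine hasFDerivAt_integral_of_compact (f := fun k => iteratedFDeriv ℝ n (f k))
      (f' := fun k v => (iteratedFDeriv ℝ (n + 1) (f k) v).curryLeft) μ hU (hc n) ?_ ?_ hv
    · exact (continuousMultilinearCurryLeftEquiv ℝ (fun _ => E) F).continuous.comp_continuousOn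
        (hc (n + 1))
    · intro k w hw
      have h1 : ContDiffAt ℝ ∞ (f k) w := (hf k).contDiffAt (hU.mem_nhds hw)
      have h2 : DifferentiableAt ℝ (iteratedFDeriv ℝ n (f k)) w :=
        h1.differentiableAt_iteratedFDeriv (by exact_mod_cast WithTop.coe_lt_top n)
      have h3 := h2.hasFDerivAt
      rwa [fderiv_iteratedFDeriv] at h3
  -- Integrating the Taylor series of the `f k` termwise gives a Taylor series of the integral,
  -- which settles all orders at once.
  have hF : HasFTaylorSeriesUpToOn ((⊤ : ℕ∞) : WithTop ℕ∞) (fun v => ∫ k, f k v ∂μ)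
      (fun v n => ∫ k, iteratedFDeriv ℝ n (f k) v ∂μ) U := by
    refine ⟨?_, ?_, ?_⟩
    · intro v hv
      have h := (continuousMultilinearCurryFin0 ℝ E F).toContinuousLinearEquiv.integral_comp_comm
        (μ := μ) (fun k => iteratedFDeriv ℝ 0 (f k) v)
      refine Eq.trans h.symm ?_
      refine integral_congr_ae (ae_of_all _ fun k => ?_)
      simp
    · intro n _ v hv
      let L : (E [×(n + 1)]→L[ℝ] F) ≃L[ℝ] (E →L[ℝ] E [×n]→L[ℝ] F) :=
        (continuousMultilinearCurryLeftEquiv ℝ (fun _ : Fin (n + 1) => E)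
          F).toContinuousLinearEquiv
      have h := ContinuousLinearMap.integral_comp_comm (𝕜 := ℝ) (μ := μ)
        (Fₗ := E →L[ℝ] E [×n]→L[ℝ] F) L.toContinuousLinearMap
        (integrable_of_continuous μ (continuous_section
          (f := fun k => iteratedFDeriv ℝ (n + 1) (f k)) (hc (n + 1)) hv))
      exact (((hstep n v hv).congr_fderiv h)).hasFDerivWithinAt
    · intro n _ v hv
      exact (hstep n v hv).continuousAt.continuousWithinAt
  exact hF.contDiffOn

theorem hasFDerivAt_integral_of_contDiffOn {f : K → E → F} {U : Set E} (hU : IsOpen U)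
    (hf : ∀ k, ContDiffOn ℝ ∞ (f k) U)
    (hc : ∀ n : ℕ, ContinuousOn (fun q : K × E => iteratedFDeriv ℝ n (f q.1) q.2) (univ ×ˢ U))
    {v : E} (hv : v ∈ U) :
    HasFDerivAt (fun v => ∫ k, f k v ∂μ) (∫ k, fderiv ℝ (f k) v ∂μ) v := by
  refine hasFDerivAt_integral_of_compact (f' := fun k => fderiv ℝ (f k)) μ hU ?_ ?_ ?_ hv
  · have := (continuousMultilinearCurryFin0 ℝ E F).continuous.comp_continuousOn (hc 0)
    refine this.congr fun q _ => ?_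
    simp
  · have := (continuousMultilinearCurryFin1 ℝ E F).continuous.comp_continuousOn (hc 1)
    refine this.congr fun q _ => ?_
    ext w
    simp
  · intro k w hw
    exact (((hf k).contDiffAt (hU.mem_nhds hw)).differentiableAt (by simp)).hasFDerivAt

end ParametricIntegral

/-! ### Constant rank theorem -/

section ConstantRank

variable {X Y E : Type*} [NormedAddCommGroup X] [NormedSpace ℝ X] [FiniteDimensional ℝ X]
  [NormedAddCommGroup Y] [NormedSpace ℝ Y] [CompleteSpace Y]
  [NormedAddCommGroup E] [NormedSpace ℝ E] [FiniteDimensional ℝ E]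

/-- By the dimension count, `p` restricted to the range of `L` is a surjection between spaces of
equal dimension, hence injective. -/
theorem eq_zero_of_surjective_of_finrank_range_le {T : Submodule ℝ E} (L : X →ₗ[ℝ] E)
    (p : E →ₗ[ℝ] T) (hs : Function.Surjective (p ∘ₗ L))
    (hr : Module.finrank ℝ L.range ≤ Module.finrank ℝ T) (w : X) (hw : p (L w) = 0) :
    L w = 0 := by
  set q : L.range →ₗ[ℝ] T := p ∘ₗ L.range.subtype with hq
  have hqs : Function.Surjective q := fun t => by
    obtain ⟨x, hx⟩ := hs t
    exact ⟨⟨L x, x, rfl⟩, hx⟩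
  have hle : Module.finrank ℝ T ≤ Module.finrank ℝ L.range :=
    LinearMap.finrank_le_finrank_of_surjective hqs
  have hqi := (LinearMap.injective_iff_surjective_of_finrank_eq_finrank (le_antisymm hr hle)).2 hqs
  have h0 : (⟨L w, w, rfl⟩ : L.range) = 0 := hqi (by simpa [hq] using hw)
  exact congrArg Subtype.val h0

/-- A diffeomorphism shearing a graph over `T` onto `T`. -/
theorem exists_shear {T : Submodule ℝ E} (p : E →L[ℝ] T) (hp : ∀ t : T, p t = t)
    {B : Set T} (hB : IsOpen B) {s : T → E} (hs : ContDiffOn ℝ ∞ s B) (hps : ∀ t ∈ B, p (s t) = t) :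
    ∃ θ : OpenPartialHomeomorph E E, θ.source = p ⁻¹' B ∧ (∀ v, θ v = v - (s (p v) - p v)) ∧
      ContDiffOn ℝ ∞ θ θ.source ∧ ContDiffOn ℝ ∞ θ.symm θ.target := by
  have hc : ContDiffOn ℝ ∞ (fun v => s (p v) - (p v : E)) (p ⁻¹' B) := by
    refine ContDiffOn.sub ?_ ?_
    · exact hs.comp p.contDiff.contDiffOn fun v hv => hv
    · exact (T.subtypeL.contDiff.comp p.contDiff).contDiffOn
  have h1 : ContDiffOn ℝ ∞ (fun v => v - (s (p v) - (p v : E))) (p ⁻¹' B) := contDiffOn_id.sub hc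
  have h2 : ContDiffOn ℝ ∞ (fun v => v + (s (p v) - (p v : E))) (p ⁻¹' B) := contDiffOn_id.add hc
  -- The correction `s (p v) - p v` is killed by `p`, so adding and subtracting it both preserve `p
  -- v` and are inverse to each other.
  have hpm : ∀ v, p v ∈ B → p (v - (s (p v) - (p v : E))) = p v := fun v hv => by
    rw [map_sub, map_sub, hps _ hv, hp, sub_self, sub_zero]
  have hpp : ∀ v, p v ∈ B → p (v + (s (p v) - (p v : E))) = p v := fun v hv => by
    rw [map_add, map_sub, hps _ hv, hp, sub_self, add_zero]
  refine ⟨{ toFun := fun v => v - (s (p v) - (p v : E))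
            invFun := fun v => v + (s (p v) - (p v : E))
            source := p ⁻¹' B
            target := p ⁻¹' B
            map_source' := fun v hv => by
              rw [mem_preimage, hpm v hv]; exact hv
            map_target' := fun v hv => by
              rw [mem_preimage, hpp v hv]; exact hv
            left_inv' := fun v hv => by
              simp only [hpm v hv]; abel
            right_inv' := fun v hv => by
              simp only [hpp v hv]; abel
            open_source := hB.preimage p.continuous
            open_target := hB.preimage p.continuous
            continuousOn_toFun := h1.continuousOn
            continuousOn_invFun := h2.continuousOn }, rfl, fun v => rfl, h1, h2⟩

/-- Constant rank theorem: a smooth map whose rank is maximal at `0` is, in suitable coordinates of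
source and target, the projection onto the range of its derivative at `0`. -/
theorem constant_rank {f : X → E} {U : Set X} (hU : IsOpen U) (h0 : (0 : X) ∈ U)
    (hf : ContDiffOn ℝ ∞ f U) (hf0 : f 0 = 0) {T : Submodule ℝ E}
    (hT : (fderiv ℝ f 0 : X →ₗ[ℝ] E).range = T)
    (hr : ∀ u ∈ U, Module.finrank ℝ (fderiv ℝ f u : X →ₗ[ℝ] E).range ≤ Module.finrank ℝ T)
    (κ : X →L[ℝ] Y) (hκ : (κ : X →ₗ[ℝ] Y).range = ⊤)
    (hcompl : IsCompl (fderiv ℝ f 0 : X →ₗ[ℝ] E).ker (κ : X →ₗ[ℝ] Y).ker) :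
    ∃ (θ : OpenPartialHomeomorph E E) (Λ : OpenPartialHomeomorph X (T × Y)),
      (0 : E) ∈ θ.source ∧ θ 0 = 0 ∧
      ContDiffOn ℝ ∞ θ θ.source ∧ ContDiffOn ℝ ∞ θ.symm θ.target ∧
      (0 : X) ∈ Λ.source ∧ Λ.source ⊆ U ∧ Λ 0 = 0 ∧
      ContDiffOn ℝ ∞ Λ Λ.source ∧ ContDiffOn ℝ ∞ Λ.symm Λ.target ∧
      (∀ u ∈ Λ.source, f u ∈ θ.source ∧ θ (f u) = (Λ u).1) ∧
      (∀ u, (Λ u).2 = κ u) := by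
  obtain ⟨p, hp⟩ := Submodule.ClosedComplemented.of_finiteDimensional (𝕜 := ℝ) T
  have hTmem : ∀ w, fderiv ℝ f 0 w ∈ T := fun w => hT ▸ ⟨w, rfl⟩
  have hfd : ∀ u ∈ U, HasFDerivAt f (fderiv ℝ f u) u := fun u hu =>
    ((hf.contDiffAt (hU.mem_nhds hu)).differentiableAt (by simp)).hasFDerivAt
  -- The source coordinates are `p ∘ f` completed by `κ`. The complementarity of the two kernels
  -- makes the derivative at `0` invertible.
  set h : X → T × Y := fun u => (p (f u), κ u) with hh
  have hhd : ∀ u ∈ U, HasFDerivAt h ((p.comp (fderiv ℝ f u)).prod κ) u := fun u hu =>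
    (p.hasFDerivAt.comp u (hfd u hu)).prodMk κ.hasFDerivAt
  have hcd : ContDiffOn ℝ ∞ h U := (p.contDiff.comp_contDiffOn hf).prodMk κ.contDiff.contDiffOn
  have hker : (p.comp (fderiv ℝ f 0) : X →ₗ[ℝ] T).ker = (fderiv ℝ f 0 : X →ₗ[ℝ] E).ker := by
    ext w
    simp only [LinearMap.mem_ker, ContinuousLinearMap.coe_coe, ContinuousLinearMap.comp_apply]
    constructor
    · intro hw
      have := hp ⟨_, hTmem w⟩
      rw [hw] at this
      exact (congrArg Subtype.val this).symm
    · intro hw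
      rw [hw, map_zero]
  have hran : (p.comp (fderiv ℝ f 0) : X →ₗ[ℝ] T).range = ⊤ := by
    rw [LinearMap.range_eq_top]
    rintro ⟨t, ht⟩
    rw [← hT] at ht
    obtain ⟨w, rfl⟩ := ht
    exact ⟨w, hp ⟨_, hTmem w⟩⟩
  have hcont : ContinuousOn (fun u => (p.comp (fderiv ℝ f u)).prod κ) U := by
    have h1 : ContinuousOn (fderiv ℝ f) U := hf.continuousOn_fderiv_of_isOpen hU (by simp)
    have h2 : ContinuousOn (fderiv ℝ h) U := hcd.continuousOn_fderiv_of_isOpen hU (by simp)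
    exact h2.congr fun u hu => (hhd u hu).fderiv.symm
  have hV := hcont.isOpen_inter_preimage hU
    (ContinuousLinearEquiv.isOpen (𝕜 := ℝ) (E := X) (F := T × Y))
  set V := U ∩ (fun u => (p.comp (fderiv ℝ f u)).prod κ) ⁻¹'
    range ((↑) : (X ≃L[ℝ] T × Y) → X →L[ℝ] T × Y) with hVdef
  let L₀ := (p.comp (fderiv ℝ f 0)).equivProdOfSurjectiveOfIsCompl κ hran hκ (hker ▸ hcompl)
  have hL₀ : (L₀ : X →L[ℝ] T × Y) = (p.comp (fderiv ℝ f 0)).prod κ := by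
    ext w <;> rfl
  have h0V : (0 : X) ∈ V := ⟨h0, L₀, hL₀⟩
  obtain ⟨Λ₀, hΛ0, hΛV, hΛh, hΛs, hΛi⟩ := exists_local_diffeo hV h0V (hcd.mono fun u hu => hu.1) L₀
    (hL₀ ▸ hhd 0 h0)
  have hΛ00 : Λ₀ 0 = 0 := by
    rw [hΛh, hh]
    simp only [hf0, map_zero, Prod.mk_zero_zero]
  have h0t : (0 : T × Y) ∈ Λ₀.target := hΛ00 ▸ Λ₀.map_source hΛ0
  obtain ⟨r, hr0, hball⟩ := Metric.isOpen_iff.1 Λ₀.open_target _ h0t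
  set g : T × Y → E := fun q => f (Λ₀.symm q) with hg
  have hpg : ∀ q ∈ Λ₀.target, p (g q) = q.1 := fun q hq => by
    have h1 := Λ₀.right_inv hq
    rw [hΛh] at h1
    exact congrArg Prod.fst h1
  have hgd : ContDiffOn ℝ ∞ g Λ₀.target :=
    hf.comp hΛi fun q hq => (hΛV (Λ₀.map_target hq)).1
  have hgF : ∀ q ∈ Λ₀.target, HasFDerivAt g
      ((fderiv ℝ f (Λ₀.symm q)).comp (fderiv ℝ Λ₀.symm q)) q := fun q hq =>
    (hfd _ (hΛV (Λ₀.map_target hq)).1).comp q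
      ((hΛi.contDiffAt (Λ₀.open_target.mem_nhds hq)).differentiableAt (by simp)).hasFDerivAt
  -- Since `p (g (t, y)) = t`, the derivative in the direction of `y` is killed by `p`; and `p` is
  -- injective on the range of the derivative of `f`, because the rank nowhere exceeds `dim T`.
  have hgY : ∀ q ∈ Λ₀.target, ∀ y : Y, fderiv ℝ g q (0, y) = 0 := by
    intro q hq y
    have hu := hΛV (Λ₀.map_target hq)
    rw [(hgF q hq).fderiv]
    refine eq_zero_of_surjective_of_finrank_range_le (fderiv ℝ f (Λ₀.symm q) : X →ₗ[ℝ] E)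
      (p : E →ₗ[ℝ] T) ?_ (hr _ hu.1) (fderiv ℝ Λ₀.symm q (0, y)) ?_
    · obtain ⟨e, he⟩ := hu.2
      intro t
      obtain ⟨w, hw⟩ := e.surjective (t, 0)
      refine ⟨w, ?_⟩
      have h1 : (e : X →L[ℝ] T × Y) w = (t, 0) := hw
      rw [he] at h1
      exact congrArg Prod.fst h1
    · have h1 : HasFDerivAt (fun q => p (g q)) (p.comp (fderiv ℝ g q)) q :=
        p.hasFDerivAt.comp q (hgF q hq).differentiableAt.hasFDerivAt
      have h2 : HasFDerivAt (fun q => p (g q)) (ContinuousLinearMap.fst ℝ T Y) q := by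
        refine (ContinuousLinearMap.fst ℝ T Y).hasFDerivAt.congr_of_eventuallyEq ?_
        filter_upwards [Λ₀.open_target.mem_nhds hq] with q' hq'
        exact hpg q' hq'
      have h3 := congrArg (fun A : T × Y →L[ℝ] T => A (0, y)) (h1.unique h2)
      rw [(hgF q hq).fderiv] at h3
      exact h3
  -- The ball for the maximum norm is a product of balls, so `g` has zero derivative along a
  -- connected slice in the direction of `y`.
  have hgc : ∀ t y, (t, y) ∈ Metric.ball (0 : T × Y) r → g (t, y) = g (t, 0) := by
    intro t y hty
    have hty' : ‖t‖ < r ∧ ‖y‖ < r := by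
      rw [mem_ball_zero_iff, Prod.norm_def] at hty
      exact max_lt_iff.1 hty
    have hmem : ∀ y' ∈ Metric.ball (0 : Y) r, (t, y') ∈ Λ₀.target := fun y' hy' => by
      refine hball ?_
      rw [mem_ball_zero_iff, Prod.norm_def]
      exact max_lt hty'.1 (mem_ball_zero_iff.1 hy')
    have hd : ∀ y' ∈ Metric.ball (0 : Y) r,
        HasFDerivAt (fun y' => g (t, y')) (0 : Y →L[ℝ] E) y' := fun y' hy' => by
      have h1 := (hgF _ (hmem y' hy')).differentiableAt.hasFDerivAt.comp y'
        (hasFDerivAt_prodMk_right t y')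
      refine h1.congr_fderiv ?_
      ext w
      exact hgY _ (hmem y' hy') w
    refine Metric.isOpen_ball.is_const_of_fderiv_eq_zero (𝕜 := ℝ) (f := fun y' => g (t, y'))
      (convex_ball (0 : Y) r).isPreconnected
      (fun y' hy' => (hd y' hy').differentiableAt.differentiableWithinAt)
      (fun y' hy' => (hd y' hy').fderiv) (mem_ball_zero_iff.2 hty'.2) (Metric.mem_ball_self hr0)
  have hmem0 : ∀ t ∈ Metric.ball (0 : T) r, (t, (0 : Y)) ∈ Λ₀.target := fun t ht => by
    refine hball ?_
    rw [mem_ball_zero_iff, Prod.norm_def]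
    exact max_lt (mem_ball_zero_iff.1 ht) (by rwa [norm_zero])
  -- Locally the image of `f` is thus the graph of `t ↦ g (t, 0)` over `T`; the shear straightens
  -- it.
  obtain ⟨θ, hθs, hθv, hθ1, hθ2⟩ := exists_shear p hp (B := Metric.ball 0 r) Metric.isOpen_ball
    (s := fun t => g (t, 0))
    (hgd.comp (contDiff_prodMk_left (0 : Y)).contDiffOn hmem0)
    (fun t ht => hpg _ (hmem0 t ht))
  have hg0 : g (0, 0) = 0 := by
    have : Λ₀.symm (0, 0) = 0 := by
      have := Λ₀.left_inv hΛ0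
      rwa [hΛ00] at this
    rw [hg]
    simp only [this, hf0]
  have hW : IsOpen (Λ₀.source ∩ Λ₀ ⁻¹' Metric.ball (0 : T × Y) r) :=
    Λ₀.isOpen_inter_preimage Metric.isOpen_ball
  refine ⟨θ, Λ₀.restrOpen _ hW, ?_, ?_, hθ1, hθ2, ⟨hΛ0, hΛ0, ?_⟩, ?_, hΛ00,
    hΛs.mono inter_subset_left, hΛi.mono ?_, ?_, ?_⟩
  · rw [hθs, mem_preimage, map_zero]
    exact Metric.mem_ball_self hr0
  · rw [hθv, map_zero, ZeroMemClass.coe_zero, hg0, sub_zero, sub_zero]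
  · rw [mem_preimage, hΛ00]
    exact Metric.mem_ball_self hr0
  · exact fun u hu => (hΛV hu.1).1
  · exact fun q hq => hq.1
  · rintro u ⟨hu, -, hub⟩
    have hΛu : Λ₀ u = (p (f u), κ u) := hΛh u
    rw [mem_preimage, hΛu] at hub
    have hpb : ‖p (f u)‖ < r := by
      rw [mem_ball_zero_iff, Prod.norm_def] at hub
      exact (max_lt_iff.1 hub).1
    have hfg : f u = g (p (f u), 0) := by
      rw [← hgc _ _ hub, ← hΛu, hg]
      simp only [Λ₀.left_inv hu]
    refine ⟨?_, ?_⟩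
    · rw [hθs]
      exact mem_ball_zero_iff.2 hpb
    · have e1 : ((Λ₀.restrOpen _ hW) u).1 = p (f u) := congrArg Prod.fst hΛu
      rw [e1, hθv, ← hfg]
      abel
  · intro u
    exact congrArg Prod.snd (hΛh u)

end ConstantRank

/-- Turns membership in a subspace into the vanishing of a continuous linear map, a condition that
passes through derivatives and integrals. -/
theorem exists_clm_ker_eq {E : Type*} [NormedAddCommGroup E] [NormedSpace ℝ E]
    [FiniteDimensional ℝ E] (F : Submodule ℝ E) : ∃ q : E →L[ℝ] E, ∀ v, q v = 0 ↔ v ∈ F := by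
  obtain ⟨p, hp⟩ := Submodule.ClosedComplemented.of_finiteDimensional (𝕜 := ℝ) F
  refine ⟨ContinuousLinearMap.id ℝ E - F.subtypeL.comp p, fun v => ?_⟩
  have h1 : (ContinuousLinearMap.id ℝ E - F.subtypeL.comp p) v = v - (p v : E) := rfl
  rw [h1, sub_eq_zero]
  constructor
  · intro h
    rw [h]
    exact (p v).2
  · intro h
    exact (congrArg Subtype.val (hp ⟨v, h⟩)).symm

theorem HasDerivAt.mem_submodule {E : Type*} [NormedAddCommGroup E] [NormedSpace ℝ E]
    [FiniteDimensional ℝ E] {F : Submodule ℝ E} {c : ℝ → E} {w : E} {t : ℝ}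
    (hc : HasDerivAt c w t) (hF : ∀ᶠ s in 𝓝 t, c s ∈ F) : w ∈ F := by
  obtain ⟨q, hq⟩ := exists_clm_ker_eq F
  have h1 : HasDerivAt (fun s => q (c s)) (q w) t := q.hasFDerivAt.comp_hasDerivAt t hc
  have h2 : HasDerivAt (fun s => q (c s)) 0 t :=
    (hasDerivAt_const t (0 : E)).congr_of_eventuallyEq (by
      filter_upwards [hF] with s hs using (hq _).2 hs)
  exact (hq w).1 (h1.unique h2)

/-! ### Charts and tangent spaces of submanifolds -/

section Charts

variable {E : Type*} [NormedAddCommGroup E] [NormedSpace ℝ E]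
  {M : Type*} [TopologicalSpace M] [ChartedSpace E M] [IsManifold 𝓘(ℝ, E) ∞ M]

theorem trans_mem_maximalAtlas {φ : OpenPartialHomeomorph M E}
    (hφ : φ ∈ IsManifold.maximalAtlas 𝓘(ℝ, E) ∞ M) (θ : OpenPartialHomeomorph E E)
    (h1 : ContDiffOn ℝ ∞ θ θ.source) (h2 : ContDiffOn ℝ ∞ θ.symm θ.target) :
    φ.trans θ ∈ IsManifold.maximalAtlas 𝓘(ℝ, E) ∞ M := by
  refine OpenPartialHomeomorph.mem_maximalAtlas_of_contMDiffOn _ ?_ ?_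
  · rw [OpenPartialHomeomorph.trans_source]
    exact (contMDiffOn_iff_contDiffOn.2 h1).comp
      ((contMDiffOn_of_mem_maximalAtlas hφ).mono inter_subset_left) fun x hx => hx.2
  · rw [OpenPartialHomeomorph.trans_target]
    exact (contMDiffOn_symm_of_mem_maximalAtlas hφ).comp
      ((contMDiffOn_iff_contDiffOn.2 h2).mono inter_subset_left) fun x hx => hx.2

theorem restrOpen_mem_maximalAtlas {φ : OpenPartialHomeomorph M E}
    (hφ : φ ∈ IsManifold.maximalAtlas 𝓘(ℝ, E) ∞ M) {s : Set M} (hs : IsOpen s) :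
    φ.restrOpen s hs ∈ IsManifold.maximalAtlas 𝓘(ℝ, E) ∞ M := by
  refine OpenPartialHomeomorph.mem_maximalAtlas_of_contMDiffOn _ ?_ ?_
  · exact (contMDiffOn_of_mem_maximalAtlas hφ).mono fun x hx => hx.1
  · exact (contMDiffOn_symm_of_mem_maximalAtlas hφ).mono fun x hx => hx.1

theorem exists_centered_chart (z : M) : ∃ φ ∈ IsManifold.maximalAtlas 𝓘(ℝ, E) ∞ M,
    z ∈ φ.source ∧ φ z = 0 := by
  refine ⟨_, trans_mem_maximalAtlas (IsManifold.chart_mem_maximalAtlas z)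
    (Homeomorph.addRight (-(chartAt E z z))).toOpenPartialHomeomorph ?_ ?_, ?_, ?_⟩
  · exact (contDiff_id.add contDiff_const).contDiffOn
  · exact (contDiff_id.add contDiff_const).contDiffOn
  · simp
  · simp

theorem mdifferentiable_of_mem_maximalAtlas {φ : OpenPartialHomeomorph M E}
    (hφ : φ ∈ IsManifold.maximalAtlas 𝓘(ℝ, E) ∞ M) :
    φ.MDifferentiable 𝓘(ℝ, E) 𝓘(ℝ, E) :=
  ⟨(contMDiffOn_of_mem_maximalAtlas hφ).mdifferentiableOn (by simp),
    (contMDiffOn_symm_of_mem_maximalAtlas hφ).mdifferentiableOn (by simp)⟩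

/-- Splits the equality in the tangent bundle into base point and velocity. -/
theorem exists_tangentSet_curve {S : Set M} {x : M} {v : TangentSpace 𝓘(ℝ, E) x}
    (hv : v ∈ tangentSet (E := E) S x) : ∃ γ : ℝ → M, ContMDiff 𝓘(ℝ, ℝ) 𝓘(ℝ, E) ∞ γ ∧
      (∀ t, γ t ∈ S) ∧ γ 0 = x ∧ (mfderiv 𝓘(ℝ, ℝ) 𝓘(ℝ, E) γ 0 : ℝ →L[ℝ] E) (1 : ℝ) = v := by
  obtain ⟨γ, hγ, hS, h⟩ := hv
  refine ⟨γ, hγ, hS, congrArg Bundle.TotalSpace.proj h, ?_⟩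
  have h2 : HEq (mfderiv 𝓘(ℝ, ℝ) 𝓘(ℝ, E) γ 0 (1 : ℝ)) v := by
    have := (Bundle.TotalSpace.ext_iff.1 h).2
    exact this
  exact eq_of_heq h2

theorem mem_tangentSet_of_curve {S : Set M} {x : M} {v : TangentSpace 𝓘(ℝ, E) x} {γ : ℝ → M}
    (hγ : ContMDiff 𝓘(ℝ, ℝ) 𝓘(ℝ, E) ∞ γ) (hS : ∀ t, γ t ∈ S) (h0 : γ 0 = x)
    (hv : (mfderiv 𝓘(ℝ, ℝ) 𝓘(ℝ, E) γ 0 : ℝ →L[ℝ] E) (1 : ℝ) = v) :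
    v ∈ tangentSet (E := E) S x := by
  refine ⟨γ, hγ, hS, Bundle.TotalSpace.ext h0 ?_⟩
  exact heq_of_eq (show (_ : E) = _ from hv)

/-- A smooth map sends tangent vectors to tangent vectors. -/
theorem mfderiv_mem_tangentSet {f : M → M} (hf : ContMDiff 𝓘(ℝ, E) 𝓘(ℝ, E) ∞ f)
    {S S' : Set M} (hS : MapsTo f S S') {x : M} {v : TangentSpace 𝓘(ℝ, E) x}
    (hv : v ∈ tangentSet (E := E) S x) :
    mfderiv 𝓘(ℝ, E) 𝓘(ℝ, E) f x v ∈ tangentSet (E := E) S' (f x) := by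
  obtain ⟨γ, hγ, hγS, rfl, rfl⟩ := exists_tangentSet_curve hv
  refine mem_tangentSet_of_curve (hf.comp hγ) (fun t => hS (hγS t)) rfl ?_
  rw [mfderiv_comp (I' := 𝓘(ℝ, E)) 0 ((hf.mdifferentiable (by simp)) _)
    ((hγ.mdifferentiable (by simp)) _)]
  rfl

theorem mem_tangentSet_of_mfderiv_mem {e : OpenPartialHomeomorph M E}
    (he : e ∈ IsManifold.maximalAtlas 𝓘(ℝ, E) ∞ M) {S : Set M} {z : M} (hz : z ∈ e.source)
    (hzS : z ∈ S) {F : Submodule ℝ E} (hF : e '' (e.source ∩ S) = e.target ∩ (F : Set E))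
    {v : TangentSpace 𝓘(ℝ, E) z} (hv : (mfderiv 𝓘(ℝ, E) 𝓘(ℝ, E) e z : E →L[ℝ] E) v ∈ F) :
    v ∈ tangentSet (E := E) S z := by
  set w : E := (mfderiv 𝓘(ℝ, E) 𝓘(ℝ, E) e z : E →L[ℝ] E) v with hw
  have hzF : e z ∈ F := ((hF ▸ mem_image_of_mem e ⟨hz, hzS⟩ : e z ∈ e.target ∩ (F : Set E))).2
  obtain ⟨r, hr, hball⟩ := Metric.isOpen_iff.1 e.open_target _ (e.map_source hz)
  set ε : ℝ := r / (2 * (‖w‖ + 1)) with hε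
  have hε0 : 0 < ε := by positivity
  -- A line would leave the chart, and the curve must exist for all times. The sine keeps it within
  -- `r / 2` of `e z` while its velocity at `0` is still `w`.
  set c : ℝ → E := fun t => e z + (ε * Real.sin (t / ε)) • w with hc
  have hcF : ∀ t, c t ∈ F := fun t => F.add_mem hzF (F.smul_mem _ hv)
  have hct : ∀ t, c t ∈ e.target := fun t => by
    refine hball ?_
    rw [Metric.mem_ball, hc, dist_eq_norm, add_sub_cancel_left, norm_smul, Real.norm_eq_abs,
      abs_mul, abs_of_pos hε0]
    have h1 : |Real.sin (t / ε)| ≤ 1 := Real.abs_sin_le_one _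
    calc ε * |Real.sin (t / ε)| * ‖w‖ ≤ ε * 1 * (‖w‖ + 1) := by gcongr; linarith
      _ = r / 2 := by rw [hε]; field_simp
      _ < r := by linarith
  have hcs : ContDiff ℝ ∞ c := by
    refine contDiff_const.add (ContDiff.smul (contDiff_const.mul ?_) contDiff_const)
    exact Real.contDiff_sin.comp (contDiff_id.div_const ε)
  have hcd : HasDerivAt c w 0 := by
    have h1 : HasDerivAt (fun t : ℝ => t / ε) (1 / ε) 0 := (hasDerivAt_id 0).div_const ε
    have h2 := (((h1.sin.const_mul ε).smul_const w).const_add (e z))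
    refine h2.congr_deriv ?_
    rw [zero_div, Real.cos_zero, one_mul, mul_one_div_cancel hε0.ne', one_smul]
  have hc0 : c 0 = e z := by simp [hc]
  have hes := contMDiffOn_symm_of_mem_maximalAtlas he
  have hMD := mdifferentiable_of_mem_maximalAtlas he
  refine mem_tangentSet_of_curve (γ := fun t => e.symm (c t))
    (hes.comp_contMDiff hcs.contMDiff hct) ?_ ?_ ?_
  · intro t
    obtain ⟨y, hy, hyt⟩ := (hF.symm ▸ (⟨hct t, hcF t⟩ : c t ∈ e.target ∩ (F : Set E)) :
      c t ∈ e '' (e.source ∩ S))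
    rw [← hyt, e.left_inv hy.1]
    exact hy.2
  · rw [hc0, e.left_inv hz]
  · have h1 := mfderiv_comp (I := 𝓘(ℝ, ℝ)) (I' := 𝓘(ℝ, E)) (I'' := 𝓘(ℝ, E)) (f := c)
      (g := e.symm) 0 (hMD.mdifferentiableAt_symm (hct 0))
      (hcs.contMDiff.mdifferentiable (by simp) 0)
    have h2 : (mfderiv 𝓘(ℝ, ℝ) 𝓘(ℝ, E) c 0 : ℝ →L[ℝ] E) (1 : ℝ) = w := by
      rw [mfderiv_eq_fderiv]
      exact hcd.deriv
    have h3 : ∀ b, b = e z → (mfderiv 𝓘(ℝ, E) 𝓘(ℝ, E) e.symm b : E →L[ℝ] E) w = v := by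
      rintro _ rfl
      have := hMD.symm_comp_deriv hz
      exact congrArg (fun A : E →L[ℝ] E => A v) this
    have h4 := congrArg (fun A : ℝ →L[ℝ] E => A 1) h1
    refine h4.trans ?_
    refine Eq.trans ?_ (h3 _ hc0)
    exact congrArg (mfderiv 𝓘(ℝ, E) 𝓘(ℝ, E) e.symm (c 0) : E →L[ℝ] E) h2

variable [FiniteDimensional ℝ E]

/-- The tangent space of a submanifold, read in a flattening chart. -/
theorem mem_tangentSet_iff {e : OpenPartialHomeomorph M E}
    (he : e ∈ IsManifold.maximalAtlas 𝓘(ℝ, E) ∞ M) {S : Set M} {z : M} (hz : z ∈ e.source)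
    (hzS : z ∈ S) {F : Submodule ℝ E} (hF : e '' (e.source ∩ S) = e.target ∩ (F : Set E))
    (v : TangentSpace 𝓘(ℝ, E) z) :
    v ∈ tangentSet (E := E) S z ↔ (mfderiv 𝓘(ℝ, E) 𝓘(ℝ, E) e z : E →L[ℝ] E) v ∈ F := by
  refine ⟨fun hv => ?_, mem_tangentSet_of_mfderiv_mem he hz hzS hF⟩
  obtain ⟨γ, hγ, hγS, rfl, rfl⟩ := exists_tangentSet_curve hv
  have hMD := mdifferentiable_of_mem_maximalAtlas he
  have h1 := mfderiv_comp (I := 𝓘(ℝ, ℝ)) (I' := 𝓘(ℝ, E)) (I'' := 𝓘(ℝ, E)) (f := γ)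
    (g := e) 0 (hMD.mdifferentiableAt hz) (hγ.mdifferentiable (by simp) 0)
  have hd : MDifferentiableAt 𝓘(ℝ, ℝ) 𝓘(ℝ, E) (e ∘ γ) 0 :=
    (hMD.mdifferentiableAt hz).comp (I' := 𝓘(ℝ, E)) 0 (hγ.mdifferentiable (by simp) 0)
  have hd' : HasDerivAt (e ∘ γ) (deriv (e ∘ γ) 0) 0 :=
    (mdifferentiableAt_iff_differentiableAt.1 hd).hasDerivAt
  have h2 : deriv (e ∘ γ) 0 ∈ F := by
    refine HasDerivAt.mem_submodule hd' ?_
    have hev : ∀ᶠ t in 𝓝 (0 : ℝ), γ t ∈ e.source :=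
      hγ.continuous.continuousAt.eventually (e.open_source.mem_nhds hz)
    filter_upwards [hev] with t ht
    exact ((hF ▸ mem_image_of_mem e ⟨ht, hγS t⟩ : e (γ t) ∈ e.target ∩ (F : Set E))).2
  rw [mfderiv_eq_fderiv] at h1
  have h3 := congrArg (fun A : ℝ →L[ℝ] E => A 1) h1
  exact (show deriv (e ∘ γ) 0 = _ from h3) ▸ h2

end Charts

/-! ### Consequences of properness -/

section Proper

variable {G M : Type*} [Group G] [TopologicalSpace G] [TopologicalSpace M] [MulAction G M]
  [ProperSMul G M] [T2Space M]

/-- The stabilizer is a closed part of the projection of the fibre of `(g, x) ↦ (g • x, x)` over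
`(z, z)`. -/
theorem isCompact_stabilizer (z : M) : IsCompact (MulAction.stabilizer G z : Set G) := by
  have h1 := (ProperSMul.isProperMap_smul_pair (G := G) (X := M)).isCompact_preimage
    (isCompact_singleton (x := (z, z)))
  refine (h1.image continuous_fst).of_isClosed_subset ?_ ?_
  · have : Continuous fun g : G => g • z := by fun_prop
    exact isClosed_singleton.preimage this
  · intro g hg
    exact ⟨(g, z), by simpa using hg, rfl⟩

/-- Elements moving a point near `z` to a point near `z` lie in a given neighbourhood of the
stabilizer of `z`. -/
theorem eventually_mem_of_smul_eq (z : M) {O : Set G} (hO : IsOpen O)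
    (hz : (MulAction.stabilizer G z : Set G) ⊆ O) :
    ∀ᶠ q in 𝓝 (z, z), ∀ g : G, g • q.2 = q.1 → g ∈ O := by
  -- The proper map `(g, x) ↦ (g • x, x)` is closed, so the pairs linked by some `g` outside `O`
  -- form a closed set, which misses `(z, z)`.
  have hcl := (ProperSMul.isProperMap_smul_pair (G := G) (X := M)).isClosedMap
    _ (hO.isClosed_compl.prod (isClosed_univ (X := M)))
  have hmem : (z, z) ∉ (fun gx : G × M => (gx.1 • gx.2, gx.2)) '' (Oᶜ ×ˢ univ) := by
    rintro ⟨⟨g, x⟩, ⟨hg, -⟩, h⟩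
    simp only [Prod.mk.injEq] at h
    obtain ⟨h1, rfl⟩ := h
    exact hg (hz h1)
  filter_upwards [hcl.isOpen_compl.mem_nhds hmem] with q hq g hg
  by_contra hgO
  exact hq ⟨(g, q.2), ⟨hgO, mem_univ _⟩, by simp [hg]⟩

/-- The same with the neighbourhood `N * K` of the stabilizer `K`. -/
theorem eventually_exists_mem_stabilizer [IsTopologicalGroup G] (z : M) {N : Set G}
    (hN : N ∈ 𝓝 (1 : G)) :
    ∀ᶠ q in 𝓝 (z, z), ∀ g : G, g • q.2 = q.1 →
      ∃ n ∈ N, ∃ k ∈ MulAction.stabilizer G z, g = n * k := by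
  have hO : IsOpen (⋃ k ∈ MulAction.stabilizer G z, (fun g => g * k⁻¹) ⁻¹' interior N) :=
    isOpen_biUnion fun k _ => isOpen_interior.preimage (by fun_prop)
  have hsub : (MulAction.stabilizer G z : Set G) ⊆
      ⋃ k ∈ MulAction.stabilizer G z, (fun g => g * k⁻¹) ⁻¹' interior N := by
    intro k hk
    refine mem_iUnion₂.2 ⟨k, hk, ?_⟩
    simpa using mem_interior_iff_mem_nhds.2 hN
  filter_upwards [eventually_mem_of_smul_eq z hO hsub] with q hq g hg
  obtain ⟨k, hk, hgk⟩ := mem_iUnion₂.1 (hq g hg)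
  exact ⟨g * k⁻¹, interior_subset hgk, k, hk, by group⟩

end Proper

/-! ### Orbit maps in charts -/

section OrbitMap

variable {EG : Type*} [NormedAddCommGroup EG] [NormedSpace ℝ EG] [FiniteDimensional ℝ EG]
  {G : Type*} [Group G] [TopologicalSpace G] [ChartedSpace EG G] [LieGroup 𝓘(ℝ, EG) ∞ G]
  {E : Type*} [NormedAddCommGroup E] [NormedSpace ℝ E] [FiniteDimensional ℝ E]
  {M : Type*} [TopologicalSpace M] [ChartedSpace E M] [IsManifold 𝓘(ℝ, E) ∞ M]
  [MulAction G M] [ContMDiffSMul 𝓘(ℝ, EG) 𝓘(ℝ, E) ∞ G M]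

/-- The orbit map of `z` in the charts `ψ` of `G` and `φ` of `M`. -/
def orbitMapIn (ψ : OpenPartialHomeomorph G EG) (φ : OpenPartialHomeomorph M E) (z : M) :
    EG → E := fun u => φ (ψ.symm u • z)

/-- The domain of the orbit map in charts. -/
def orbitMapDomain (ψ : OpenPartialHomeomorph G EG) (φ : OpenPartialHomeomorph M E) (z : M) :
    Set EG := ψ.target ∩ ψ.symm ⁻¹' {g | g • z ∈ φ.source}

theorem contMDiff_orbitMap (z : M) : ContMDiff 𝓘(ℝ, EG) 𝓘(ℝ, E) ∞ fun g : G => g • z :=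
  contMDiff_id.smul contMDiff_const

theorem isOpen_orbitMapDomain (ψ : OpenPartialHomeomorph G EG) (φ : OpenPartialHomeomorph M E)
    (z : M) : IsOpen (orbitMapDomain ψ φ z) :=
  ψ.isOpen_inter_preimage_symm (φ.open_source.preimage
    (contMDiff_orbitMap (EG := EG) (E := E) z).continuous)

variable {ψ : OpenPartialHomeomorph G EG} {φ φ' : OpenPartialHomeomorph M E}

theorem contDiffOn_orbitMapIn (hψ : ψ ∈ IsManifold.maximalAtlas 𝓘(ℝ, EG) ∞ G)
    (hφ : φ ∈ IsManifold.maximalAtlas 𝓘(ℝ, E) ∞ M) (z : M) :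
    ContDiffOn ℝ ∞ (orbitMapIn ψ φ z) (orbitMapDomain ψ φ z) := by
  refine contMDiffOn_iff_contDiffOn.1 ?_
  refine (contMDiffOn_of_mem_maximalAtlas hφ).comp (t := φ.source)
    (f := fun u => ψ.symm u • z) ?_ fun u hu => hu.2
  exact (contMDiff_orbitMap z).comp_contMDiffOn
    ((contMDiffOn_symm_of_mem_maximalAtlas hψ).mono inter_subset_left)

/-- The rank of an orbit map does not exceed its rank at the identity. -/
theorem finrank_range_fderiv_orbitMapIn_le (hψ : ψ ∈ IsManifold.maximalAtlas 𝓘(ℝ, EG) ∞ G)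
    (hψ1 : (1 : G) ∈ ψ.source) (hψ0 : ψ 1 = 0)
    (hφ : φ ∈ IsManifold.maximalAtlas 𝓘(ℝ, E) ∞ M)
    (hφ' : φ' ∈ IsManifold.maximalAtlas 𝓘(ℝ, E) ∞ M) {z : M} (hz : z ∈ φ.source) (hz0 : φ z = 0)
    (a : G) {u : EG} (hu : u ∈ orbitMapDomain ψ φ' (a • z)) :
    Module.finrank ℝ (fderiv ℝ (orbitMapIn ψ φ' (a • z)) u : EG →ₗ[ℝ] E).range ≤
      Module.finrank ℝ (fderiv ℝ (orbitMapIn ψ φ z) 0 : EG →ₗ[ℝ] E).range := by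
  have : IsTopologicalGroup G := topologicalGroup_of_lieGroup 𝓘(ℝ, EG) ∞
  have : ContinuousSMul G M := ContMDiffSMul.continuousSMul (n := ∞) (I := 𝓘(ℝ, EG))
    (I' := 𝓘(ℝ, E))
  set g : G := ψ.symm u with hg
  have hsymm0 : ψ.symm 0 = 1 := by rw [← hψ0, ψ.left_inv hψ1]
  have hφsymm0 : φ.symm 0 = z := by rw [← hz0, φ.left_inv hz]
  have h0t : (0 : EG) ∈ ψ.target := hψ0 ▸ ψ.map_source hψ1
  have h0t' : (0 : E) ∈ φ.target := hz0 ▸ φ.map_source hz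
  -- For `h` near `g`, `h • a • z = (g * a) • (a⁻¹ * g⁻¹ * h * a) • z`. So the orbit map of `a • z`
  -- at `u` factors as `A` after the orbit map of `z` after `C`, with `C u = 0`.
  set A : E → E := fun v => φ' ((g * a) • φ.symm v) with hA
  set C : EG → EG := fun u' => ψ (a⁻¹ * g⁻¹ * ψ.symm u' * a) with hC
  have hCu : C u = 0 := by
    have : a⁻¹ * g⁻¹ * ψ.symm u * a = 1 := by rw [← hg]; group
    rw [hC]
    simp only [this, hψ0]
  have hcontC : ContinuousAt (fun u' => a⁻¹ * g⁻¹ * ψ.symm u' * a) u := by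
    have := ψ.continuousAt_symm hu.1
    fun_prop
  have hval : a⁻¹ * g⁻¹ * ψ.symm u * a = 1 := by rw [← hg]; group
  have hev : orbitMapIn ψ φ' (a • z) =ᶠ[𝓝 u] fun u' => A (orbitMapIn ψ φ z (C u')) := by
    have h1 : ∀ᶠ u' in 𝓝 u, a⁻¹ * g⁻¹ * ψ.symm u' * a ∈ ψ.source :=
      hcontC.eventually (by beta_reduce; rw [hval]; exact ψ.open_source.mem_nhds hψ1)
    have h2 : ∀ᶠ u' in 𝓝 u, (a⁻¹ * g⁻¹ * ψ.symm u' * a) • z ∈ φ.source := by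
      have hc : ContinuousAt (fun u' => (a⁻¹ * g⁻¹ * ψ.symm u' * a) • z) u := by fun_prop
      exact hc.eventually (by
        simp only [hval, one_smul]; exact φ.open_source.mem_nhds hz)
    filter_upwards [h1, h2] with u' h1 h2
    simp only [hA, hC, orbitMapIn]
    rw [ψ.left_inv h1, φ.left_inv h2, smul_smul, smul_smul]
    congr 2
    group
  have hAd : DifferentiableAt ℝ A 0 := by
    refine mdifferentiableAt_iff_differentiableAt.1 ?_
    have h1 : MDifferentiableAt 𝓘(ℝ, E) 𝓘(ℝ, E) φ.symm 0 :=
      (mdifferentiable_of_mem_maximalAtlas hφ).mdifferentiableAt_symm h0t'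
    have h2 : MDifferentiableAt 𝓘(ℝ, E) 𝓘(ℝ, E) (fun y : M => (g * a) • y) (φ.symm 0) :=
      (ContMDiffSMul.contMDiff_const_smul (I := 𝓘(ℝ, EG)) (I' := 𝓘(ℝ, E)) (n := ∞)
        (g * a)).mdifferentiable (by simp) _
    have h3 : MDifferentiableAt 𝓘(ℝ, E) 𝓘(ℝ, E) φ' ((g * a) • φ.symm 0) := by
      refine (mdifferentiable_of_mem_maximalAtlas hφ').mdifferentiableAt ?_
      rw [hφsymm0, mul_smul]
      exact hu.2
    exact h3.comp (I' := 𝓘(ℝ, E)) 0 (h2.comp (I' := 𝓘(ℝ, E)) 0 h1)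
  have hCd : DifferentiableAt ℝ C u := by
    refine mdifferentiableAt_iff_differentiableAt.1 ?_
    have h1 : MDifferentiableAt 𝓘(ℝ, EG) 𝓘(ℝ, EG) ψ.symm u :=
      (mdifferentiable_of_mem_maximalAtlas hψ).mdifferentiableAt_symm hu.1
    have h2 : MDifferentiableAt 𝓘(ℝ, EG) 𝓘(ℝ, EG) (fun h : G => a⁻¹ * g⁻¹ * h * a)
        (ψ.symm u) := by
      have : ContMDiff 𝓘(ℝ, EG) 𝓘(ℝ, EG) ∞ (fun h : G => a⁻¹ * g⁻¹ * h * a) :=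
        (contMDiff_const.mul contMDiff_id).mul contMDiff_const
      exact this.mdifferentiable (by simp) _
    have h3 : MDifferentiableAt 𝓘(ℝ, EG) 𝓘(ℝ, EG) ψ (a⁻¹ * g⁻¹ * ψ.symm u * a) := by
      refine (mdifferentiable_of_mem_maximalAtlas hψ).mdifferentiableAt ?_
      rw [hval]
      exact hψ1
    exact h3.comp (I' := 𝓘(ℝ, EG)) u (h2.comp (I' := 𝓘(ℝ, EG)) u h1)
  have h0d : (0 : EG) ∈ orbitMapDomain ψ φ z :=
    ⟨h0t, by rw [mem_preimage, hsymm0]; simpa using hz⟩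
  have hfd : DifferentiableAt ℝ (orbitMapIn ψ φ z) 0 :=
    ((contDiffOn_orbitMapIn hψ hφ z).contDiffAt
      ((isOpen_orbitMapDomain ψ φ z).mem_nhds h0d)).differentiableAt (by simp)
  have hf0 : orbitMapIn ψ φ z 0 = 0 := by simp [orbitMapIn, hsymm0, hz0]
  have hfd' : HasFDerivAt (orbitMapIn ψ φ z) (fderiv ℝ (orbitMapIn ψ φ z) 0) (C u) := by
    rw [hCu]; exact hfd.hasFDerivAt
  have hAd' : HasFDerivAt A (fderiv ℝ A 0) (orbitMapIn ψ φ z (C u)) := by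
    rw [hCu, hf0]; exact hAd.hasFDerivAt
  have hcomp := (hAd'.comp u (hfd'.comp u hCd.hasFDerivAt)).congr_of_eventuallyEq hev
  rw [hcomp.fderiv]
  have hle : ((fderiv ℝ A 0).comp ((fderiv ℝ (orbitMapIn ψ φ z) 0).comp (fderiv ℝ C u)) :
      EG →ₗ[ℝ] E).range ≤ Submodule.map (fderiv ℝ A 0 : E →ₗ[ℝ] E)
        (fderiv ℝ (orbitMapIn ψ φ z) 0 : EG →ₗ[ℝ] E).range := by
    rintro _ ⟨w, rfl⟩
    exact ⟨_, ⟨fderiv ℝ C u w, rfl⟩, rfl⟩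
  exact (Submodule.finrank_mono hle).trans (Submodule.finrank_map_le _ _)

/-- The normal form of an orbit map near the identity. -/
theorem orbitMap_normalForm {Y : Type*} [NormedAddCommGroup Y] [NormedSpace ℝ Y] [CompleteSpace Y]
    (hψ : ψ ∈ IsManifold.maximalAtlas 𝓘(ℝ, EG) ∞ G)
    (hψ1 : (1 : G) ∈ ψ.source) (hψ0 : ψ 1 = 0)
    (hφ : φ ∈ IsManifold.maximalAtlas 𝓘(ℝ, E) ∞ M) {z : M} (hz : z ∈ φ.source) (hz0 : φ z = 0)
    {T : Submodule ℝ E} (hT : (fderiv ℝ (orbitMapIn ψ φ z) 0 : EG →ₗ[ℝ] E).range = T)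
    (κ : EG →L[ℝ] Y) (hκ : (κ : EG →ₗ[ℝ] Y).range = ⊤)
    (hcompl : IsCompl (fderiv ℝ (orbitMapIn ψ φ z) 0 : EG →ₗ[ℝ] E).ker (κ : EG →ₗ[ℝ] Y).ker) :
    ∃ (θ : OpenPartialHomeomorph E E) (Λ : OpenPartialHomeomorph EG (T × Y)),
      (0 : E) ∈ θ.source ∧ θ 0 = 0 ∧
      ContDiffOn ℝ ∞ θ θ.source ∧ ContDiffOn ℝ ∞ θ.symm θ.target ∧
      (0 : EG) ∈ Λ.source ∧ Λ 0 = 0 ∧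
      ContDiffOn ℝ ∞ Λ Λ.source ∧ ContDiffOn ℝ ∞ Λ.symm Λ.target ∧
      (∀ u ∈ Λ.source, u ∈ ψ.target ∧ ψ.symm u • z ∈ (φ.trans θ).source ∧
        φ.trans θ (ψ.symm u • z) = (Λ u).1) ∧
      (∀ u ∈ Λ.source, ψ.symm u • z = z ↔ (Λ u).1 = 0) ∧
      (∀ u, (Λ u).2 = κ u) := by
  have hsymm0 : ψ.symm 0 = 1 := by rw [← hψ0, ψ.left_inv hψ1]
  have h0d : (0 : EG) ∈ orbitMapDomain ψ φ z :=
    ⟨hψ0 ▸ ψ.map_source hψ1, by rw [mem_preimage, hsymm0]; simpa using hz⟩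
  obtain ⟨θ, Λ, hθ0, hθ00, hθ1, hθ2, hΛ0, hΛU, hΛ00, hΛ1, hΛ2, hnf, hκΛ⟩ :=
    -- Taking `a = 1` in the rank comparison shows that the rank is maximal at the identity.
    constant_rank (isOpen_orbitMapDomain ψ φ z) h0d (contDiffOn_orbitMapIn hψ hφ z)
      (by simp [orbitMapIn, hsymm0, hz0]) hT (fun u hu => by
        have := finrank_range_fderiv_orbitMapIn_le hψ hψ1 hψ0 hφ hφ hz hz0 1
          (u := u) (by rwa [one_smul])
        rwa [one_smul, hT] at this) κ hκ hcompl
  have hmain : ∀ u ∈ Λ.source, u ∈ ψ.target ∧ ψ.symm u • z ∈ (φ.trans θ).source ∧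
        φ.trans θ (ψ.symm u • z) = (Λ u).1 := by
    intro u hu
    refine ⟨(hΛU hu).1, ?_, (hnf u hu).2⟩
    rw [OpenPartialHomeomorph.trans_source]
    exact ⟨(hΛU hu).2, (hnf u hu).1⟩
  refine ⟨θ, Λ, hθ0, hθ00, hθ1, hθ2, hΛ0, hΛ00, hΛ1, hΛ2, hmain, ?_, hκΛ⟩
  intro u hu
  obtain ⟨-, h2, h3⟩ := hmain u hu
  have hzs : z ∈ (φ.trans θ).source := by
    rw [OpenPartialHomeomorph.trans_source]
    exact ⟨hz, by rw [mem_preimage, hz0]; exact hθ0⟩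
  have hz' : φ.trans θ z = 0 := by
    rw [OpenPartialHomeomorph.coe_trans, Function.comp_apply, hz0, hθ00]
  constructor
  · intro h
    rw [h, hz'] at h3
    exact Subtype.ext h3.symm
  · intro h
    rw [h] at h3
    exact (φ.trans θ).injOn h2 hzs (h3.trans hz'.symm)

end OrbitMap

theorem exists_clm_isCompl_ker {X : Type*} [NormedAddCommGroup X] [NormedSpace ℝ X]
    [FiniteDimensional ℝ X] (W : Submodule ℝ X) :
    ∃ κ : X →L[ℝ] W, (∀ w : W, κ w = w) ∧ (κ : X →ₗ[ℝ] W).range = ⊤ ∧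
      IsCompl W (κ : X →ₗ[ℝ] W).ker := by
  obtain ⟨κ, hκ⟩ := Submodule.ClosedComplemented.of_finiteDimensional (𝕜 := ℝ) W
  refine ⟨κ, hκ, LinearMap.range_eq_top.2 fun w => ⟨w, hκ w⟩, ?_⟩
  exact LinearMap.isCompl_of_proj (f := (κ : X →ₗ[ℝ] W)) hκ

/-! ### Orbits are embedded; subgroups of finite index -/

section Orbit

variable {EG : Type*} [NormedAddCommGroup EG] [NormedSpace ℝ EG] [FiniteDimensional ℝ EG]
  {G : Type*} [Group G] [TopologicalSpace G] [ChartedSpace EG G] [LieGroup 𝓘(ℝ, EG) ∞ G]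
  {E : Type*} [NormedAddCommGroup E] [NormedSpace ℝ E] [FiniteDimensional ℝ E]
  {M : Type*} [TopologicalSpace M] [ChartedSpace E M] [IsManifold 𝓘(ℝ, E) ∞ M] [T2Space M]
  [MulAction G M] [ContMDiffSMul 𝓘(ℝ, EG) 𝓘(ℝ, E) ∞ G M] [ProperSMul G M]

variable (EG E) in
/-- Around each point there is a chart flattening the orbit, together with a smooth local section
of the orbit map. -/
theorem exists_orbit_chart (z : M) : ∃ φ ∈ IsManifold.maximalAtlas 𝓘(ℝ, E) ∞ M,
    z ∈ φ.source ∧ φ z = 0 ∧ ∃ T : Submodule ℝ E,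
      φ '' (φ.source ∩ MulAction.orbit G z) = φ.target ∩ (T : Set E) ∧
      ∃ τ : E → G, τ 0 = 1 ∧ ContMDiffAt 𝓘(ℝ, E) 𝓘(ℝ, EG) ∞ τ 0 ∧
        ∀ᶠ v in 𝓝 (0 : E), v ∈ T → φ (τ v • z) = v := by
  have : IsTopologicalGroup G := topologicalGroup_of_lieGroup 𝓘(ℝ, EG) ∞
  obtain ⟨ψ, hψ, hψ1, hψ0⟩ := exists_centered_chart (E := EG) (1 : G)
  obtain ⟨φ₀, hφ₀, hz, hz0⟩ := exists_centered_chart (E := E) z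
  obtain ⟨κ, -, hκ, hcompl⟩ :=
    exists_clm_isCompl_ker (fderiv ℝ (orbitMapIn ψ φ₀ z) 0 : EG →ₗ[ℝ] E).ker
  set T := (fderiv ℝ (orbitMapIn ψ φ₀ z) 0 : EG →ₗ[ℝ] E).range with hT
  obtain ⟨θ, Λ, hθ0, hθ00, hθ1, hθ2, hΛ0, hΛ00, hΛ1, hΛ2, hnf, -, -⟩ :=
    orbitMap_normalForm hψ hψ1 hψ0 hφ₀ hz hz0 hT.symm κ hκ hcompl
  obtain ⟨p, hp, -, -⟩ := exists_clm_isCompl_ker T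
  have hsymm0 : ψ.symm 0 = 1 := by rw [← hψ0, ψ.left_inv hψ1]
  have h0ψ : (0 : EG) ∈ ψ.target := hψ0 ▸ ψ.map_source hψ1
  have hΛsymm0 : Λ.symm 0 = 0 := by rw [← hΛ00, Λ.left_inv hΛ0]
  have h0t : (0 : T × _) ∈ Λ.target := hΛ00 ▸ Λ.map_source hΛ0
  set φ₁ := φ₀.trans θ with hφ₁def
  have hφ₁ := trans_mem_maximalAtlas hφ₀ θ hθ1 hθ2
  have hzs : z ∈ φ₁.source := by
    rw [hφ₁def, OpenPartialHomeomorph.trans_source]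
    exact ⟨hz, by rw [mem_preimage, hz0]; exact hθ0⟩
  have hz' : φ₁ z = 0 := by
    rw [hφ₁def, OpenPartialHomeomorph.coe_trans, Function.comp_apply, hz0, hθ00]
  set i : E → T × _ := fun v => (p v, (0 : (fderiv ℝ (orbitMapIn ψ φ₀ z) 0 : EG →ₗ[ℝ] E).ker))
    with hi
  have hic : ContDiff ℝ ∞ i := p.contDiff.prodMk contDiff_const
  have hi0 : i 0 = 0 := by simp [hi]
  -- The section is the inverse of the normal form `Λ` with the second coordinate set to zero.
  set τ : E → G := fun v => ψ.symm (Λ.symm (i v)) with hτ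
  have hτ0 : τ 0 = 1 := by rw [hτ]; simp only [hi0, hΛsymm0, hsymm0]
  have hWo : IsOpen (i ⁻¹' Λ.target) := Λ.open_target.preimage hic.continuous
  have hτφ : ∀ v ∈ i ⁻¹' Λ.target, v ∈ T → τ v • z ∈ φ₁.source ∧ φ₁ (τ v • z) = v := by
    intro v hv hvT
    obtain ⟨-, h2, h3⟩ := hnf _ (Λ.map_target hv)
    refine ⟨h2, h3.trans ?_⟩
    rw [Λ.right_inv hv]
    exact congrArg Subtype.val (hp ⟨v, hvT⟩)
  have hNopen : IsOpen (ψ.source ∩ ψ ⁻¹' Λ.source) := ψ.isOpen_inter_preimage Λ.open_source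
  have hN : ψ.source ∩ ψ ⁻¹' Λ.source ∈ 𝓝 (1 : G) :=
    hNopen.mem_nhds ⟨hψ1, by rw [mem_preimage, hψ0]; exact hΛ0⟩
  -- The normal form only sees the part of the orbit swept by elements near `1`. By properness there
  -- is no other part near `z`: an orbit point close to `z` is `n • z` with `n` in this
  -- neighbourhood. Currying then freezes the second point of the pair at `z`.
  have hev := eventually_exists_mem_stabilizer z hN
  rw [nhds_prod_eq] at hev
  obtain ⟨P, hP, hP'⟩ := (hev.and (Eventually.of_forall fun _ => trivial)).curry.exists_mem
  have hev2 : ∀ᶠ y in 𝓝 z, ∀ g : G, g • z = y →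
      ∃ n ∈ ψ.source ∩ ψ ⁻¹' Λ.source, ∃ k ∈ MulAction.stabilizer G z, g = n * k := by
    filter_upwards [hP] with y hy
    exact (hP' y hy).self_of_nhds.1
  obtain ⟨O, hO, hOo, hzO⟩ := eventually_nhds_iff.1 hev2
  have hR : IsOpen (O ∩ (φ₁.source ∩ φ₁ ⁻¹' (i ⁻¹' Λ.target))) :=
    hOo.inter (φ₁.isOpen_inter_preimage hWo)
  have hzR : z ∈ O ∩ (φ₁.source ∩ φ₁ ⁻¹' (i ⁻¹' Λ.target)) :=
    ⟨hzO, hzs, by rw [mem_preimage, mem_preimage, hz', hi0]; exact h0t⟩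
  refine ⟨φ₁.restrOpen _ hR, restrOpen_mem_maximalAtlas hφ₁ hR, ⟨hzs, hzR⟩, hz', T, ?_, τ, hτ0,
    ?_, ?_⟩
  · apply Subset.antisymm
    · rintro _ ⟨y, ⟨hy, hyo⟩, rfl⟩
      refine ⟨(φ₁.restrOpen _ hR).map_source hy, ?_⟩
      obtain ⟨g, rfl⟩ := hyo
      obtain ⟨n, hn, k, hk, rfl⟩ := hO _ hy.2.1 g rfl
      have h1 := (hnf _ hn.2).2.2
      rw [ψ.left_inv hn.1] at h1
      have h2 : φ₁.restrOpen _ hR ((fun g : G => g • z) (n * k)) = φ₁ (n • z) := by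
        simp only [mul_smul, MulAction.mem_stabilizer_iff.1 hk]
        rfl
      rw [h2, h1]
      exact Subtype.mem _
    · rintro v ⟨hv, hvT⟩
      have h1 := (φ₁.restrOpen _ hR).map_target hv
      have h2 := (φ₁.restrOpen _ hR).right_inv hv
      set y := (φ₁.restrOpen _ hR).symm v
      have h1' : y ∈ φ₁.source ∩ (O ∩ (φ₁.source ∩ φ₁ ⁻¹' (i ⁻¹' Λ.target))) := h1
      have h2' : φ₁ y = v := h2
      have hvi : v ∈ i ⁻¹' Λ.target := h2' ▸ h1'.2.2.2
      obtain ⟨h3, h4⟩ := hτφ v hvi hvT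
      have h5 : τ v • z = y := φ₁.injOn h3 h1'.1 (h4.trans h2'.symm)
      exact ⟨y, ⟨h1, h5 ▸ MulAction.mem_orbit z (τ v)⟩, h2⟩
  · have h1 : ContMDiffAt 𝓘(ℝ, E) 𝓘(ℝ, EG) ∞ (fun v => Λ.symm (i v)) 0 := by
      refine contMDiffAt_iff_contDiffAt.2 ?_
      refine ContDiffAt.comp (g := Λ.symm) 0 ?_ hic.contDiffAt
      rw [hi0]
      exact hΛ2.contDiffAt (Λ.open_target.mem_nhds h0t)
    refine ContMDiffAt.comp (g := ψ.symm) (I' := 𝓘(ℝ, EG)) 0 ?_ h1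
    rw [hi0, hΛsymm0]
    exact contMDiffAt_symm_of_mem_maximalAtlas hψ h0ψ
  · filter_upwards [hWo.mem_nhds (show (0 : E) ∈ i ⁻¹' Λ.target by
      rw [mem_preimage, hi0]; exact h0t)] with v hv hvT
    exact (hτφ v hv hvT).2

/-- Near `1` the groups `H` and `J` agree, so the left cosets of `J` are relatively open in `H`. A
connected subset of `H` containing `1` therefore cannot leave `J`. -/
theorem isPreconnected_subset_of_relOpen [IsTopologicalGroup G] {C N : Set G} {J H : Subgroup G}
    (hN : N ∈ 𝓝 (1 : G)) (hJ : ∀ g ∈ N, g ∈ H → g ∈ J) (hJH : J ≤ H) (hC : IsPreconnected C)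
    (hC1 : (1 : G) ∈ C) (hCH : C ⊆ H) : C ⊆ J := by
  have hopen : ∀ s : Set G, IsOpen (⋃ h ∈ s, (fun g => h⁻¹ * g) ⁻¹' interior N) := fun s =>
    isOpen_biUnion fun k _ => isOpen_interior.preimage (by fun_prop)
  have h1N : (1 : G) ∈ interior N := mem_interior_iff_mem_nhds.2 hN
  have hself : ∀ (s : Set G), ∀ g ∈ s, g ∈ ⋃ h ∈ s, (fun g => h⁻¹ * g) ⁻¹' interior N :=
    fun s g hg => mem_iUnion₂.2 ⟨g, hg, by simpa using h1N⟩
  by_contra hCJ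
  obtain ⟨c, hc, hcJ⟩ := not_subset.1 hCJ
  obtain ⟨d, hdC, hd1, hd2⟩ := hC _ _ (hopen J) (hopen (H \ J : Set G))
    (fun g hg => by
      by_cases hgJ : g ∈ J
      · exact Or.inl (hself _ _ hgJ)
      · exact Or.inr (hself _ _ ⟨hCH hg, hgJ⟩))
    ⟨1, hC1, hself _ _ J.one_mem⟩ ⟨c, hc, hself _ _ ⟨hCH hc, hcJ⟩⟩
  obtain ⟨j, hj, hjd⟩ := mem_iUnion₂.1 hd1
  obtain ⟨h, hh, hhd⟩ := mem_iUnion₂.1 hd2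
  have hdH := hCH hdC
  have e1 : j⁻¹ * d ∈ J := hJ _ (interior_subset hjd) (H.mul_mem (H.inv_mem (hJH hj)) hdH)
  have e2 : h⁻¹ * d ∈ J := hJ _ (interior_subset hhd) (H.mul_mem (H.inv_mem hh.1) hdH)
  refine hh.2 ?_
  have e3 : h = j * (j⁻¹ * d) * (h⁻¹ * d)⁻¹ := by group
  rw [e3]
  exact J.mul_mem (J.mul_mem hj e1) (J.inv_mem e2)

/-- An open subgroup of a compact group has finite index. -/
theorem relIndex_ne_zero_of_relOpen [IsTopologicalGroup G] {N : Set G} {J H : Subgroup G}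
    (hN : N ∈ 𝓝 (1 : G)) (hJ : ∀ g ∈ N, g ∈ H → g ∈ J) (hH : IsCompact (H : Set G)) :
    J.relIndex H ≠ 0 := by
  have : CompactSpace H := isCompact_iff_compactSpace.1 hH
  have hopen : IsOpen ((J.subgroupOf H : Subgroup H) : Set H) := by
    refine Subgroup.isOpen_of_mem_nhds (g := 1) _ ?_
    have : Subtype.val ⁻¹' N ∈ 𝓝 (1 : H) := continuous_subtype_val.continuousAt.preimage_mem_nhds hN
    filter_upwards [this] with g hg
    exact Subgroup.mem_subgroupOf.2 (hJ _ hg g.2)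
  have := Subgroup.quotient_finite_of_isOpen _ hopen
  exact (Subgroup.finiteIndex_iff_finite_quotient.2 this).index_ne_zero

/-- A compact subgroup with a connected neighbourhood of the identity is not conjugate to a proper
subgroup containing a neighbourhood of its identity. -/
theorem le_map_conj_of_relOpen [IsTopologicalGroup G] {H : Subgroup G} (hH : IsCompact (H : Set G))
    {C N₀ N₁ : Set G} (hC : IsPreconnected C) (hC1 : (1 : G) ∈ C) (hCH : C ⊆ H)
    (hN₀ : N₀ ∈ 𝓝 (1 : G)) (hNC : ∀ g ∈ N₀, g ∈ H → g ∈ C) (a : G)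
    (hle : H.map (MulAut.conj a).toMonoidHom ≤ H) (hN₁ : N₁ ∈ 𝓝 (1 : G))
    (hN : ∀ g ∈ N₁, g ∈ H → g ∈ H.map (MulAut.conj a).toMonoidHom) :
    H ≤ H.map (MulAut.conj a).toMonoidHom := by
  set c := (MulAut.conj a).toMonoidHom with hc
  have hinj : Function.Injective c := (MulAut.conj a).injective
  set J := Subgroup.closure C with hJdef
  have hJH : J ≤ H := (Subgroup.closure_le H).2 hCH
  have hJ : ∀ g ∈ N₀, g ∈ H → g ∈ J := fun g hg hgH => Subgroup.subset_closure (hNC g hg hgH)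
  have hn := relIndex_ne_zero_of_relOpen hN₀ hJ hH
  -- Near `1`, `J`, `H` and their conjugates by `a` all contain the elements of `H`, so the
  -- connected set `C` generating `J` lies in the conjugate of `J`.
  have hJ1 : J ≤ J.map c := by
    refine (Subgroup.closure_le _).2 ?_
    have hpre : (fun g : G => a⁻¹ * g * a) ⁻¹' N₀ ∈ 𝓝 (1 : G) := by
      have : Continuous fun g : G => a⁻¹ * g * a := by fun_prop
      exact this.continuousAt.preimage_mem_nhds (by simpa using hN₀)
    refine isPreconnected_subset_of_relOpen (inter_mem hN₁ hpre) ?_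
      ((Subgroup.map_mono hJH).trans hle) hC hC1 hCH
    rintro g ⟨hg1, hg2⟩ hgH
    obtain ⟨h, hh, rfl⟩ := hN g hg1 hgH
    refine ⟨h, hJ h ?_ hh, rfl⟩
    have : a⁻¹ * (c h) * a = h := by
      rw [hc]; simp [MulAut.conj_apply]; group
    rwa [mem_preimage, this] at hg2
  -- With `c` the conjugation, `[H : J] = [cH : J] [H : cH]` and `[cH : J] = [cJ : J] [cH : cJ]`,
  -- where `[cH : cJ] = [H : J]`. As `[H : J]` is finite and nonzero, `[H : cH] = 1`.
  have e1 := Subgroup.relIndex_mul_relIndex _ _ _ (hJ1.trans (Subgroup.map_mono hJH)) hle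
  have e2 := Subgroup.relIndex_mul_relIndex _ _ _ hJ1 (Subgroup.map_mono (f := c) hJH)
  rw [Subgroup.relIndex_map_map_of_injective J H hinj] at e2
  have h4 : (H.map c).relIndex H = 1 := by
    rw [← e2, mul_right_comm] at e1
    have h5 : (J.relIndex (J.map c) * (H.map c).relIndex H) * J.relIndex H = 1 * J.relIndex H := by
      rw [one_mul]; exact e1
    exact Nat.eq_one_of_mul_eq_one_left (Nat.eq_of_mul_eq_mul_right (Nat.pos_of_ne_zero hn) h5)
  exact Subgroup.relIndex_eq_one.1 h4

end Orbit

/-! ### Isotropy groups do not properly contain conjugates of themselves -/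

section Stabilizer

/-- A stabilizer does not properly contain a conjugate of itself. -/
theorem stabilizer_le_of_smul_le
    (EG : Type*) [NormedAddCommGroup EG] [NormedSpace ℝ EG] [FiniteDimensional ℝ EG]
    {G : Type*} [Group G] [TopologicalSpace G] [ChartedSpace EG G] [LieGroup 𝓘(ℝ, EG) ∞ G]
    (E : Type*) [NormedAddCommGroup E] [NormedSpace ℝ E] [FiniteDimensional ℝ E]
    {M : Type*} [TopologicalSpace M] [ChartedSpace E M] [IsManifold 𝓘(ℝ, E) ∞ M] [T2Space M]
    [MulAction G M] [ContMDiffSMul 𝓘(ℝ, EG) 𝓘(ℝ, E) ∞ G M] [ProperSMul G M]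
    {x : M} {a : G}
    (hle : MulAction.stabilizer G (a • x) ≤ MulAction.stabilizer G x) :
    MulAction.stabilizer G x ≤ MulAction.stabilizer G (a • x) := by
  have : IsTopologicalGroup G := topologicalGroup_of_lieGroup 𝓘(ℝ, EG) ∞
  obtain ⟨ψ, hψ, hψ1, hψ0⟩ := exists_centered_chart (E := EG) (1 : G)
  obtain ⟨φ, hφ, hz, hz0⟩ := exists_centered_chart (E := E) x
  obtain ⟨φ', hφ', hz', hz0'⟩ := exists_centered_chart (E := E) (a • x)
  have hsymm0 : ψ.symm 0 = 1 := by rw [← hψ0, ψ.left_inv hψ1]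
  have h0ψ : (0 : EG) ∈ ψ.target := hψ0 ▸ ψ.map_source hψ1
  set f' := orbitMapIn ψ φ' (a • x) with hf'
  set f := orbitMapIn ψ φ x with hf
  obtain ⟨κ, hκp, hκ, hcompl'⟩ :=
    exists_clm_isCompl_ker (fderiv ℝ f' 0 : EG →ₗ[ℝ] E).ker
  obtain ⟨θ', Λ', -, -, -, -, hΛ0', hΛ00', hΛ1', hΛ2', hnf', hst', hκΛ'⟩ :=
    orbitMap_normalForm hψ hψ1 hψ0 hφ' hz' hz0' rfl κ hκ hcompl'
  have h0t' := hΛ00' ▸ Λ'.map_source hΛ0'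
  have hΛsymm0' : Λ'.symm 0 = 0 := by rw [← hΛ00', Λ'.left_inv hΛ0']
  have h0d : (0 : EG) ∈ orbitMapDomain ψ φ x :=
    ⟨h0ψ, by rw [mem_preimage, hsymm0]; simpa using hz⟩
  have h0d' : (0 : EG) ∈ orbitMapDomain ψ φ' (a • x) :=
    ⟨h0ψ, by rw [mem_preimage, hsymm0]; simpa using hz'⟩
  have hfd : HasFDerivAt f (fderiv ℝ f 0) 0 :=
    (((contDiffOn_orbitMapIn hψ hφ x).contDiffAt
      ((isOpen_orbitMapDomain ψ φ x).mem_nhds h0d)).differentiableAt (by simp)).hasFDerivAt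
  have hfd' : HasFDerivAt f' (fderiv ℝ f' 0) 0 :=
    (((contDiffOn_orbitMapIn hψ hφ' (a • x)).contDiffAt
      ((isOpen_orbitMapDomain ψ φ' (a • x)).mem_nhds h0d')).differentiableAt
        (by simp)).hasFDerivAt
  have hf0 : f 0 = 0 := by simp [hf, orbitMapIn, hsymm0, hz0]
  have hf0' : f' 0 = 0 := by simp [hf', orbitMapIn, hsymm0, hz0']
  -- These kernels play the role of the Lie algebras of `G_{ax}` and `G_x`: each `k` in the first is
  -- the velocity of a curve in `G_{ax}`, which by `hle` also fixes `x`.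
  have hkerle : (fderiv ℝ f' 0 : EG →ₗ[ℝ] E).ker ≤ (fderiv ℝ f 0 : EG →ₗ[ℝ] E).ker := by
    intro k hk
    set c : ℝ → EG := fun s => Λ'.symm (s • (0, ⟨k, hk⟩)) with hc
    have hc0 : c 0 = 0 := by simp only [hc, zero_smul, hΛsymm0']
    have hcd : DifferentiableAt ℝ c 0 := by
      have h1 : DifferentiableAt ℝ Λ'.symm ((0 : ℝ) • ((0, ⟨k, hk⟩) :
          (fderiv ℝ f' 0 : EG →ₗ[ℝ] E).range × (fderiv ℝ f' 0 : EG →ₗ[ℝ] E).ker)) := by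
        rw [zero_smul]
        exact (hΛ2'.contDiffAt (Λ'.open_target.mem_nhds h0t')).differentiableAt (by simp)
      exact h1.comp (0 : ℝ) (differentiableAt_id.smul_const _)
    set w := deriv c 0 with hw
    have hcw : HasDerivAt c w 0 := hcd.hasDerivAt
    have hct : ∀ᶠ s : ℝ in 𝓝 0, (s • ((0, ⟨k, hk⟩) :
          (fderiv ℝ f' 0 : EG →ₗ[ℝ] E).range × (fderiv ℝ f' 0 : EG →ₗ[ℝ] E).ker)) ∈ Λ'.target := by
      have : Continuous fun s : ℝ => (s • ((0, ⟨k, hk⟩) :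
          (fderiv ℝ f' 0 : EG →ₗ[ℝ] E).range × (fderiv ℝ f' 0 : EG →ₗ[ℝ] E).ker)) := by fun_prop
      exact this.continuousAt.eventually (by
        beta_reduce; rw [zero_smul]; exact Λ'.open_target.mem_nhds h0t')
    have hstab : ∀ᶠ s : ℝ in 𝓝 0, ψ.symm (c s) ∈ MulAction.stabilizer G (a • x) := by
      filter_upwards [hct] with s hs
      refine (hst' _ (Λ'.map_target hs)).2 ?_
      rw [Λ'.right_inv hs]
      simp
    have h1 : HasDerivAt (f' ∘ c) (fderiv ℝ f' 0 w) 0 :=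
      HasFDerivAt.comp_hasDerivAt (0 : ℝ) (by rw [hc0]; exact hfd') hcw
    have h2 : fderiv ℝ f' 0 w = 0 := by
      refine h1.unique ((hasDerivAt_const (0 : ℝ) (0 : E)).congr_of_eventuallyEq ?_)
      filter_upwards [hstab] with s hs
      change φ' (ψ.symm (c s) • a • x) = 0
      rw [MulAction.mem_stabilizer_iff.1 hs, hz0']
    have h3 : HasDerivAt (f ∘ c) (fderiv ℝ f 0 w) 0 :=
      HasFDerivAt.comp_hasDerivAt (0 : ℝ) (by rw [hc0]; exact hfd) hcw
    have h4 : fderiv ℝ f 0 w = 0 := by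
      refine h3.unique ((hasDerivAt_const (0 : ℝ) (0 : E)).congr_of_eventuallyEq ?_)
      filter_upwards [hstab] with s hs
      change φ (ψ.symm (c s) • x) = 0
      rw [MulAction.mem_stabilizer_iff.1 (hle hs), hz0]
    have h5 : HasDerivAt (fun s => κ (c s)) (κ w) 0 := κ.hasFDerivAt.comp_hasDerivAt (0 : ℝ) hcw
    have h6 : HasDerivAt (fun s : ℝ => s • (⟨k, hk⟩ : (fderiv ℝ f' 0 : EG →ₗ[ℝ] E).ker))
        ((1 : ℝ) • ⟨k, hk⟩) 0 := (hasDerivAt_id (0 : ℝ)).smul_const _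
    have h7 : κ w = ⟨k, hk⟩ := by
      rw [← one_smul ℝ (⟨k, hk⟩ : (fderiv ℝ f' 0 : EG →ₗ[ℝ] E).ker)]
      refine h5.unique (h6.congr_of_eventuallyEq ?_)
      filter_upwards [hct] with s hs
      rw [← hκΛ', hc]
      simp only [Λ'.right_inv hs]
      rfl
    have h8 : w = k := by
      have := hκp ⟨w, h2⟩
      rw [h7] at this
      exact (congrArg Subtype.val this).symm
    rw [← h8]
    exact h4
  -- Conjugation gives the reverse comparison of dimensions, so the two kernels coincide and one `κ`
  -- serves both normal forms.
  have hrank : Module.finrank ℝ (fderiv ℝ f' 0 : EG →ₗ[ℝ] E).range ≤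
      Module.finrank ℝ (fderiv ℝ f 0 : EG →ₗ[ℝ] E).range :=
    finrank_range_fderiv_orbitMapIn_le hψ hψ1 hψ0 hφ hφ' hz hz0 a h0d'
  have hker : (fderiv ℝ f' 0 : EG →ₗ[ℝ] E).ker = (fderiv ℝ f 0 : EG →ₗ[ℝ] E).ker := by
    refine Submodule.eq_of_le_of_finrank_le hkerle ?_
    have e1 := LinearMap.finrank_range_add_finrank_ker (fderiv ℝ f 0 : EG →ₗ[ℝ] E)
    have e2 := LinearMap.finrank_range_add_finrank_ker (fderiv ℝ f' 0 : EG →ₗ[ℝ] E)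
    omega
  obtain ⟨θ, Λ, -, -, -, -, hΛ0, hΛ00, hΛ1, hΛ2, hnf, hst, hκΛ⟩ :=
    orbitMap_normalForm hψ hψ1 hψ0 hφ hz hz0 rfl κ hκ (hker ▸ hcompl')
  have h0t := hΛ00 ▸ Λ.map_source hΛ0
  have hΛsymm0 : Λ.symm 0 = 0 := by rw [← hΛ00, Λ.left_inv hΛ0]
  have hnhds : ∀ᶠ g in 𝓝 (1 : G), g ∈ ψ.source ∧ ψ g ∈ Λ.source ∧
      ((0, κ (ψ g)) ∈ Λ'.target) ∧ Λ'.symm (0, κ (ψ g)) ∈ Λ.source := by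
    have hψc : ContinuousAt ψ 1 := ψ.continuousAt hψ1
    have hc1 : ContinuousAt (fun g => ((0, κ (ψ g)) :
        (fderiv ℝ f' 0 : EG →ₗ[ℝ] E).range × (fderiv ℝ f' 0 : EG →ₗ[ℝ] E).ker)) 1 :=
      continuousAt_const.prodMk (κ.continuous.continuousAt.comp hψc)
    have hval : ((0, κ (ψ 1)) :
        (fderiv ℝ f' 0 : EG →ₗ[ℝ] E).range × (fderiv ℝ f' 0 : EG →ₗ[ℝ] E).ker) = 0 := by
      rw [hψ0, map_zero]; rfl
    have hc2 : ContinuousAt (fun g => Λ'.symm (0, κ (ψ g))) 1 := by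
      refine ContinuousAt.comp (g := Λ'.symm) ?_ hc1
      rw [hval]
      exact Λ'.continuousAt_symm h0t'
    refine (ψ.open_source.eventually_mem hψ1).and (Eventually.and ?_ (Eventually.and ?_ ?_))
    · exact hψc.eventually (by rw [hψ0]; exact Λ.open_source.mem_nhds hΛ0)
    · exact hc1.eventually (by beta_reduce; rw [hval]; exact Λ'.open_target.mem_nhds h0t')
    · exact hc2.eventually (by
        beta_reduce; rw [hval, hΛsymm0']; exact Λ.open_source.mem_nhds hΛ0)
  -- For `g` in `G_x` near `1`, let `u₁` be the point with coordinates `(0, κ (ψ g))` for `Λ'`. It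
  -- represents an element of `G_{ax}`, hence of `G_x`, so it has the same coordinates as `ψ g` for
  -- `Λ`. Thus `u₁ = ψ g`, and `g` lies in `G_{ax}`.
  have hrel : ∀ᶠ g in 𝓝 (1 : G), g ∈ MulAction.stabilizer G x →
      g ∈ MulAction.stabilizer G (a • x) := by
    filter_upwards [hnhds] with g hg hgx
    obtain ⟨hg1, hg2, hg3, hg4⟩ := hg
    set u := ψ g with hu
    set u₁ := Λ'.symm (0, κ u) with hu₁
    have h1 : (Λ u).1 = 0 := by
      refine (hst u hg2).1 ?_
      rw [hu, ψ.left_inv hg1]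
      exact hgx
    have h2 : ψ.symm u₁ ∈ MulAction.stabilizer G (a • x) := by
      refine (hst' u₁ (Λ'.map_target hg3)).2 ?_
      rw [hu₁, Λ'.right_inv hg3]
    have h3 : (Λ u₁).1 = 0 := (hst u₁ hg4).1 (hle h2)
    have h4 : κ u₁ = κ u := by
      rw [← hκΛ' u₁, hu₁, Λ'.right_inv hg3]
    have h5 : Λ u₁ = Λ u := Prod.ext (h3.trans h1.symm) (by rw [hκΛ, hκΛ, h4])
    have h6 : u₁ = u := Λ.injOn hg4 hg2 h5
    rw [h6, hu, ψ.left_inv hg1] at h2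
    exact h2
  obtain ⟨r, hr, hball⟩ := Metric.isOpen_iff.1 Λ.open_target _ h0t
  set i : (fderiv ℝ f' 0 : EG →ₗ[ℝ] E).ker → (fderiv ℝ f 0 : EG →ₗ[ℝ] E).range ×
    (fderiv ℝ f' 0 : EG →ₗ[ℝ] E).ker := fun y => (0, y) with hi
  have hib : ∀ y ∈ Metric.ball (0 : (fderiv ℝ f' 0 : EG →ₗ[ℝ] E).ker) r, i y ∈ Λ.target := by
    intro y hy
    refine hball ?_
    rw [mem_ball_zero_iff, Prod.norm_def, hi]
    exact max_lt (by simpa using hr) (mem_ball_zero_iff.1 hy)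
  have hi0 : i 0 = 0 := rfl
  have hmap : MulAction.stabilizer G (a • x) =
      (MulAction.stabilizer G x).map (MulAut.conj a).toMonoidHom :=
    MulAction.stabilizer_smul_eq_stabilizer_map_conj a x
  have hcg : ContinuousOn (fun y => ψ.symm (Λ.symm (i y)))
      (Metric.ball (0 : (fderiv ℝ f' 0 : EG →ₗ[ℝ] E).ker) r) := by
    refine ψ.continuousOn_symm.comp (Λ.continuousOn_symm.comp (by fun_prop) hib) ?_
    exact fun y hy => (hnf _ (Λ.map_target (hib y hy))).1
  have hN₀ : ∀ᶠ g in 𝓝 (1 : G), g ∈ ψ.source ∧ ψ g ∈ Λ.source ∧ ‖κ (ψ g)‖ < r := by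
    have hψc : ContinuousAt ψ 1 := ψ.continuousAt hψ1
    refine (ψ.open_source.eventually_mem hψ1).and (Eventually.and ?_ ?_)
    · exact hψc.eventually (by rw [hψ0]; exact Λ.open_source.mem_nhds hΛ0)
    · have : ContinuousAt (fun g => ‖κ (ψ g)‖) 1 := (κ.continuous.continuousAt.comp hψc).norm
      exact this.eventually (by beta_reduce; rw [hψ0, map_zero, norm_zero]; exact gt_mem_nhds hr)
  rw [hmap]
  -- In the coordinates `Λ` the group `G_x` is the slice `{0} × ball` near `1`; its convexity
  -- supplies the connected neighbourhood `C`.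
  refine le_map_conj_of_relOpen (isCompact_stabilizer x)
    (C := (fun y => ψ.symm (Λ.symm (i y))) '' Metric.ball 0 r)
    ((convex_ball _ _).isPreconnected.image _ hcg) ?_ ?_ hN₀ ?_ a (hmap ▸ hle) hrel ?_
  · exact ⟨0, Metric.mem_ball_self hr, by simp only [hi0, hΛsymm0, hsymm0]⟩
  · rintro _ ⟨y, hy, rfl⟩
    refine (hst _ (Λ.map_target (hib y hy))).2 ?_
    rw [Λ.right_inv (hib y hy)]
  · rintro g ⟨hg1, hg2, hg3⟩ hgx
    refine ⟨κ (ψ g), mem_ball_zero_iff.2 hg3, ?_⟩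
    have h1 : (Λ (ψ g)).1 = 0 := by
      refine (hst _ hg2).1 ?_
      rw [ψ.left_inv hg1]
      exact hgx
    have h2 : i (κ (ψ g)) = Λ (ψ g) := Prod.ext h1.symm (hκΛ _).symm
    simp only [h2, Λ.left_inv hg2, ψ.left_inv hg1]
  · intro g hg hgx
    rw [← hmap]
    exact hg hgx

end Stabilizer

/-! ### Derivatives in the second variable of jointly smooth maps -/

section SmoothFamily

variable {P E F : Type*} [NormedAddCommGroup P] [NormedSpace ℝ P]
  [NormedAddCommGroup E] [NormedSpace ℝ E] [NormedAddCommGroup F] [NormedSpace ℝ F]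

/-- Induction on `n`: one more partial derivative is the total derivative of the previous one
composed with the inclusion of the second factor. -/
theorem contDiffOn_iteratedFDeriv_snd {f : P × E → F} {O : Set (P × E)} (hO : IsOpen O)
    (hf : ContDiffOn ℝ ∞ f O) (n : ℕ) :
    ContDiffOn ℝ ∞ (fun q : P × E => iteratedFDeriv ℝ n (fun v => f (q.1, v)) q.2) O := by
  induction n with
  | zero =>
    have h := (continuousMultilinearCurryFin0 ℝ E F).symm.contDiff (n := ∞) |>.comp_contDiffOn hf
    exact h
  | succ n ih =>
    set g : P × E → E [×n]→L[ℝ] F := fun q => iteratedFDeriv ℝ n (fun v => f (q.1, v)) q.2 with hg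
    have h1 : ContDiffOn ℝ ∞ (fderiv ℝ g) O := ih.fderiv_of_isOpen hO (by simp)
    have h2 : ContDiffOn ℝ ∞ (fun q => (fderiv ℝ g q).comp (ContinuousLinearMap.inr ℝ P E)) O :=
      h1.clm_comp contDiffOn_const
    have h3 := (continuousMultilinearCurryLeftEquiv ℝ (fun _ : Fin (n + 1) => E)
      F).symm.contDiff (n := ∞) |>.comp_contDiffOn h2
    refine h3.congr fun q hq => ?_
    rw [iteratedFDeriv_succ_eq_comp_left]
    simp only [Function.comp_apply]
    congr 1
    have h4 : HasFDerivAt (fun v => g (q.1, v))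
        ((fderiv ℝ g q).comp (ContinuousLinearMap.inr ℝ P E)) q.2 := by
      have h5 : HasFDerivAt g (fderiv ℝ g q) (q.1, q.2) :=
        ((ih.contDiffAt (hO.mem_nhds hq)).differentiableAt (by simp)).hasFDerivAt
      exact h5.comp q.2 (hasFDerivAt_prodMk_right q.1 q.2)
    exact h4.fderiv

variable {EG : Type*} [NormedAddCommGroup EG] [NormedSpace ℝ EG]
  {G : Type*} [TopologicalSpace G] [ChartedSpace EG G] [IsManifold 𝓘(ℝ, EG) ∞ G]

/-- Supplies the continuity hypothesis for differentiating under an integral over an isotropy group.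
-/
theorem continuousOn_iteratedFDeriv_of_contMDiffOn {f : G × E → F} {O : Set (G × E)}
    (hO : IsOpen O) (hf : ContMDiffOn (𝓘(ℝ, EG).prod 𝓘(ℝ, E)) 𝓘(ℝ, F) ∞ f O) (n : ℕ) :
    ContinuousOn (fun q : G × E => iteratedFDeriv ℝ n (fun v => f (q.1, v)) q.2) O := by
  rintro ⟨g₀, v₀⟩ hq
  set ψ := chartAt EG g₀ with hψdef
  have hψ : ψ ∈ IsManifold.maximalAtlas 𝓘(ℝ, EG) ∞ G := IsManifold.chart_mem_maximalAtlas g₀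
  have hg₀ : g₀ ∈ ψ.source := mem_chart_source EG g₀
  set j : EG × E → G × E := fun q => (ψ.symm q.1, q.2) with hj
  have hjs : ContMDiffOn (𝓘(ℝ, EG × E)) (𝓘(ℝ, EG).prod 𝓘(ℝ, E)) ∞ j (ψ.target ×ˢ univ) := by
    refine ContMDiffOn.prodMk ?_ ?_
    · exact (contMDiffOn_symm_of_mem_maximalAtlas hψ).comp (t := ψ.target)
        contDiff_fst.contMDiff.contMDiffOn fun q hq => hq.1
    · exact contDiff_snd.contMDiff.contMDiffOn
  have hO' : IsOpen ((ψ.target ×ˢ univ) ∩ j ⁻¹' O) :=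
    hjs.continuousOn.isOpen_inter_preimage (ψ.open_target.prod isOpen_univ) hO
  have hc : ContDiffOn ℝ ∞ (fun q => f (j q)) ((ψ.target ×ˢ univ) ∩ j ⁻¹' O) :=
    contMDiffOn_iff_contDiffOn.1 (hf.comp (hjs.mono inter_subset_left) inter_subset_right)
  have h1 := (contDiffOn_iteratedFDeriv_snd hO' hc n).continuousOn
  have hmem : (ψ g₀, v₀) ∈ (ψ.target ×ˢ univ) ∩ j ⁻¹' O :=
    ⟨⟨ψ.map_source hg₀, mem_univ _⟩, by simpa [hj, ψ.left_inv hg₀] using hq⟩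
  have h2 := (h1.continuousAt (hO'.mem_nhds hmem))
  have h3 : ContinuousAt (fun q : G × E => (ψ q.1, q.2)) (g₀, v₀) := by
    have : ContinuousAt ψ g₀ := ψ.continuousAt hg₀
    exact (ContinuousAt.comp (f := Prod.fst) (x := (g₀, v₀)) this continuousAt_fst).prodMk
      continuousAt_snd
  have h4 := ContinuousAt.comp (f := fun q : G × E => (ψ q.1, q.2)) (x := (g₀, v₀)) h2 h3
  refine (h4.congr ?_).continuousWithinAt
  have h5 : ∀ᶠ q : G × E in 𝓝 (g₀, v₀), q.1 ∈ ψ.source :=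
    continuousAt_fst.eventually (ψ.open_source.mem_nhds hg₀)
  filter_upwards [h5] with q hq5
  simp only [Function.comp_apply, hj, ψ.left_inv hq5]

end SmoothFamily

/-! ### Averaging over compact groups -/

section Haar

variable (K : Type*) [Group K] [TopologicalSpace K] [IsTopologicalGroup K] [CompactSpace K]
  [MeasurableSpace K] [BorelSpace K]

theorem exists_haar_probability : ∃ μ : Measure K, μ.IsMulLeftInvariant ∧ IsProbabilityMeasure μ ∧
    μ.IsOpenPosMeasure := by
  refine ⟨Measure.haarMeasure (⊤ : TopologicalSpace.PositiveCompacts K), inferInstance, ⟨?_⟩,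
    inferInstance⟩
  exact Measure.haarMeasure_self (K₀ := (⊤ : TopologicalSpace.PositiveCompacts K))

end Haar

section Representation

variable {K : Type*} [Group K] [TopologicalSpace K] [IsTopologicalGroup K] [CompactSpace K]
  {E : Type*} [NormedAddCommGroup E] [NormedSpace ℝ E] [FiniteDimensional ℝ E]
  {ρ : K →* (E →L[ℝ] E)}

/-- The averaging operator of a representation of a compact group. -/
theorem exists_average (hρ : Continuous ρ) : ∃ A : E →L[ℝ] E,
    (∀ h v, ρ h (A v) = A v) ∧
    (∀ (F : Submodule ℝ E) (v : E), (∀ h, ρ h v ∈ F) → A v ∈ F) ∧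
    (∀ (l : E →L[ℝ] ℝ), (∀ h v, l (ρ h v) = l v) → ∀ v, l (A v) = l v) := by
  let _ : MeasurableSpace K := borel K
  have _ : BorelSpace K := ⟨rfl⟩
  obtain ⟨μ, _, _, _⟩ := exists_haar_probability K
  have hi : Integrable ρ μ := integrable_of_continuous μ hρ
  have hA : ∀ v, (∫ k, ρ k ∂μ) v = ∫ k, ρ k v ∂μ := fun v => ContinuousLinearMap.integral_apply hi v
  have hiv : ∀ v, Integrable (fun k => ρ k v) μ := fun v =>
    integrable_of_continuous μ (by fun_prop)
  refine ⟨∫ k, ρ k ∂μ, ?_, ?_, ?_⟩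
  · intro h v
    rw [hA, ← ContinuousLinearMap.integral_comp_comm _ (hiv v)]
    have h1 : ∀ k, ρ h (ρ k v) = ρ (h * k) v := fun k => by rw [map_mul]; rfl
    simp only [h1]
    exact integral_mul_left_eq_self (fun k => ρ k v) h
  · intro F v hv
    obtain ⟨q, hq⟩ := exists_clm_ker_eq F
    rw [← hq, hA, ← ContinuousLinearMap.integral_comp_comm _ (hiv v)]
    simp only [(hq _).2 (hv _), integral_zero]
  · intro l hl v
    rw [hA, ← ContinuousLinearMap.integral_comp_comm _ (hiv v)]
    simp only [hl, integral_const, probReal_univ, one_smul]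

/-- A representation of a compact group has an invariant inner product. -/
theorem exists_invariant_inner (hρ : Continuous ρ) : ∃ B : LinearMap.BilinForm ℝ E,
    (∀ v w, B v w = B w v) ∧ (∀ v, v ≠ 0 → 0 < B v v) ∧ ∀ h v w, B (ρ h v) (ρ h w) = B v w := by
  let _ : MeasurableSpace K := borel K
  have _ : BorelSpace K := ⟨rfl⟩
  obtain ⟨μ, _, _, _⟩ := exists_haar_probability K
  -- The average of `b` is taken along `k⁻¹`, so that left invariance of the measure gives
  -- invariance of the form. Positivity holds because the integrand is nonzero at `k = 1` and the
  -- measure charges open sets.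
  set b : E → E → ℝ := fun v w => inner ℝ (toEuclidean v) (toEuclidean w) with hb
  have hcont : ∀ v w, Continuous fun k : K => b (ρ k⁻¹ v) (ρ k⁻¹ w) := fun v w => by
    have h1 : ∀ v, Continuous fun k : K => toEuclidean (ρ k⁻¹ v) := fun v =>
      toEuclidean.continuous.comp ((hρ.comp continuous_inv).clm_apply continuous_const)
    exact (h1 v).inner (h1 w)
  have hint : ∀ v w, Integrable (fun k : K => b (ρ k⁻¹ v) (ρ k⁻¹ w)) μ := fun v w =>
    integrable_of_continuous μ (hcont v w)
  refine ⟨LinearMap.mk₂ ℝ (fun v w => ∫ k, b (ρ k⁻¹ v) (ρ k⁻¹ w) ∂μ) ?_ ?_ ?_ ?_, ?_, ?_, ?_⟩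
  · intro v v' w
    rw [← integral_add (hint _ _) (hint _ _)]
    simp only [hb, map_add, inner_add_left]
  · intro c v w
    rw [smul_eq_mul, ← integral_const_mul]
    simp only [hb, map_smul, inner_smul_left, RCLike.conj_to_real]
  · intro v w w'
    rw [← integral_add (hint _ _) (hint _ _)]
    simp only [hb, map_add, inner_add_right]
  · intro c v w
    rw [smul_eq_mul, ← integral_const_mul]
    simp only [hb, map_smul, inner_smul_right]
  · intro v w
    simp only [LinearMap.mk₂_apply, hb]
    simp only [real_inner_comm]
  · intro v hv
    simp only [LinearMap.mk₂_apply]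
    refine (hcont v v).integral_pos_of_hasCompactSupport_nonneg_nonzero (x := 1)
      (HasCompactSupport.of_compactSpace _) ?_ ?_
    · intro k
      exact real_inner_self_nonneg
    · simp only [inv_one, map_one, hb]
      exact inner_self_ne_zero.2 (by simpa using hv)
  · intro h v w
    simp only [LinearMap.mk₂_apply]
    have h1 : ∀ k : K, ∀ v, ρ k⁻¹ (ρ h v) = ρ (h⁻¹ * k)⁻¹ v := fun k v => by
      rw [mul_inv_rev, inv_inv, map_mul]; rfl
    simp only [h1]
    exact integral_mul_left_eq_self (fun k => b (ρ k⁻¹ v) (ρ k⁻¹ w)) h⁻¹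

/-- An invariant subspace has an invariant complement. -/
theorem exists_isCompl_invariant {B : LinearMap.BilinForm ℝ E}
    (hsymm : ∀ v w, B v w = B w v) (hpos : ∀ v, v ≠ 0 → 0 < B v v)
    (hB : ∀ h v w, B (ρ h v) (ρ h w) = B v w)
    {T : Submodule ℝ E} (hT : ∀ h, ∀ t ∈ T, ρ h t ∈ T) :
    ∃ S : Submodule ℝ E, IsCompl T S ∧ ∀ h, ∀ s ∈ S, ρ h s ∈ S := by
  refine ⟨B.orthogonal T, (LinearMap.BilinForm.isCompl_orthogonal_iff_disjoint ?_).2 ?_, ?_⟩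
  · exact fun v w h => (hsymm w v).trans h
  · rw [Submodule.disjoint_def]
    intro v hv hv'
    by_contra h0
    exact (hpos v h0).ne' (LinearMap.BilinForm.mem_orthogonal_iff.1 hv' v hv)
  · intro h s hs
    refine LinearMap.BilinForm.mem_orthogonal_iff.2 fun t ht => ?_
    have h1 : ρ h (ρ h⁻¹ t) = t := by
      have : ρ h * ρ h⁻¹ = 1 := by rw [← map_mul, mul_inv_cancel, map_one]
      exact congrArg (fun A : E →L[ℝ] E => A t) this
    have h2 := LinearMap.BilinForm.mem_orthogonal_iff.1 hs _ (hT h⁻¹ t ht)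
    change B t (ρ h s) = 0
    rw [← h1, hB]
    exact h2

end Representation

/-- The tube lemma. It provides neighbourhoods valid for all elements of a compact isotropy group at
once. -/
theorem isOpen_setOf_forall_mem {K X : Type*} [TopologicalSpace K] [CompactSpace K]
    [TopologicalSpace X] {O : Set (K × X)} (hO : IsOpen O) : IsOpen {x | ∀ k, (k, x) ∈ O} := by
  rw [isOpen_iff_eventually]
  intro x hx
  have := (isCompact_univ (X := K)).eventually_forall_of_forall_eventually (x₀ := x)
    (P := fun x k => (k, x) ∈ O) fun k _ =>
      (continuous_swap.tendsto (x, k)).eventually (hO.mem_nhds (hx k))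
  filter_upwards [this] with y hy k using hy k (mem_univ k)

/-! ### Linearization of the isotropy action by averaging a chart -/

section Linearization

variable {EG : Type*} [NormedAddCommGroup EG] [NormedSpace ℝ EG] [FiniteDimensional ℝ EG]
  {G : Type*} [Group G] [TopologicalSpace G] [ChartedSpace EG G] [LieGroup 𝓘(ℝ, EG) ∞ G]
  {E : Type*} [NormedAddCommGroup E] [NormedSpace ℝ E] [FiniteDimensional ℝ E]
  {M : Type*} [TopologicalSpace M] [ChartedSpace E M] [IsManifold 𝓘(ℝ, E) ∞ M]
  [MulAction G M]

/-- The action in a chart of `M`. -/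
def actionIn (G : Type*) [Group G] [MulAction G M] (φ : OpenPartialHomeomorph M E) :
    G × E → E := fun q => φ (q.1 • φ.symm q.2)

/-- The domain of the action in a chart of `M`. -/
def actionDomain (G : Type*) [Group G] [MulAction G M] (φ : OpenPartialHomeomorph M E) :
    Set (G × E) := (univ ×ˢ φ.target) ∩ {q | q.1 • φ.symm q.2 ∈ φ.source}

variable {φ : OpenPartialHomeomorph M E}

theorem contMDiffOn_smul_symm
    (hsm : ContMDiff (𝓘(ℝ, EG).prod 𝓘(ℝ, E)) 𝓘(ℝ, E) ∞ fun p : G × M => p.1 • p.2)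
    (hφ : φ ∈ IsManifold.maximalAtlas 𝓘(ℝ, E) ∞ M) :
    ContMDiffOn (𝓘(ℝ, EG).prod 𝓘(ℝ, E)) 𝓘(ℝ, E) ∞ (fun q : G × E => q.1 • φ.symm q.2)
      (univ ×ˢ φ.target) := by
  refine hsm.comp_contMDiffOn (contMDiff_fst.contMDiffOn.prodMk ?_)
  exact (contMDiffOn_symm_of_mem_maximalAtlas hφ).comp contMDiff_snd.contMDiffOn fun q hq => hq.2

theorem isOpen_actionDomain
    (hsm : ContMDiff (𝓘(ℝ, EG).prod 𝓘(ℝ, E)) 𝓘(ℝ, E) ∞ fun p : G × M => p.1 • p.2)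
    (hφ : φ ∈ IsManifold.maximalAtlas 𝓘(ℝ, E) ∞ M) :
    IsOpen (actionDomain G φ) :=
  (contMDiffOn_smul_symm hsm hφ).continuousOn.isOpen_inter_preimage
    (isOpen_univ.prod φ.open_target) φ.open_source

theorem contMDiffOn_actionIn
    (hsm : ContMDiff (𝓘(ℝ, EG).prod 𝓘(ℝ, E)) 𝓘(ℝ, E) ∞ fun p : G × M => p.1 • p.2)
    (hφ : φ ∈ IsManifold.maximalAtlas 𝓘(ℝ, E) ∞ M) :
    ContMDiffOn (𝓘(ℝ, EG).prod 𝓘(ℝ, E)) 𝓘(ℝ, E) ∞ (actionIn G φ) (actionDomain G φ) :=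
  (contMDiffOn_of_mem_maximalAtlas hφ).comp
    ((contMDiffOn_smul_symm hsm hφ).mono inter_subset_left) inter_subset_right

theorem contDiffAt_actionIn
    (hsm : ContMDiff (𝓘(ℝ, EG).prod 𝓘(ℝ, E)) 𝓘(ℝ, E) ∞ fun p : G × M => p.1 • p.2)
    (hφ : φ ∈ IsManifold.maximalAtlas 𝓘(ℝ, E) ∞ M) {q : G × E}
    (hq : q ∈ actionDomain G φ) : ContDiffAt ℝ ∞ (fun v => actionIn G φ (q.1, v)) q.2 := by
  refine contMDiffAt_iff_contDiffAt.1 ?_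
  have h1 := (contMDiffOn_actionIn hsm hφ).contMDiffAt
    ((isOpen_actionDomain hsm hφ).mem_nhds hq)
  exact ContMDiffAt.comp (I' := 𝓘(ℝ, EG).prod 𝓘(ℝ, E)) (f := fun v => (q.1, v))
    (g := actionIn G φ) q.2 h1 (contMDiffAt_const.prodMk contMDiffAt_id)

/-- The isotropy representation in a chart. -/
theorem exists_isotropyRep
    (hsm : ContMDiff (𝓘(ℝ, EG).prod 𝓘(ℝ, E)) 𝓘(ℝ, E) ∞ fun p : G × M => p.1 • p.2)
    (hφ : φ ∈ IsManifold.maximalAtlas 𝓘(ℝ, E) ∞ M) {z : M}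
    (hz : z ∈ φ.source) (hz0 : φ z = 0) :
    ∃ ρ : MulAction.stabilizer G z →* (E →L[ℝ] E), Continuous ρ ∧
      ∀ k : MulAction.stabilizer G z,
        HasFDerivAt (fun v => actionIn G φ ((k : G), v)) (ρ k) 0 := by
  have hsymm0 : φ.symm 0 = z := by rw [← hz0, φ.left_inv hz]
  have h0t : (0 : E) ∈ φ.target := hz0 ▸ φ.map_source hz
  have hk0 : ∀ k : MulAction.stabilizer G z, ((k : G), (0 : E)) ∈ actionDomain G φ := fun k =>
    ⟨⟨mem_univ _, h0t⟩, by
      have : (k : G) • z = z := k.2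
      simp only [mem_ofPred_eq, hsymm0, this]
      exact hz⟩
  have hd : ∀ k : MulAction.stabilizer G z, HasFDerivAt (fun v => actionIn G φ ((k : G), v))
      (fderiv ℝ (fun v => actionIn G φ ((k : G), v)) 0) 0 := fun k =>
    ((contDiffAt_actionIn hsm hφ (hk0 k)).differentiableAt (by simp)).hasFDerivAt
  have hval : ∀ k : MulAction.stabilizer G z, actionIn G φ ((k : G), 0) = 0 := fun k => by
    have : (k : G) • z = z := k.2
    simp only [actionIn, hsymm0, this, hz0]
  have hO := isOpen_actionDomain hsm hφ
  refine ⟨⟨⟨fun k => fderiv ℝ (fun v => actionIn G φ ((k : G), v)) 0, ?_⟩, ?_⟩, ?_, hd⟩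
  · refine ((hasFDerivAt_id (0 : E)).congr_of_eventuallyEq ?_).fderiv
    filter_upwards [φ.open_target.mem_nhds h0t] with v hv
    simp only [actionIn, OneMemClass.coe_one, one_smul, id, φ.right_inv hv]
  · intro k k'
    have h0 : HasFDerivAt (fun v => actionIn G φ ((k : G), v))
        (fderiv ℝ (fun v => actionIn G φ ((k : G), v)) 0) (actionIn G φ ((k' : G), 0)) := by
      rw [hval k']
      exact hd k
    have h1 := h0.comp 0 (hd k')
    refine (h1.congr_of_eventuallyEq ?_).fderiv
    have h2 : ∀ᶠ v in 𝓝 (0 : E), ((k' : G), v) ∈ actionDomain G φ :=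
      (Continuous.prodMk_right (k' : G)).continuousAt.eventually (hO.mem_nhds (hk0 k'))
    filter_upwards [h2] with v hv
    simp only [actionIn, Function.comp_apply, Subgroup.coe_mul, mul_smul]
    rw [φ.left_inv hv.2]
  · have h1 := continuousOn_iteratedFDeriv_of_contMDiffOn hO (contMDiffOn_actionIn hsm hφ) 1
    have h2 := (continuousMultilinearCurryFin1 ℝ E E).continuous.comp_continuousOn h1
    have h3 : Continuous fun k : MulAction.stabilizer G z => ((k : G), (0 : E)) := by fun_prop
    refine (h2.comp_continuous h3 hk0).congr fun k => ?_
    ext w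
    simp

variable [IsTopologicalGroup G] [ContinuousSMul G M]

/-- Averaging a chart over the stabilizer of a point. -/
theorem exists_equivariant_map
    (hsm : ContMDiff (𝓘(ℝ, EG).prod 𝓘(ℝ, E)) 𝓘(ℝ, E) ∞ fun p : G × M => p.1 • p.2)
    (hφ : φ ∈ IsManifold.maximalAtlas 𝓘(ℝ, E) ∞ M) {z : M}
    (hz : z ∈ φ.source) (hz0 : φ z = 0) (hK : IsCompact (MulAction.stabilizer G z : Set G))
    {ρ : MulAction.stabilizer G z →* (E →L[ℝ] E)} (hρ : Continuous ρ)
    (hd : ∀ k : MulAction.stabilizer G z,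
        HasFDerivAt (fun v => actionIn G φ ((k : G), v)) (ρ k) 0) :
    ∃ Φ : M → E, (∀ (h : MulAction.stabilizer G z) (y : M), Φ ((h : G) • y) = ρ h (Φ y)) ∧
      Φ z = 0 ∧
      (∀ T : Submodule ℝ E, (∀ h, ∀ t ∈ T, ρ h t ∈ T) → ∀ y : M,
        (∀ k : MulAction.stabilizer G z, φ ((k : G) • y) ∈ T) → Φ y ∈ T) ∧
      ∃ W : Set E, IsOpen W ∧ (0 : E) ∈ W ∧ W ⊆ φ.target ∧
        ContDiffOn ℝ ∞ (fun v => Φ (φ.symm v)) W ∧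
        HasFDerivAt (fun v => Φ (φ.symm v)) (ContinuousLinearMap.id ℝ E) 0 := by
  have : CompactSpace (MulAction.stabilizer G z) := isCompact_iff_compactSpace.1 hK
  let _ : MeasurableSpace (MulAction.stabilizer G z) := borel _
  have _ : BorelSpace (MulAction.stabilizer G z) := ⟨rfl⟩
  obtain ⟨μ, _, _, _⟩ := exists_haar_probability (MulAction.stabilizer G z)
  have hsymm0 : φ.symm 0 = z := by rw [← hz0, φ.left_inv hz]
  have h0t : (0 : E) ∈ φ.target := hz0 ▸ φ.map_source hz
  have hO := isOpen_actionDomain hsm hφ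
  set j : MulAction.stabilizer G z × E → G × E := fun q => (((q.1⁻¹ : MulAction.stabilizer G z) : G),
    q.2) with hj
  have hjc : Continuous j := by
    refine Continuous.prodMk ?_ continuous_snd
    exact continuous_subtype_val.comp continuous_fst.inv
  set W : Set E := {v | ∀ k : MulAction.stabilizer G z, (k, v) ∈ j ⁻¹' actionDomain G φ} with hW
  have hWo : IsOpen W := isOpen_setOf_forall_mem (hO.preimage hjc)
  have h0W : (0 : E) ∈ W := fun k => ⟨⟨mem_univ _, h0t⟩, by
      have : ((k⁻¹ : MulAction.stabilizer G z) : G) • z = z := (k⁻¹).2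
      simp only [hj, mem_ofPred_eq, hsymm0, this]
      exact hz⟩
  -- Each integrand is the chart conjugated by `k`, with derivative `ρ k * ρ k⁻¹ = 1` at `z`. So the
  -- average is equivariant and still a chart near `z`.
  set Φ : M → E := fun y => ∫ k, ρ k (φ (((k⁻¹ : MulAction.stabilizer G z) : G) • y)) ∂μ with hΦ
  set f : MulAction.stabilizer G z → E → E := fun k v => ρ k (actionIn G φ (j (k, v))) with hf
  have hΦf : (fun v => Φ (φ.symm v)) = fun v => ∫ k, f k v ∂μ := rfl
  have hact : ∀ k, ∀ v ∈ W, ContDiffAt ℝ ∞ (fun v => actionIn G φ (j (k, v))) v := fun k v hv =>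
    contDiffAt_actionIn hsm hφ (hv k)
  have hfs : ∀ k, ContDiffOn ℝ ∞ (f k) W := fun k v hv =>
    ((ρ k).contDiff.contDiffAt.comp v (hact k v hv)).contDiffWithinAt
  have hfc : ∀ n : ℕ, ContinuousOn
      (fun q : MulAction.stabilizer G z × E => iteratedFDeriv ℝ n (f q.1) q.2) (univ ×ˢ W) := by
    intro n
    have h1 := (continuousOn_iteratedFDeriv_of_contMDiffOn hO
      (contMDiffOn_actionIn hsm hφ) n).comp (hjc.continuousOn (s := univ ×ˢ W))
      fun q hq => hq.2 q.1
    have h2 : ContinuousOn (fun q : MulAction.stabilizer G z × E =>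
        ContinuousLinearMap.compContinuousMultilinearMapL ℝ (fun _ : Fin n => E) E E (ρ q.1))
        (univ ×ˢ W) :=
      ((ContinuousLinearMap.continuous _).comp (hρ.comp continuous_fst)).continuousOn
    refine (h2.clm_apply h1).congr fun q hq => ?_
    exact (ρ q.1).iteratedFDeriv_comp_left (hact q.1 q.2 (hq.2)) (i := n)
      (by exact_mod_cast le_top)
  refine ⟨Φ, ?_, ?_, ?_, W, hWo, h0W, fun v hv => (hv 1).1.2, ?_, ?_⟩
  · intro h y
    have h1 : ∀ k : MulAction.stabilizer G z, ρ (h * k) (φ (((k⁻¹ : MulAction.stabilizer G z) : G) • y))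
        = ρ (h * k) (φ ((((h * k)⁻¹ : MulAction.stabilizer G z) : G) • (h : G) • y)) := fun k => by
      rw [smul_smul]
      congr 3
      simp
    have hinv : ρ h * ρ h⁻¹ = 1 := by rw [← map_mul, mul_inv_cancel, map_one]
    have hinv' : ρ h⁻¹ * ρ h = 1 := by rw [← map_mul, inv_mul_cancel, map_one]
    -- An invertible operator commutes with the integral even if the integrand is not integrable and
    -- the integral is `0` by default. Hence equivariance holds at every `y`, also where `φ` has no
    -- meaning.
    let L : E ≃L[ℝ] E := ContinuousLinearEquiv.equivOfInverse (ρ h) (ρ h⁻¹)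
      (fun v => congrArg (fun A : E →L[ℝ] E => A v) hinv')
      (fun v => congrArg (fun A : E →L[ℝ] E => A v) hinv)
    have h2 : ρ h (Φ y) = ∫ k : MulAction.stabilizer G z,
        ρ h (ρ k (φ (((k⁻¹ : MulAction.stabilizer G z) : G) • y))) ∂μ :=
      (L.integral_comp_comm _).symm
    rw [h2]
    have h3 : ∀ k : MulAction.stabilizer G z,
        ρ h (ρ k (φ (((k⁻¹ : MulAction.stabilizer G z) : G) • y))) =
        ρ (h * k) (φ ((((h * k)⁻¹ : MulAction.stabilizer G z) : G) • (h : G) • y)) := fun k => by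
      rw [← h1, map_mul]; rfl
    simp only [h3]
    exact (integral_mul_left_eq_self (fun k : MulAction.stabilizer G z =>
      ρ k (φ (((k⁻¹ : MulAction.stabilizer G z) : G) • (h : G) • y))) h).symm
  · have h1 : ∀ k : MulAction.stabilizer G z,
        φ (((k⁻¹ : MulAction.stabilizer G z) : G) • z) = 0 := fun k => by
      have : ((k⁻¹ : MulAction.stabilizer G z) : G) • z = z := (k⁻¹).2
      rw [this, hz0]
    simp only [hΦ, h1, map_zero, integral_zero]
  · intro T hT y hy
    by_cases hi : Integrable
        (fun k : MulAction.stabilizer G z => ρ k (φ (((k⁻¹ : MulAction.stabilizer G z) : G) • y))) μ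
    · obtain ⟨q, hq⟩ := exists_clm_ker_eq T
      rw [← hq, hΦ]
      beta_reduce
      rw [← ContinuousLinearMap.integral_comp_comm _ hi]
      simp only [(hq _).2 (hT _ _ (hy _)), integral_zero]
    -- The default value `0` of the integral also lies in `T`.
    · rw [hΦ]
      beta_reduce
      rw [integral_undef hi]
      exact T.zero_mem
  · rw [hΦf]
    exact contDiffOn_integral_of_compact μ hWo hfs hfc
  · rw [hΦf]
    refine (hasFDerivAt_integral_of_contDiffOn μ hWo hfs hfc h0W).congr_fderiv ?_
    have h1 : ∀ k, fderiv ℝ (f k) 0 = ContinuousLinearMap.id ℝ E := fun k => by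
      refine (((ρ k).hasFDerivAt.comp (0 : E) (hd k⁻¹)).fderiv).trans ?_
      have : ρ k * ρ k⁻¹ = 1 := by rw [← map_mul, mul_inv_cancel, map_one]
      exact this
    simp only [h1, integral_const, probReal_univ, one_smul]

end Linearization

/-! ### Existence of linear slices -/

/-- The ball of radius `r` for the supremum of the norm over a group acting linearly. -/
def invariantBall {K E : Type*} [Group K] [NormedAddCommGroup E] [NormedSpace ℝ E]
    (ρ : K →* (E →L[ℝ] E)) (r : ℝ) : Set E := {v | ∀ k, ‖ρ k v‖ < r}

section InvariantBall

variable {K E : Type*} [Group K] [NormedAddCommGroup E] [NormedSpace ℝ E]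
  {ρ : K →* (E →L[ℝ] E)} {r : ℝ}

theorem invariantBall_subset_ball : invariantBall ρ r ⊆ Metric.ball 0 r := fun v hv => by
  have := hv 1
  rw [map_one] at this
  exact mem_ball_zero_iff.2 this

theorem map_mem_invariantBall (h : K) {v : E} (hv : v ∈ invariantBall ρ r) :
    ρ h v ∈ invariantBall ρ r := fun k => by
  have := hv (k * h)
  rw [map_mul] at this
  exact this

theorem zero_mem_invariantBall (hr : 0 < r) : (0 : E) ∈ invariantBall ρ r := fun k => by
  rwa [map_zero, norm_zero]

theorem convex_invariantBall : Convex ℝ (invariantBall ρ r) := by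
  have : invariantBall ρ r = ⋂ k, (ρ k) ⁻¹' Metric.ball 0 r := by
    ext v
    simp [invariantBall]
  rw [this]
  exact convex_iInter fun k => (convex_ball (0 : E) r).linear_preimage (ρ k : E →ₗ[ℝ] E)

theorem isOpen_invariantBall [TopologicalSpace K] [CompactSpace K] (hρ : Continuous ρ) :
    IsOpen (invariantBall ρ r) := by
  refine isOpen_setOf_forall_mem (O := {q : K × E | ‖ρ q.1 q.2‖ < r}) ?_
  have : Continuous fun q : K × E => ‖ρ q.1 q.2‖ := by fun_prop
  exact isOpen_lt this continuous_const

end InvariantBall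

/-- A linear slice at `z` of an action of `G` on the manifold `M`: a chart around `z` in which the
stabilizer of `z` acts linearly and the orbit of `z` is a linear subspace, together with an invariant
complement of this subspace meeting the orbits of all points near `z`. -/
structure LinearSlice (G : Type*) [Group G] [TopologicalSpace G]
    (E : Type*) [NormedAddCommGroup E] [NormedSpace ℝ E] {M : Type*} [TopologicalSpace M]
    [ChartedSpace E M] [MulAction G M] (z : M) where
  e : OpenPartialHomeomorph M E
  e_mem : e ∈ IsManifold.maximalAtlas 𝓘(ℝ, E) ∞ M
  z_mem : z ∈ e.source
  e_z : e z = 0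
  ρ : MulAction.stabilizer G z →* (E →L[ℝ] E)
  continuous_ρ : Continuous ρ
  smul_mem : ∀ (k : MulAction.stabilizer G z), ∀ y ∈ e.source, (k : G) • y ∈ e.source
  e_smul : ∀ (k : MulAction.stabilizer G z), ∀ y ∈ e.source, e ((k : G) • y) = ρ k (e y)
  convex_target : Convex ℝ e.target
  T : Submodule ℝ E
  S : Submodule ℝ E
  isCompl : IsCompl T S
  T_inv : ∀ h, ∀ t ∈ T, ρ h t ∈ T
  S_inv : ∀ h, ∀ s ∈ S, ρ h s ∈ S
  orbit_flat : e '' (e.source ∩ MulAction.orbit G z) = e.target ∩ (T : Set E)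
  stabilizer_le : ∀ s ∈ S, s ∈ e.target →
    MulAction.stabilizer G (e.symm s) ≤ MulAction.stabilizer G z
  orbit_near : ∀ N ∈ 𝓝 z, ∀ᶠ y in 𝓝 z, ∃ g : G, ∃ s ∈ S, s ∈ e.target ∧ e.symm s ∈ N ∧
    y = g • e.symm s

/-- A local diffeomorphism of `E` with derivative the identity at `0`, mapping a subspace to itself
near `0`, covers a neighbourhood of `0` in this subspace. -/
theorem eventually_exists_of_mapsTo_submodule {E : Type*} [NormedAddCommGroup E] [NormedSpace ℝ E]
    [FiniteDimensional ℝ E] {F : E → E} {T : Submodule ℝ E}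
    (hF : HasStrictFDerivAt F (ContinuousLinearMap.id ℝ E) 0) (hF0 : F 0 = 0)
    (hFT : ∀ᶠ t in 𝓝 (0 : E), t ∈ T → F t ∈ T) {N : Set E} (hN : N ∈ 𝓝 (0 : E)) :
    ∀ᶠ t' in 𝓝 (0 : E), t' ∈ T → ∃ t ∈ T, t ∈ N ∧ F t = t' := by
  obtain ⟨p, hp, -, -⟩ := exists_clm_isCompl_ker T
  -- The map `p ∘ F` on `T` has the identity as derivative, so it is locally onto; where `F` maps
  -- into `T`, it is `F` itself.
  have hm : HasStrictFDerivAt (fun t : T => p (F t))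
      ((ContinuousLinearEquiv.refl ℝ T : T ≃L[ℝ] T) : T →L[ℝ] T) 0 := by
    have h1 : HasStrictFDerivAt F (ContinuousLinearMap.id ℝ E) (T.subtypeL 0) := by simpa using hF
    refine ((p.hasStrictFDerivAt (x := F (T.subtypeL 0))).comp (0 : T)
      (h1.comp (0 : T) T.subtypeL.hasStrictFDerivAt)).congr_fderiv ?_
    ext t
    simp [hp]
  have h1 := hm.map_nhds_eq_of_equiv
  have hm0 : p (F ((0 : T) : E)) = 0 := by simp [hF0]
  rw [hm0] at h1
  have h2 : ∀ᶠ t : T in 𝓝 0, (t : E) ∈ N ∧ F t ∈ T := by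
    have hc : Tendsto (fun t : T => (t : E)) (𝓝 0) (𝓝 0) := continuous_subtype_val.tendsto 0
    filter_upwards [hc.eventually hN, hc.eventually hFT] with t ht1 ht2
    exact ⟨ht1, ht2 t.2⟩
  have h3 : ∀ᶠ t' : T in 𝓝 0, ∃ t : T, ((t : E) ∈ N ∧ F t ∈ T) ∧ p (F t) = t' := by
    rw [← h1]
    exact eventually_map.2 (h2.mono fun t ht => ⟨t, ht, rfl⟩)
  have hc : Tendsto p (𝓝 0) (𝓝 0) := by
    have := p.continuous.tendsto 0
    rwa [map_zero] at this
  filter_upwards [hc.eventually h3] with t' ht' ht'T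
  obtain ⟨t, ⟨htN, htT⟩, ht⟩ := ht'
  refine ⟨t, t.2, htN, ?_⟩
  have e1 := congrArg Subtype.val (ht.trans (hp ⟨t', ht'T⟩))
  rwa [hp ⟨F t, htT⟩] at e1

section Slice

variable {EG : Type*} [NormedAddCommGroup EG] [NormedSpace ℝ EG] [FiniteDimensional ℝ EG]
  {G : Type*} [Group G] [TopologicalSpace G] [ChartedSpace EG G] [LieGroup 𝓘(ℝ, EG) ∞ G]
  {E : Type*} [NormedAddCommGroup E] [NormedSpace ℝ E] [FiniteDimensional ℝ E]
  {M : Type*} [TopologicalSpace M] [ChartedSpace E M] [IsManifold 𝓘(ℝ, E) ∞ M] [T2Space M]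
  [MulAction G M] [IsTopologicalGroup G] [ContinuousSMul G M]

/-- Around each point there is a chart in which the stabilizer acts linearly and the orbit is a
linear subspace. -/
theorem exists_linearizing_chart
    (hsm : ContMDiff (𝓘(ℝ, EG).prod 𝓘(ℝ, E)) 𝓘(ℝ, E) ∞ fun p : G × M => p.1 • p.2)
    {z : M} (hK : IsCompact (MulAction.stabilizer G z : Set G))
    {φ : OpenPartialHomeomorph M E} (hφ : φ ∈ IsManifold.maximalAtlas 𝓘(ℝ, E) ∞ M)
    (hz : z ∈ φ.source) (hz0 : φ z = 0) {T : Submodule ℝ E}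
    (hT : φ '' (φ.source ∩ MulAction.orbit G z) = φ.target ∩ (T : Set E)) :
    ∃ ρ : MulAction.stabilizer G z →* (E →L[ℝ] E), Continuous ρ ∧ (∀ h, ∀ t ∈ T, ρ h t ∈ T) ∧
      ∃ e ∈ IsManifold.maximalAtlas 𝓘(ℝ, E) ∞ M, z ∈ e.source ∧ e z = 0 ∧
        e.source ⊆ φ.source ∧ HasFDerivAt (fun v => e (φ.symm v)) (ContinuousLinearMap.id ℝ E) 0 ∧
        (∀ᶠ t in 𝓝 (0 : E), t ∈ T → e.symm t ∈ MulAction.orbit G z) ∧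
        (∀ y : M, (∀ k : MulAction.stabilizer G z, (k : G) • y ∈ e.source) →
          (∀ k : MulAction.stabilizer G z, e ((k : G) • y) = ρ k (e y)) ∧
          (y ∈ MulAction.orbit G z → e y ∈ T)) := by
  obtain ⟨ρ, hρ, hρd⟩ := exists_isotropyRep (G := G) hsm hφ hz hz0
  have hsymm0 : φ.symm 0 = z := by rw [← hz0, φ.left_inv hz]
  have h0t : (0 : E) ∈ φ.target := hz0 ▸ φ.map_source hz
  have hflat : ∀ y ∈ φ.source, y ∈ MulAction.orbit G z → φ y ∈ T := fun y hy hyo =>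
    (hT ▸ mem_image_of_mem φ ⟨hy, hyo⟩ : φ y ∈ φ.target ∩ (T : Set E)).2
  have hflat' : ∀ t ∈ φ.target, t ∈ T → φ.symm t ∈ MulAction.orbit G z := by
    intro t ht htT
    obtain ⟨y, ⟨hy, hyo⟩, rfl⟩ := (hT.symm ▸ ⟨ht, htT⟩ : t ∈ φ '' (φ.source ∩ MulAction.orbit G z))
    rwa [φ.left_inv hy]
  -- The curve `s ↦ h • φ.symm (s • t)` runs in the orbit, so its velocity `ρ h t` in the flat chart
  -- lies in `T`.
  have hTinv : ∀ h, ∀ t ∈ T, ρ h t ∈ T := by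
    intro h t ht
    have hc : HasDerivAt (fun s : ℝ => actionIn G φ ((h : G), s • t)) (ρ h t) 0 := by
      have h1 : HasDerivAt (fun s : ℝ => s • t) t 0 := by
        simpa using (hasDerivAt_id (0 : ℝ)).smul_const t
      have h2 : HasFDerivAt (fun v => actionIn G φ ((h : G), v)) (ρ h) ((0 : ℝ) • t) := by
        rw [zero_smul]; exact hρd h
      exact h2.comp_hasDerivAt (0 : ℝ) h1
    refine HasDerivAt.mem_submodule hc ?_
    have hO := isOpen_actionDomain (G := G) hsm hφ
    have h0 : ((h : G), (0 : ℝ) • t) ∈ actionDomain G φ := by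
      rw [zero_smul]
      refine ⟨⟨mem_univ _, h0t⟩, ?_⟩
      have : (h : G) • z = z := h.2
      simp only [mem_ofPred_eq, hsymm0, this]
      exact hz
    have hcont : Continuous fun s : ℝ => ((h : G), s • t) := by fun_prop
    filter_upwards [hcont.continuousAt.eventually (hO.mem_nhds h0)] with s hs
    refine hflat _ hs.2 ?_
    have := hflat' (s • t) hs.1.2 (T.smul_mem s ht)
    exact MulAction.mem_orbit_of_mem_orbit _ this
  obtain ⟨Φ, hΦe, hΦz, hΦT, W, hWo, h0W, hWφ, hΦs, hΦd⟩ :=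
    exists_equivariant_map (G := G) hsm hφ hz hz0 hK hρ hρd
  obtain ⟨θ, hθ0, hθW, hθF, hθ1, hθ2⟩ := exists_local_diffeo hWo h0W hΦs
    (ContinuousLinearEquiv.refl ℝ E) hΦd
  have hes : (φ.trans θ).source = φ.source ∩ φ ⁻¹' θ.source := OpenPartialHomeomorph.trans_source _ _
  have heΦ : ∀ y ∈ (φ.trans θ).source, φ.trans θ y = Φ y := fun y hy => by
    rw [OpenPartialHomeomorph.coe_trans, Function.comp_apply, hθF]
    rw [hes] at hy
    simp only [φ.left_inv hy.1]
  have hze : z ∈ (φ.trans θ).source := by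
    rw [hes]; exact ⟨hz, by rw [mem_preimage, hz0]; exact hθ0⟩
  have hFT : ∀ᶠ t in 𝓝 (0 : E), t ∈ T → Φ (φ.symm t) ∈ T := by
    have : CompactSpace (MulAction.stabilizer G z) := isCompact_iff_compactSpace.1 hK
    have hO := isOpen_actionDomain (G := G) hsm hφ
    have hc : Continuous fun q : MulAction.stabilizer G z × E => ((q.1 : G), q.2) := by fun_prop
    have hO' := isOpen_setOf_forall_mem (hO.preimage hc)
    have h0 : (0 : E) ∈ {v | ∀ k : MulAction.stabilizer G z, (k, v) ∈
        (fun q : MulAction.stabilizer G z × E => ((q.1 : G), q.2)) ⁻¹' actionDomain G φ} := by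
      intro k
      refine ⟨⟨mem_univ _, h0t⟩, ?_⟩
      have : (k : G) • z = z := k.2
      simp only [mem_ofPred_eq, hsymm0, this]
      exact hz
    filter_upwards [hO'.mem_nhds h0] with t ht htT
    refine hΦT T hTinv _ fun k => hflat _ (ht k).2 ?_
    exact MulAction.mem_orbit_of_mem_orbit _ (hflat' t (ht k).1.2 htT)
  refine ⟨ρ, hρ, hTinv, φ.trans θ, trans_mem_maximalAtlas hφ θ hθ1 hθ2, hze, ?_, ?_, ?_, ?_, ?_⟩
  · rw [heΦ z hze, hΦz]
  · rw [hes]; exact inter_subset_left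
  · refine hΦd.congr_of_eventuallyEq ?_
    filter_upwards [φ.open_target.mem_nhds h0t] with v hv
    rw [OpenPartialHomeomorph.coe_trans, Function.comp_apply, hθF, φ.right_inv hv]
  -- Averaging maps the flat orbit into `T`; local surjectivity on `T` shows that it still fills `T`
  -- near `0`.
  · have hst : HasStrictFDerivAt (fun v => Φ (φ.symm v)) (ContinuousLinearMap.id ℝ E) 0 :=
      (hΦs.contDiffAt (hWo.mem_nhds h0W)).hasStrictFDerivAt' hΦd (by simp)
    have := eventually_exists_of_mapsTo_submodule hst (by simp only [hsymm0, hΦz]) hFT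
      (N := φ.target ∩ θ.source)
      (inter_mem (φ.open_target.mem_nhds h0t) (θ.open_source.mem_nhds hθ0))
    filter_upwards [this] with t' ht' ht'T
    obtain ⟨t, htT, ⟨htφ, htθ⟩, rfl⟩ := ht' ht'T
    rw [OpenPartialHomeomorph.coe_trans_symm, Function.comp_apply, ← hθF, θ.left_inv htθ]
    exact hflat' t htφ htT
  · intro y hy
    have h1 : y ∈ (φ.trans θ).source := by simpa using hy 1
    refine ⟨fun k => ?_, fun hyo => ?_⟩
    · rw [heΦ _ (hy k), heΦ _ h1, hΦe]
    · rw [heΦ _ h1]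
      refine hΦT T hTinv y fun k => hflat _ ?_ (MulAction.mem_orbit_of_mem_orbit _ hyo)
      have := hy k
      rw [hes] at this
      exact this.1

end Slice

section Tube

variable {EG : Type*} [NormedAddCommGroup EG] [NormedSpace ℝ EG] [FiniteDimensional ℝ EG]
  {G : Type*} [Group G] [TopologicalSpace G] [ChartedSpace EG G] [LieGroup 𝓘(ℝ, EG) ∞ G]
  {E : Type*} [NormedAddCommGroup E] [NormedSpace ℝ E] [FiniteDimensional ℝ E]
  {M : Type*} [TopologicalSpace M] [ChartedSpace E M] [IsManifold 𝓘(ℝ, E) ∞ M] [T2Space M]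
  [MulAction G M] [ContMDiffSMul 𝓘(ℝ, EG) 𝓘(ℝ, E) ∞ G M] [ProperSMul G M]

/-- Moving a slice along a local section of the orbit map gives a local diffeomorphism. -/
theorem hasStrictFDerivAt_tube {φ e : OpenPartialHomeomorph M E}
    (he : e ∈ IsManifold.maximalAtlas 𝓘(ℝ, E) ∞ M) {z : M}
    (hz : z ∈ φ.source) (hze : z ∈ e.source) (hez : e z = 0)
    (hd : HasFDerivAt (fun v => e (φ.symm v)) (ContinuousLinearMap.id ℝ E) 0)
    {T S : Submodule ℝ E} (h : IsCompl T S) {τ : E → G} (hτ0 : τ 0 = 1)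
    (hτ : ContMDiffAt 𝓘(ℝ, E) 𝓘(ℝ, EG) ∞ τ 0)
    (hτT : ∀ᶠ v in 𝓝 (0 : E), v ∈ T → φ (τ v • z) = v) :
    HasStrictFDerivAt
      (fun v => e (τ (T.projection S h v) • e.symm (v - T.projection S h v)))
      (ContinuousLinearMap.id ℝ E) 0 := by
  have _ : IsTopologicalGroup G := topologicalGroup_of_lieGroup 𝓘(ℝ, EG) ∞
  have hesymm0 : e.symm 0 = z := by rw [← hez, e.left_inv hze]
  have h0t : (0 : E) ∈ e.target := hez ▸ e.map_source hze
  set p : E →L[ℝ] E := (T.projection S h).toContinuousLinearMap with hp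
  set Ψ : E → E := fun v => e (τ (p v) • e.symm (v - p v)) with hΨ
  have hcd : ContDiffAt ℝ ∞ Ψ 0 := by
    refine contMDiffAt_iff_contDiffAt.1 ?_
    have h1 : ContMDiffAt 𝓘(ℝ, E) 𝓘(ℝ, EG) ∞ (fun v => τ (p v)) 0 := by
      refine ContMDiffAt.comp (I' := 𝓘(ℝ, E)) (g := τ) 0 ?_ p.contDiff.contMDiff.contMDiffAt
      rw [map_zero]; exact hτ
    have h2 : ContMDiffAt 𝓘(ℝ, E) 𝓘(ℝ, E) ∞ (fun v => e.symm (v - p v)) 0 := by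
      refine ContMDiffAt.comp (I' := 𝓘(ℝ, E)) (g := e.symm) 0 ?_
        (contDiff_id.sub p.contDiff).contMDiff.contMDiffAt
      have : (0 : E) - p 0 = 0 := by simp
      simp only [this]
      exact contMDiffAt_symm_of_mem_maximalAtlas he h0t
    refine ContMDiffAt.comp (I' := 𝓘(ℝ, E)) (g := e) 0 ?_ (h1.smul h2)
    refine contMDiffAt_of_mem_maximalAtlas he ?_
    simpa [hτ0, hesymm0] using hze
  have hdd : HasFDerivAt Ψ (fderiv ℝ Ψ 0) 0 := (hcd.differentiableAt (by simp)).hasFDerivAt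
  have hdir : ∀ w c, HasDerivAt (fun x : ℝ => Ψ (x • w)) c 0 → fderiv ℝ Ψ 0 w = c := by
    intro w c hc
    have h1 : HasDerivAt (fun x : ℝ => x • w) w 0 := by
      simpa using (hasDerivAt_id (0 : ℝ)).smul_const w
    have h2 : HasFDerivAt Ψ (fderiv ℝ Ψ 0) ((0 : ℝ) • w) := by rw [zero_smul]; exact hdd
    have h3 : HasDerivAt (fun x : ℝ => Ψ (x • w)) (fderiv ℝ Ψ 0 w) 0 :=
      HasFDerivAt.comp_hasDerivAt (f := fun x : ℝ => x • w) (0 : ℝ) h2 h1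
    exact h3.unique hc
  have hline : ∀ w : E, Tendsto (fun x : ℝ => x • w) (𝓝 0) (𝓝 0) := fun w => by
    have : Continuous fun x : ℝ => x • w := by fun_prop
    simpa using this.tendsto 0
  -- On `T` the map is `e ∘ φ.symm`, as `τ` is a section of the orbit map; on `S` it is the identity
  -- because `τ 0 = 1`.
  have hT : ∀ t ∈ T, fderiv ℝ Ψ 0 t = t := by
    intro t ht
    refine hdir t t ?_
    have h1 : HasDerivAt (fun x : ℝ => x • t) t 0 := by
      simpa using (hasDerivAt_id (0 : ℝ)).smul_const t
    have h2 : HasFDerivAt (fun v => e (φ.symm v)) (ContinuousLinearMap.id ℝ E) ((0 : ℝ) • t) := by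
      rw [zero_smul]; exact hd
    refine (h2.comp_hasDerivAt (0 : ℝ) h1).congr_of_eventuallyEq ?_
    have h3 : ∀ᶠ v in 𝓝 (0 : E), τ v • z ∈ φ.source := by
      have hc : ContinuousAt (fun v => τ v • z) 0 := hτ.continuousAt.smul continuousAt_const
      exact hc.eventually (by
        beta_reduce; rw [hτ0, one_smul]; exact φ.open_source.mem_nhds hz)
    filter_upwards [(hline t).eventually hτT, (hline t).eventually h3] with x hx1 hx2
    have hpx : p (x • t) = x • t := T.projection_apply_left h ⟨x • t, T.smul_mem x ht⟩
    simp only [hΨ, hpx, sub_self, hesymm0, Function.comp_apply]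
    rw [← φ.left_inv hx2, hx1 (T.smul_mem x ht)]
  have hS : ∀ s ∈ S, fderiv ℝ Ψ 0 s = s := by
    intro s hs
    refine hdir s s ?_
    have h1 : HasDerivAt (fun x : ℝ => x • s) s 0 := by
      simpa using (hasDerivAt_id (0 : ℝ)).smul_const s
    refine h1.congr_of_eventuallyEq ?_
    filter_upwards [(hline s).eventually (e.open_target.mem_nhds h0t)] with x hx
    have hpx : p (x • s) = 0 := T.projection_apply_right h ⟨x • s, S.smul_mem x hs⟩
    simp only [hΨ, hpx, sub_zero, hτ0, one_smul]
    exact e.right_inv hx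
  refine hcd.hasStrictFDerivAt' (hdd.congr_fderiv ?_) (by simp)
  ext v
  have h1 := hT _ (T.projection_apply_mem h v)
  have h2 := hS _ (T.sub_projection_mem h v)
  rw [map_sub, h1] at h2
  simpa using h2

/-- The tube map `Ψ` is a local diffeomorphism. Its injectivity forces the isotropy groups of slice
points into `G_z`, and its local surjectivity makes the slice meet every nearby orbit. -/
theorem exists_linearSlice
    (hsm : ContMDiff (𝓘(ℝ, EG).prod 𝓘(ℝ, E)) 𝓘(ℝ, E) ∞ fun p : G × M => p.1 • p.2) (z : M) :
    Nonempty (LinearSlice G E z) := by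
  have _ : IsTopologicalGroup G := topologicalGroup_of_lieGroup 𝓘(ℝ, EG) ∞
  have hK : IsCompact (MulAction.stabilizer G z : Set G) := isCompact_stabilizer z
  have _ : CompactSpace (MulAction.stabilizer G z) := isCompact_iff_compactSpace.1 hK
  obtain ⟨φ, hφ, hz, hz0, T, hT, τ, hτ0, hτ, hτT⟩ := exists_orbit_chart (G := G) EG E z
  obtain ⟨ρ, hρ, hTinv, e, he, hze, hez, heφ, hed, heo, hee⟩ :=
    exists_linearizing_chart (G := G) hsm hK hφ hz hz0 hT
  obtain ⟨B, hBs, hBp, hBi⟩ := exists_invariant_inner hρ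
  obtain ⟨S, hc, hSinv⟩ := exists_isCompl_invariant hBs hBp hBi hTinv
  have hflat : ∀ y ∈ φ.source, y ∈ MulAction.orbit G z → φ y ∈ T := fun y hy hyo =>
    (hT ▸ mem_image_of_mem φ ⟨hy, hyo⟩ : φ y ∈ φ.target ∩ (T : Set E)).2
  have hesymm0 : e.symm 0 = z := by rw [← hez, e.left_inv hze]
  have h0t : (0 : E) ∈ e.target := hez ▸ e.map_source hze
  have hsc : ContinuousAt e.symm 0 := e.continuousAt_symm h0t
  set Ψ : E → E := fun v => e (τ (T.projection S hc v) • e.symm (v - T.projection S hc v)) with hΨ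
  have hΨd : HasStrictFDerivAt Ψ ((ContinuousLinearEquiv.refl ℝ E : E ≃L[ℝ] E) : E →L[ℝ] E) 0 :=
    hasStrictFDerivAt_tube he hz hze hez hed hc hτ0 hτ hτT
  have hΨ0 : Ψ 0 = 0 := by simp [hΨ, hτ0, hesymm0, hez]
  have hpc : Continuous (T.projection S hc) := LinearMap.continuous_of_finiteDimensional _
  have hτz : ContinuousAt (fun v => τ v • z) 0 := hτ.continuousAt.smul continuousAt_const
  have hτφ : ∀ᶠ v in 𝓝 (0 : E), τ v • z ∈ φ.source :=
    hτz.eventually (by beta_reduce; rw [hτ0, one_smul]; exact φ.open_source.mem_nhds hz)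
  obtain ⟨ε, hε, hinj⟩ : ∃ ε > 0, InjOn Ψ (Metric.ball 0 (ε + ε)) := by
    obtain ⟨ε, hε, hb⟩ := Metric.isOpen_iff.1 (hΨd.toOpenPartialHomeomorph Ψ).open_source _
      hΨd.mem_toOpenPartialHomeomorph_source
    refine ⟨ε / 2, by positivity, ?_⟩
    rw [add_halves]
    exact (hΨd.toOpenPartialHomeomorph Ψ).injOn.mono hb
  have hN : ∀ᶠ n in 𝓝 (1 : G), n • z ∈ φ.source ∧ ‖φ (n • z)‖ < ε ∧
      τ (φ (n • z)) • z ∈ φ.source ∧ (φ (n • z) ∈ T → φ (τ (φ (n • z)) • z) = φ (n • z)) := by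
    have hcz : ContinuousAt (fun n : G => n • z) 1 := by fun_prop
    have h1z : (1 : G) • z = z := one_smul G z
    have hcφ : Tendsto (fun n : G => φ (n • z)) (𝓝 1) (𝓝 0) := by
      have : ContinuousAt (fun n : G => φ (n • z)) 1 :=
        ContinuousAt.comp (g := φ) (by rw [h1z]; exact φ.continuousAt hz) hcz
      have h2 := this.tendsto
      simp only [h1z, hz0] at h2
      exact h2
    refine Eventually.and ?_ (Eventually.and ?_ (Eventually.and ?_ ?_))
    · exact hcz.eventually (by beta_reduce; rw [h1z]; exact φ.open_source.mem_nhds hz)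
    · exact hcφ.norm.eventually (by rw [norm_zero]; exact gt_mem_nhds hε)
    · exact hcφ.eventually hτφ
    · exact hcφ.eventually hτT
  have hstab := eventually_exists_mem_stabilizer (G := G) z hN
  have hstab' : ∀ᶠ y in 𝓝 z, ∀ g : G, g • y = y → ∃ n, (n • z ∈ φ.source ∧ ‖φ (n • z)‖ < ε ∧
      τ (φ (n • z)) • z ∈ φ.source ∧ (φ (n • z) ∈ T → φ (τ (φ (n • z)) • z) = φ (n • z))) ∧
      ∃ k ∈ MulAction.stabilizer G z, g = n * k := by
    have hdiag : Tendsto (fun y : M => (y, y)) (𝓝 z) (𝓝 (z, z)) :=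
      (continuous_id.prodMk continuous_id).tendsto z
    exact hdiag.eventually hstab
  have hinvN : ∀ᶠ y in 𝓝 z, ∀ k : MulAction.stabilizer G z, (k : G) • y ∈ e.source := by
    have hcont : Continuous fun q : MulAction.stabilizer G z × M => (q.1 : G) • q.2 := by fun_prop
    refine (isOpen_setOf_forall_mem (e.open_source.preimage hcont)).mem_nhds fun k => ?_
    have : (k : G) • z = z := k.2
    simp only [mem_preimage, this]
    exact hze
  have hsc' : Tendsto e.symm (𝓝 0) (𝓝 z) := by
    have := hsc.tendsto
    rwa [hesymm0] at this
  obtain ⟨r, hr, hball⟩ := Metric.eventually_nhds_iff_ball.1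
    ((e.open_target.eventually_mem h0t).and ((hsc'.eventually hstab').and
      ((hsc'.eventually hinvN).and (heo.and (Metric.ball_mem_nhds (0 : E) hε)))))
  -- Restricting to an invariant convex open set makes the chart domain stable under `G_z` and
  -- allows segments to be drawn in the target.
  set D := invariantBall ρ r with hD
  have hDo : IsOpen D := isOpen_invariantBall hρ
  have hDp : ∀ v ∈ D, _ := fun v hv => hball v (invariantBall_subset_ball hv)
  have hRo : IsOpen (e.source ∩ e ⁻¹' D) := e.isOpen_inter_preimage hDo
  set e' := e.restrOpen _ hRo with he'
  have hsource : ∀ y, y ∈ e'.source ↔ y ∈ e.source ∧ e y ∈ D := fun y =>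
    ⟨fun h => h.2, fun h => ⟨h.1, h⟩⟩
  have htarget : e'.target = D := by
    ext v
    constructor
    · intro hv
      have h1 := ((hsource _).1 (e'.map_target hv)).2
      rwa [show e (e'.symm v) = v from e'.right_inv hv] at h1
    · intro hv
      have h1 := (hDp v hv).1
      have h2 : e.symm v ∈ e'.source := by
        refine (hsource _).2 ⟨e.map_target h1, ?_⟩
        rwa [e.right_inv h1]
      have h3 := e'.map_source h2
      rwa [show e' (e.symm v) = v from e.right_inv h1] at h3
  have hke : ∀ y ∈ e'.source, ∀ k : MulAction.stabilizer G z, (k : G) • y ∈ e.source := by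
    intro y hy k
    have h1 := (hsource y).1 hy
    have h2 := (hDp _ h1.2).2.2.1 k
    rwa [e.left_inv h1.1] at h2
  have hesm : ∀ (k : MulAction.stabilizer G z), ∀ y ∈ e'.source, e ((k : G) • y) = ρ k (e y) :=
    fun k y hy => (hee y (hke y hy)).1 k
  refine ⟨{ e := e'
            e_mem := restrOpen_mem_maximalAtlas he hRo
            z_mem := (hsource z).2 ⟨hze, hez ▸ zero_mem_invariantBall hr⟩
            e_z := hez
            ρ := ρ
            continuous_ρ := hρ
            smul_mem := ?_
            e_smul := hesm
            convex_target := htarget ▸ convex_invariantBall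
            T := T
            S := S
            isCompl := hc
            T_inv := hTinv
            S_inv := hSinv
            orbit_flat := ?_
            stabilizer_le := ?_
            orbit_near := ?_ }⟩
  · intro k y hy
    refine (hsource _).2 ⟨hke y hy k, ?_⟩
    rw [hesm k y hy]
    exact map_mem_invariantBall k ((hsource y).1 hy).2
  · apply Subset.antisymm
    · rintro _ ⟨y, ⟨hy, hyo⟩, rfl⟩
      exact ⟨e'.map_source hy, (hee y (hke y hy)).2 hyo⟩
    · rintro t ⟨ht, htT⟩
      have h1 := (hDp t (htarget ▸ ht)).2.2.2.1 htT
      exact ⟨e'.symm t, ⟨e'.map_target ht, h1⟩, e'.right_inv ht⟩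
  · intro s hs hst g hg
    have hsD : s ∈ D := htarget ▸ hst
    obtain ⟨hs1, hs2, hs3, hs4, hs5⟩ := hDp s hsD
    obtain ⟨n, ⟨hn1, hn2, hn3, hn4⟩, k, hk, rfl⟩ := hs2 g hg
    have hnT : φ (n • z) ∈ T := hflat _ hn1 (MulAction.mem_orbit z n)
    set t := φ (n • z) with ht
    have h1 : τ t • z = n • z := φ.injOn hn3 hn1 (hn4 hnT)
    -- Writing `g = τ t * k'` with `k'` in `G_z`, the relation `g • e.symm s = e.symm s` becomes `Ψ
    -- (t + ρ k' s) = s = Ψ s`. Injectivity gives `t = 0`, so `g = k'`. Both `t` and `ρ k' s` have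
    -- norm below `ε`, whence the radius `ε + ε`.
    have hk' : (τ t)⁻¹ * n * k ∈ MulAction.stabilizer G z := by
      rw [MulAction.mem_stabilizer_iff, mul_smul, mul_smul, MulAction.mem_stabilizer_iff.1 hk, ← h1,
        inv_smul_smul]
    set k' : MulAction.stabilizer G z := ⟨_, hk'⟩ with hk'def
    have hs' : e.symm s ∈ e'.source := e'.map_target hst
    have hkD : ρ k' s ∈ D := map_mem_invariantBall k' hsD
    have hks : e.symm (ρ k' s) = (k' : G) • e.symm s := by
      have h2 := hesm k' _ hs'
      rw [e.right_inv hs1] at h2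
      rw [← h2, e.left_inv (hke _ hs' k')]
    have hpt : T.projection S hc (t + ρ k' s) = t := by
      rw [map_add, T.projection_apply_left hc ⟨t, hnT⟩,
        T.projection_apply_right hc ⟨ρ k' s, hSinv k' s hs⟩, add_zero]
    have hps : T.projection S hc s = 0 := T.projection_apply_right hc ⟨s, hs⟩
    have hΨ1 : Ψ (t + ρ k' s) = s := by
      simp only [hΨ, hpt, add_sub_cancel_left, hks, smul_smul]
      have : τ t * (k' : G) = n * k := by rw [hk'def]; simp only; group
      have hg' : (n * k) • e.symm s = e.symm s := MulAction.mem_stabilizer_iff.1 hg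
      rw [this, hg']
      exact e.right_inv hs1
    have hΨ2 : Ψ s = s := by
      simp only [hΨ, hps, sub_zero, hτ0, one_smul]
      exact e.right_inv hs1
    have hb1 : t + ρ k' s ∈ Metric.ball (0 : E) (ε + ε) := by
      rw [mem_ball_zero_iff]
      exact (norm_add_le _ _).trans_lt
        (add_lt_add hn2 (mem_ball_zero_iff.1 (hDp _ hkD).2.2.2.2))
    have hb2 : s ∈ Metric.ball (0 : E) (ε + ε) :=
      Metric.ball_subset_ball (by linarith) hs5
    have h3 := hinj hb1 hb2 (hΨ1.trans hΨ2.symm)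
    have ht0 : t = 0 := by
      rw [← hpt, h3, hps]
    have h4 : (n * k) = k' := by
      rw [hk'def]
      simp only [ht0, hτ0]
      group
    rw [h4]
    exact k'.2
  · intro N hN'
    have h1 := hΨd.map_nhds_eq_of_equiv
    rw [hΨ0] at h1
    have hq : Tendsto (fun v => v - T.projection S hc v) (𝓝 0) (𝓝 0) := by
      have hqc : Continuous fun v => v - T.projection S hc v := continuous_id.sub hpc
      simpa using hqc.tendsto 0
    have hcomb : ContinuousAt (fun v => τ (T.projection S hc v) •
        e.symm (v - T.projection S hc v)) 0 := by
      refine ContinuousAt.smul ?_ ?_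
      · refine ContinuousAt.comp (g := τ) ?_ hpc.continuousAt
        rw [map_zero]; exact hτ.continuousAt
      · refine ContinuousAt.comp (g := e.symm) ?_ (continuous_id.sub hpc).continuousAt
        simpa using hsc
    have h2 : ∀ᶠ v in 𝓝 (0 : E), v - T.projection S hc v ∈ D ∧
        e.symm (v - T.projection S hc v) ∈ N ∧
        τ (T.projection S hc v) • e.symm (v - T.projection S hc v) ∈ e.source := by
      refine (hq.eventually (hDo.mem_nhds (zero_mem_invariantBall hr))).and (Eventually.and ?_ ?_)
      · exact hq.eventually (hsc'.eventually hN')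
      · exact hcomb.eventually (by
          simpa [hτ0, hesymm0] using e.open_source.mem_nhds hze)
    have h3 : ∀ᶠ w in 𝓝 (0 : E), ∃ v, (v - T.projection S hc v ∈ D ∧
        e.symm (v - T.projection S hc v) ∈ N ∧
        τ (T.projection S hc v) • e.symm (v - T.projection S hc v) ∈ e.source) ∧ Ψ v = w := by
      rw [← h1]
      exact eventually_map.2 (h2.mono fun v hv => ⟨v, hv, rfl⟩)
    have hec : Tendsto e (𝓝 z) (𝓝 0) := by
      have := (e.continuousAt hze).tendsto
      rwa [hez] at this
    filter_upwards [hec.eventually h3, e.open_source.mem_nhds hze] with y hy hye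
    obtain ⟨v, ⟨hv1, hv2, hv3⟩, hv⟩ := hy
    refine ⟨τ (T.projection S hc v), v - T.projection S hc v, T.sub_projection_mem hc v,
      htarget ▸ hv1, hv2, ?_⟩
    exact e.injOn hye hv3 hv.symm

end Tube

/-- In an orthogonal representation of a compact group, the isotropy groups at the interior points
of a shortest segment from `s` to the orbit of `t` fix both ends of the segment. -/
theorem exists_forall_segment_fixed {K E : Type*} [Group K] [TopologicalSpace K] [CompactSpace K]
    [NormedAddCommGroup E] [NormedSpace ℝ E] [FiniteDimensional ℝ E] {ρ : K →* (E →L[ℝ] E)}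
    (hρ : Continuous ρ) {B : LinearMap.BilinForm ℝ E} (hsymm : ∀ v w, B v w = B w v)
    (hpos : ∀ v, v ≠ 0 → 0 < B v v) (hB : ∀ h v w, B (ρ h v) (ρ h w) = B v w) (s t : E) :
    ∃ k, ∀ c ∈ Ioo (0 : ℝ) 1, ∀ h, ρ h ((1 - c) • s + c • ρ k t) = (1 - c) • s + c • ρ k t →
      ρ h s = s ∧ ρ h (ρ k t) = ρ k t := by
  have hBc : Continuous (B s) := LinearMap.continuous_of_finiteDimensional (B s)
  have hc : Continuous fun k => B s (ρ k t) := hBc.comp (by fun_prop)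
  -- Since norms are invariant, maximizing `B s (ρ k t)` minimizes the distance from `s` to the
  -- orbit of `t`.
  obtain ⟨k, -, hk⟩ := isCompact_univ.exists_isMaxOn (univ_nonempty (α := K)) hc.continuousOn
  refine ⟨k, fun c hc h hh => ?_⟩
  have hmax : B s (ρ h (ρ k t)) ≤ B s (ρ k t) := by
    have := hk (mem_univ (h * k))
    simpa using this
  set t' := ρ k t
  -- If `h` fixes an interior point, the two end displacements are proportional with opposite signs.
  -- Pairing with `s`, maximality makes `B s (s - ρ h s)` nonpositive, whereas it equals half the
  -- squared norm of `s - ρ h s`.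
  have h1 : (1 - c) • (s - ρ h s) = -(c • (t' - ρ h t')) := by
    rw [map_add, map_smul, map_smul] at hh
    rw [smul_sub, smul_sub, neg_sub, sub_eq_sub_iff_add_eq_add, ← hh]
    abel
  have h2 : (1 - c) * B s (s - ρ h s) = -(c * (B s t' - B s (ρ h t'))) := by
    have := congrArg (B s) h1
    simpa using this
  have h3 : 2 * B s (s - ρ h s) = B (s - ρ h s) (s - ρ h s) := by
    simp only [map_sub, LinearMap.sub_apply, hB, hsymm (ρ h s) s]
    ring
  have h4 : s - ρ h s = 0 := by
    by_contra hne
    have := hpos _ hne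
    nlinarith [mul_nonneg hc.1.le (sub_nonneg.2 hmax), mul_pos (sub_pos.2 hc.2) this]
  refine ⟨(sub_eq_zero.1 h4).symm, ?_⟩
  rw [h4, smul_zero, eq_comm, neg_eq_zero, smul_eq_zero] at h1
  exact (sub_eq_zero.1 (h1.resolve_left hc.1.ne')).symm

/-! ### Orbit types and isotropy groups along a slice -/

section SetAction

variable {G : Type*} [Group G] {M : Type*} [MulAction G M]

theorem mem_stabilizer_smul_iff {g a : G} {x : M} :
    g ∈ MulAction.stabilizer G (a • x) ↔ a⁻¹ * g * a ∈ MulAction.stabilizer G x := by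
  simp only [MulAction.mem_stabilizer_iff, mul_smul, inv_smul_eq_iff]

theorem stabilizer_smul_le_iff {a : G} {x y : M} :
    MulAction.stabilizer G (a • x) ≤ MulAction.stabilizer G (a • y) ↔
      MulAction.stabilizer G x ≤ MulAction.stabilizer G y := by
  constructor
  · intro h g hg
    have h1 : a * g * a⁻¹ ∈ MulAction.stabilizer G (a • x) := by
      rw [mem_stabilizer_smul_iff]
      convert hg using 1
      group
    have h2 := mem_stabilizer_smul_iff.1 (h h1)
    convert h2 using 1
    group
  · intro h g hg
    exact mem_stabilizer_smul_iff.2 (h (mem_stabilizer_smul_iff.1 hg))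

variable (M) in
/-- The set of points with isotropy group conjugate to `H`. -/
def orbitTypeSet (H : Subgroup G) : Set M := {y | ∃ g : G, MulAction.stabilizer G (g • y) = H}

variable (M) in
/-- The set of points whose isotropy group contains a conjugate of `H`. -/
def subconjugateSet (H : Subgroup G) : Set M :=
  {y | ∃ g : G, H ≤ MulAction.stabilizer G (g • y)}

theorem smul_mem_orbitTypeSet {H : Subgroup G} (g : G) {y : M} (hy : y ∈ orbitTypeSet M H) :
    g • y ∈ orbitTypeSet M H := by
  obtain ⟨a, ha⟩ := hy
  exact ⟨a * g⁻¹, by rwa [mul_smul, inv_smul_smul]⟩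

theorem smul_mem_subconjugateSet {H : Subgroup G} (g : G) {y : M}
    (hy : y ∈ subconjugateSet M H) : g • y ∈ subconjugateSet M H := by
  obtain ⟨a, ha⟩ := hy
  exact ⟨a * g⁻¹, by rwa [mul_smul, inv_smul_smul]⟩

theorem smul_mem_interior [TopologicalSpace M] [ContinuousConstSMul G M] {A : Set M}
    (hA : ∀ (g : G), ∀ y ∈ A, g • y ∈ A) (g : G) {y : M} (hy : y ∈ interior A) :
    g • y ∈ interior A := by
  rw [mem_interior_iff_mem_nhds] at hy ⊢
  have h1 : (fun w : M => g⁻¹ • w) ⁻¹' A ∈ 𝓝 (g • y) :=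
    (continuous_const_smul g⁻¹).continuousAt.preimage_mem_nhds (by rwa [inv_smul_smul])
  filter_upwards [h1] with w hw
  have := hA g _ hw
  rwa [smul_inv_smul] at this

end SetAction

namespace LinearSlice

variable {G : Type*} [Group G] [TopologicalSpace G]
  {E : Type*} [NormedAddCommGroup E] [NormedSpace ℝ E]
  {M : Type*} [TopologicalSpace M] [ChartedSpace E M] [MulAction G M] {z : M}
  (sl : LinearSlice G E z)

theorem zero_mem_target : (0 : E) ∈ sl.e.target := sl.e_z ▸ sl.e.map_source sl.z_mem

theorem symm_zero : sl.e.symm 0 = z := by rw [← sl.e_z, sl.e.left_inv sl.z_mem]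

theorem map_mem_target (k : MulAction.stabilizer G z) {v : E} (hv : v ∈ sl.e.target) :
    sl.ρ k v ∈ sl.e.target := by
  have h1 := sl.e.map_target hv
  have h2 := sl.e.map_source (sl.smul_mem k _ h1)
  rwa [sl.e_smul k _ h1, sl.e.right_inv hv] at h2

theorem symm_map (k : MulAction.stabilizer G z) {v : E} (hv : v ∈ sl.e.target) :
    sl.e.symm (sl.ρ k v) = (k : G) • sl.e.symm v := by
  have h1 := sl.e.map_target hv
  have h2 := sl.e_smul k _ h1
  rw [sl.e.right_inv hv] at h2
  rw [← h2, sl.e.left_inv (sl.smul_mem k _ h1)]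

theorem mem_stabilizer_symm_iff (k : MulAction.stabilizer G z) {v : E} (hv : v ∈ sl.e.target) :
    (k : G) ∈ MulAction.stabilizer G (sl.e.symm v) ↔ sl.ρ k v = v := by
  rw [MulAction.mem_stabilizer_iff, ← sl.symm_map k hv]
  exact ⟨fun h => sl.e.symm.injOn (sl.map_mem_target k hv) hv h, fun h => by rw [h]⟩

/-- Only elements of `G_z` can fix a slice point, so comparing isotropy groups becomes a question
about the representation `ρ`. -/
theorem stabilizer_symm_le_iff {s t : E} (hs : s ∈ sl.S) (hst : s ∈ sl.e.target)
    (htt : t ∈ sl.e.target) :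
    MulAction.stabilizer G (sl.e.symm s) ≤ MulAction.stabilizer G (sl.e.symm t) ↔
      ∀ k, sl.ρ k s = s → sl.ρ k t = t := by
  constructor
  · intro h k hk
    exact (sl.mem_stabilizer_symm_iff k htt).1 (h ((sl.mem_stabilizer_symm_iff k hst).2 hk))
  · intro h g hg
    have hgz := sl.stabilizer_le s hs hst hg
    exact (sl.mem_stabilizer_symm_iff ⟨g, hgz⟩ htt).2
      (h _ ((sl.mem_stabilizer_symm_iff ⟨g, hgz⟩ hst).1 hg))

theorem tendsto_symm {v : E} (hv : v ∈ sl.e.target) {X : Type*} {l : Filter X} {f : X → E}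
    (hf : Tendsto f l (𝓝 v)) : Tendsto (fun c => sl.e.symm (f c)) l (𝓝 (sl.e.symm v)) :=
  (sl.e.continuousAt_symm hv).tendsto.comp hf

end LinearSlice

/-! ### Principal orbit theorem -/

section Principal

variable {EG : Type*} [NormedAddCommGroup EG] [NormedSpace ℝ EG] [FiniteDimensional ℝ EG]
  {G : Type*} [Group G] [TopologicalSpace G] [ChartedSpace EG G] [LieGroup 𝓘(ℝ, EG) ∞ G]
  {E : Type*} [NormedAddCommGroup E] [NormedSpace ℝ E] [FiniteDimensional ℝ E]
  {M : Type*} [TopologicalSpace M] [ChartedSpace E M] [IsManifold 𝓘(ℝ, E) ∞ M] [T2Space M]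
  [MulAction G M] [ContMDiffSMul 𝓘(ℝ, EG) 𝓘(ℝ, E) ∞ G M] [ProperSMul G M]

theorem stabilizer_smul_le_of_le
    (_hsm : ContMDiff (𝓘(ℝ, EG).prod 𝓘(ℝ, E)) 𝓘(ℝ, E) ∞ fun p : G × M => p.1 • p.2)
    {x : M} {a : G}
    (h : MulAction.stabilizer G x ≤ MulAction.stabilizer G (a • x)) :
    MulAction.stabilizer G (a • x) ≤ MulAction.stabilizer G x := by
  have h1 := stabilizer_le_of_smul_le EG E (x := a • x) (a := a⁻¹) (by rwa [inv_smul_smul])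
  rwa [inv_smul_smul] at h1

/-- Near `x`, the isotropy groups containing the one of `x` are equal to it. -/
theorem LinearSlice.eventually_stabilizer_eq
    (hsm : ContMDiff (𝓘(ℝ, EG).prod 𝓘(ℝ, E)) 𝓘(ℝ, E) ∞ fun p : G × M => p.1 • p.2)
    {x : M} (sl : LinearSlice G E x) :
    ∀ᶠ y in 𝓝 x, MulAction.stabilizer G x ≤ MulAction.stabilizer G y →
      MulAction.stabilizer G y = MulAction.stabilizer G x := by
  filter_upwards [sl.orbit_near univ univ_mem] with y hnear hle
  obtain ⟨g, s, hs, hst, -, hy⟩ := hnear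
  have h1 : MulAction.stabilizer G y ≤ MulAction.stabilizer G (g • x) := by
    rw [hy, stabilizer_smul_le_iff]
    exact sl.stabilizer_le s hs hst
  exact le_antisymm (h1.trans (stabilizer_smul_le_of_le hsm (hle.trans h1))) hle

/-- At a point of a principal orbit the isotropy representation is trivial on the slice. -/
theorem LinearSlice.map_eq_of_mem_interior
    (hsm : ContMDiff (𝓘(ℝ, EG).prod 𝓘(ℝ, E)) 𝓘(ℝ, E) ∞ fun p : G × M => p.1 • p.2)
    {x : M} (sl : LinearSlice G E x)
    (hx : x ∈ interior (subconjugateSet M (MulAction.stabilizer G x)))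
    (k : MulAction.stabilizer G x) {s : E} (hs : s ∈ sl.S) : sl.ρ k s = s := by
  have hline : Tendsto (fun c : ℝ => c • s) (𝓝[>] 0) (𝓝 0) := by
    have : Continuous fun c : ℝ => c • s := by fun_prop
    simpa using (this.tendsto 0).mono_left nhdsWithin_le_nhds
  have h1 := sl.tendsto_symm sl.zero_mem_target hline
  rw [sl.symm_zero] at h1
  -- For small `c > 0` the isotropy group of the point `c • s` is contained in `G_x` and contains it
  -- up to conjugation, hence equals it. So `ρ k` fixes `c • s`, and therefore `s`.
  obtain ⟨c, ⟨hc1, ⟨g, hg⟩⟩, hc0⟩ := ((hline.eventually (sl.e.open_target.mem_nhds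
    sl.zero_mem_target)).and (h1.eventually (mem_interior_iff_mem_nhds.1 hx))
    |>.and self_mem_nhdsWithin).exists
  have h2 := sl.stabilizer_le _ (sl.S.smul_mem c hs) hc1
  have h3 := hg.trans (stabilizer_smul_le_of_le hsm (h2.trans hg))
  have h4 := (sl.mem_stabilizer_symm_iff k hc1).1 (h3 k.2)
  rw [map_smul] at h4
  exact smul_right_injective E (ne_of_gt hc0) h4

theorem LinearSlice.stabilizer_symm_eq_of_mem_interior
    (hsm : ContMDiff (𝓘(ℝ, EG).prod 𝓘(ℝ, E)) 𝓘(ℝ, E) ∞ fun p : G × M => p.1 • p.2)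
    {x : M} (sl : LinearSlice G E x)
    (hx : x ∈ interior (subconjugateSet M (MulAction.stabilizer G x)))
    {s : E} (hs : s ∈ sl.S) (hst : s ∈ sl.e.target) :
    MulAction.stabilizer G (sl.e.symm s) = MulAction.stabilizer G x :=
  le_antisymm (sl.stabilizer_le s hs hst) fun g hg =>
    (sl.mem_stabilizer_symm_iff ⟨g, hg⟩ hst).2 (sl.map_eq_of_mem_interior hsm hx _ hs)

/-- If `σ s` is on a principal orbit, then up to moving `t` along its orbit, all points on the open
segment from `s` to `t` in the slice have the isotropy group of `s`. -/
theorem LinearSlice.exists_segment_stabilizer_eq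
    (hsm : ContMDiff (𝓘(ℝ, EG).prod 𝓘(ℝ, E)) 𝓘(ℝ, E) ∞ fun p : G × M => p.1 • p.2)
    {z : M} (sl : LinearSlice G E z) {s t : E} (hs : s ∈ sl.S) (hst : s ∈ sl.e.target)
    (ht : t ∈ sl.S) (htt : t ∈ sl.e.target)
    (hP : sl.e.symm s ∈ interior (subconjugateSet M (MulAction.stabilizer G (sl.e.symm s)))) :
    ∃ k, (∀ c ∈ Ioo (0 : ℝ) 1, (1 - c) • s + c • sl.ρ k t ∈ sl.e.target ∧
        MulAction.stabilizer G (sl.e.symm ((1 - c) • s + c • sl.ρ k t)) =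
          MulAction.stabilizer G (sl.e.symm s)) ∧
      MulAction.stabilizer G (sl.e.symm s) ≤ MulAction.stabilizer G (sl.e.symm (sl.ρ k t)) := by
  have _ : IsTopologicalGroup G := topologicalGroup_of_lieGroup 𝓘(ℝ, EG) ∞
  have _ : CompactSpace (MulAction.stabilizer G z) :=
    isCompact_iff_compactSpace.1 (isCompact_stabilizer z)
  obtain ⟨B, hBs, hBp, hBi⟩ := exists_invariant_inner sl.continuous_ρ
  obtain ⟨k, hk⟩ := exists_forall_segment_fixed sl.continuous_ρ hBs hBp hBi s t
  set t' := sl.ρ k t with ht'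
  have ht'S : t' ∈ sl.S := sl.S_inv k t ht
  have ht't : t' ∈ sl.e.target := sl.map_mem_target k htt
  set p : ℝ → E := fun c => (1 - c) • s + c • t' with hp
  have hpt : ∀ c ∈ Ioo (0 : ℝ) 1, p c ∈ sl.e.target := fun c hc =>
    sl.convex_target hst ht't (sub_nonneg.2 hc.2.le) hc.1.le (by ring)
  have hpS : ∀ c, p c ∈ sl.S := fun c => sl.S.add_mem (sl.S.smul_mem _ hs) (sl.S.smul_mem _ ht'S)
  have hple : ∀ c ∈ Ioo (0 : ℝ) 1, MulAction.stabilizer G (sl.e.symm (p c)) ≤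
      MulAction.stabilizer G (sl.e.symm s) := fun c hc =>
    (sl.stabilizer_symm_le_iff (hpS c) (hpt c hc) hst).2 fun h hh => (hk c hc h hh).1
  have hpc : Tendsto p (𝓝[>] 0) (𝓝 s) := by
    have h1 : Continuous p := by fun_prop
    have h2 := (h1.tendsto 0).mono_left (nhdsWithin_le_nhds (s := Ioi 0))
    simpa [hp] using h2
  -- Close to `s`, principality turns the inclusion `hple` into equality for one `c`. Hence the
  -- isotropy group of `s` also fixes `t'`, which gives equality for every `c`.
  obtain ⟨c, ⟨g, hg⟩, hc⟩ := (((sl.tendsto_symm hst hpc).eventually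
    (mem_interior_iff_mem_nhds.1 hP)).and (Ioo_mem_nhdsGT (zero_lt_one' ℝ))).exists
  have h1 : MulAction.stabilizer G (sl.e.symm s) ≤ MulAction.stabilizer G (sl.e.symm (p c)) :=
    hg.trans (stabilizer_smul_le_of_le hsm ((hple c hc).trans hg))
  have h2 : ∀ h, sl.ρ h s = s → sl.ρ h t' = t' := fun h hh =>
    (hk c hc h ((sl.stabilizer_symm_le_iff hs hst (hpt c hc)).1 h1 h hh)).2
  refine ⟨k, fun c hc => ⟨hpt c hc, le_antisymm (hple c hc) ?_⟩,
    (sl.stabilizer_symm_le_iff hs hst ht't).2 h2⟩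
  refine (sl.stabilizer_symm_le_iff hs hst (hpt c hc)).2 fun h hh => ?_
  simp only [hp, map_add, map_smul, hh, h2 h hh]

/-- Points on principal orbits with isotropy groups conjugate to `H` are dense. -/
theorem dense_orbitTypeSet_inter_interior [ConnectedSpace M]
    (hsm : ContMDiff (𝓘(ℝ, EG).prod 𝓘(ℝ, E)) 𝓘(ℝ, E) ∞ fun p : G × M => p.1 • p.2)
    {H : Subgroup G} (hne : (orbitTypeSet M H ∩ interior (subconjugateSet M H)).Nonempty) :
    Dense (orbitTypeSet M H ∩ interior (subconjugateSet M H)) := by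
  have _ : IsTopologicalGroup G := topologicalGroup_of_lieGroup 𝓘(ℝ, EG) ∞
  set P := orbitTypeSet M H ∩ interior (subconjugateSet M H) with hPdef
  have hPinv : ∀ (g : G), ∀ y ∈ P, g • y ∈ P := fun g y hy =>
    ⟨smul_mem_orbitTypeSet g hy.1,
      smul_mem_interior (fun g y hy => smul_mem_subconjugateSet g hy) g hy.2⟩
  have hCinv : ∀ (g : G), ∀ y ∈ closure P, g • y ∈ closure P := fun g y hy =>
    map_mem_closure (continuous_const_smul g) hy (hPinv g)
  -- By connectedness it is enough that the closure of `P` is open. Near a limit point `z`, a slice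
  -- contains some `s` in `P`, and the segments from `s` carry its isotropy type to the other slice
  -- points.
  suffices h : IsClopen (closure P) by
    exact dense_iff_closure_eq.2 (h.eq_univ hne.closure)
  refine ⟨isClosed_closure, isOpen_iff_mem_nhds.2 fun z hz => ?_⟩
  obtain ⟨sl⟩ := exists_linearSlice (G := G) hsm z
  obtain ⟨p, ⟨g, s, hs, hst, -, hp⟩, hpP⟩ :=
    mem_closure_iff_nhds.1 hz _ (sl.orbit_near univ univ_mem)
  have hsP : sl.e.symm s ∈ P := by
    have := hPinv g⁻¹ p hpP
    rwa [hp, inv_smul_smul] at this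
  obtain ⟨⟨a, ha⟩, hsQ⟩ := hsP
  have hQ : subconjugateSet M H = subconjugateSet M (MulAction.stabilizer G (sl.e.symm s)) := by
    ext y
    constructor
    · rintro ⟨b, hb⟩
      refine ⟨a⁻¹ * b, ?_⟩
      rw [← ha, ← stabilizer_smul_le_iff (a := a⁻¹), inv_smul_smul] at hb
      rwa [mul_smul]
    · rintro ⟨b, hb⟩
      refine ⟨a * b, ?_⟩
      rw [← stabilizer_smul_le_iff (a := a), ha] at hb
      rwa [mul_smul]
  have hsQ' := hQ ▸ hsQ
  have hnear : ∀ y, (∃ g : G, ∃ t ∈ sl.S, t ∈ sl.e.target ∧ sl.e.symm t ∈ univ ∧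
      y = g • sl.e.symm t) → y ∈ subconjugateSet M H := by
    rintro y ⟨g, t, ht, htt, -, rfl⟩
    refine smul_mem_subconjugateSet g ?_
    obtain ⟨k, -, hk⟩ := sl.exists_segment_stabilizer_eq hsm hs hst ht htt hsQ'
    rw [hQ]
    exact ⟨k, by rwa [← sl.symm_map k htt]⟩
  have hzQ : ∀ᶠ y in 𝓝 z, y ∈ interior (subconjugateSet M H) :=
    isOpen_interior.mem_nhds (mem_interior_iff_mem_nhds.2
      ((sl.orbit_near univ univ_mem).mono hnear))
  filter_upwards [hzQ, sl.orbit_near univ univ_mem] with y hyQ ⟨g, t, ht, htt, _, hy⟩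
  obtain ⟨k, hk, -⟩ := sl.exists_segment_stabilizer_eq hsm hs hst ht htt hsQ'
  have hy' : y = (g * (k : G)⁻¹) • sl.e.symm (sl.ρ k t) := by
    rw [sl.symm_map k htt, mul_smul, inv_smul_smul, hy]
  have ht't := sl.map_mem_target k htt
  have ht'Q : sl.e.symm (sl.ρ k t) ∈ interior (subconjugateSet M H) := by
    have := smul_mem_interior (fun g y hy => smul_mem_subconjugateSet g hy) (g * (k : G)⁻¹)⁻¹ hyQ
    rwa [hy', inv_smul_smul] at this
  rw [hy']
  refine hCinv _ _ ?_
  -- The open segment has the isotropy group of `s`, so the point `sl.ρ k t` is approached from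
  -- within `P` as `c` tends to `1`.
  have hpc : Tendsto (fun c : ℝ => (1 - c) • s + c • sl.ρ k t) (𝓝[<] 1) (𝓝 (sl.ρ k t)) := by
    have h1 : Continuous fun c : ℝ => (1 - c) • s + c • sl.ρ k t := by fun_prop
    have h2 := (h1.tendsto 1).mono_left (nhdsWithin_le_nhds (s := Iio 1))
    simpa using h2
  have hpc' := sl.tendsto_symm ht't hpc
  refine mem_closure_of_tendsto hpc' ?_
  filter_upwards [hpc'.eventually (isOpen_interior.mem_nhds ht'Q),
    Ioo_mem_nhdsLT (zero_lt_one' ℝ)] with c hc1 hc2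
  refine ⟨⟨a, ?_⟩, hc1⟩
  have h5 := (hk c hc2).2
  rw [← ha]
  exact le_antisymm (stabilizer_smul_le_iff.2 h5.le) (stabilizer_smul_le_iff.2 h5.ge)

/-- Principal orbit theorem: a principal isotropy group is up to conjugation contained in all isotropy
groups. -/
theorem exists_le_stabilizer_smul [ConnectedSpace M]
    (hsm : ContMDiff (𝓘(ℝ, EG).prod 𝓘(ℝ, E)) 𝓘(ℝ, E) ∞ fun p : G × M => p.1 • p.2)
    {H : Subgroup G} (hH : IsPrincipalIsotropy M H) :
    Dense (orbitTypeSet M H) ∧ ∀ y : M, y ∈ subconjugateSet M H := by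
  obtain ⟨x, rfl, hx⟩ := hH
  set H := MulAction.stabilizer G x
  have hd := dense_orbitTypeSet_inter_interior (G := G) hsm (H := H)
    ⟨x, ⟨1, by rw [one_smul]⟩, mem_interior_iff_mem_nhds.2 hx⟩
  have hd' : Dense (orbitTypeSet M H) := hd.mono inter_subset_left
  refine ⟨hd', fun y => ?_⟩
  -- By density an orbit of type `H` meets the slice at `y`, and isotropy groups on the slice are
  -- contained in `G_y`.
  obtain ⟨sl⟩ := exists_linearSlice (G := G) hsm y
  obtain ⟨p, ⟨g, s, hs, hst, -, hp⟩, a, ha⟩ :=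
    mem_closure_iff_nhds.1 (hd' y) _ (sl.orbit_near univ univ_mem)
  refine ⟨a * g, ?_⟩
  rw [← ha, hp, mul_smul, stabilizer_smul_le_iff, stabilizer_smul_le_iff]
  exact sl.stabilizer_le s hs hst

end Principal

/-! ### Symplectic linear algebra with a compact group -/

section LinearAlgebra

variable {K E : Type*} [Group K] [NormedAddCommGroup E] [NormedSpace ℝ E]

/-- The subspace of vectors fixed by a linear representation. -/
def fixedSubmodule (ρ : K →* (E →L[ℝ] E)) : Submodule ℝ E where
  carrier := {v | ∀ k, ρ k v = v}
  add_mem' ha hb k := by rw [map_add, ha k, hb k]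
  zero_mem' k := map_zero _
  smul_mem' c v hv k := by rw [map_smul, hv k]

/-- The bilinear form underlying an alternating `2`-form. -/
def bilinOfAlternating (f : E [⋀^Fin 2]→L[ℝ] ℝ) : LinearMap.BilinForm ℝ E :=
  have hu (v w : E) : Function.update ![v, 0] 1 w = ![v, w] := by
    ext i
    fin_cases i <;> rfl
  LinearMap.mk₂ ℝ (fun v w => f ![v, w])
    (fun v v' w => f.vecCons_add ![w] v v')
    (fun c v w => f.vecCons_smul ![w] c v)
    (fun v w w' => by
      have := f.map_update_add ![v, 0] 1 w w'
      rwa [hu, hu, hu] at this)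
    (fun c v w => by
      have := f.map_update_smul ![v, 0] 1 c w
      rwa [hu, hu] at this)

variable [TopologicalSpace K] [IsTopologicalGroup K] [CompactSpace K] [FiniteDimensional ℝ E]
  {ρ : K →* (E →L[ℝ] E)} {β : LinearMap.BilinForm ℝ E}

/-- For fixed `v`, the functional `β v` is invariant, so averaging its argument changes nothing. -/
theorem exists_average_fixedSubmodule (hρ : Continuous ρ)
    (hβ : ∀ k v w, β (ρ k v) (ρ k w) = β v w) : ∃ A : E →L[ℝ] E, (∀ v, A v ∈ fixedSubmodule ρ) ∧
      (∀ F : Submodule ℝ E, ∀ v, (∀ h, ρ h v ∈ F) → A v ∈ F) ∧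
      (∀ l : E →L[ℝ] ℝ, (∀ h v, l (ρ h v) = l v) → ∀ v, l (A v) = l v) ∧
      ∀ v ∈ fixedSubmodule ρ, ∀ w, β v (A w) = β v w := by
  obtain ⟨A, hA1, hA2, hA3⟩ := exists_average hρ
  refine ⟨A, fun v h => hA1 h v, hA2, hA3, fun v hv w => ?_⟩
  refine hA3 (β v).toContinuousLinearMap (fun h w => ?_) w
  have := hβ h v w
  rwa [hv h] at this

/-- The fixed subspace of a compact group of symplectic maps is symplectic. -/
theorem eq_zero_of_mem_fixedSubmodule (hρ : Continuous ρ)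
    (hβ : ∀ k v w, β (ρ k v) (ρ k w) = β v w) (hnd : ∀ v, (∀ w, β v w = 0) → v = 0) {v : E}
    (hv : v ∈ fixedSubmodule ρ) (h : ∀ w ∈ fixedSubmodule ρ, β v w = 0) : v = 0 := by
  obtain ⟨A, hA1, -, -, hA4⟩ := exists_average_fixedSubmodule hρ hβ
  exact hnd v fun w => by rw [← hA4 v hv, h _ (hA1 w)]

/-- The fixed part of an invariant coisotropic subspace is coisotropic in the fixed subspace. -/
theorem mem_of_coisotropic (hρ : Continuous ρ) (hβ : ∀ k v w, β (ρ k v) (ρ k w) = β v w)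
    {T : Submodule ℝ E} (hT : ∀ k, ∀ t ∈ T, ρ k t ∈ T)
    (h : ∀ v, (∀ t ∈ T, β v t = 0) → v ∈ T) {v : E} (hv : v ∈ fixedSubmodule ρ)
    (hvT : ∀ t ∈ T ⊓ fixedSubmodule ρ, β v t = 0) : v ∈ T ⊓ fixedSubmodule ρ := by
  obtain ⟨A, hA1, hA2, -, hA4⟩ := exists_average_fixedSubmodule hρ hβ
  refine ⟨h v fun t ht => ?_, hv⟩
  rw [← hA4 v hv]
  exact hvT _ ⟨hA2 T t fun k => hT k t ht, hA1 t⟩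

/-- An invariant subspace with a complement of fixed vectors is coisotropic if its fixed part is
coisotropic in the fixed subspace. -/
theorem mem_of_coisotropic_fixed (hρ : Continuous ρ) (hβ : ∀ k v w, β (ρ k v) (ρ k w) = β v w)
    {T S : Submodule ℝ E} (hTS : IsCompl T S) (hT : ∀ k, ∀ t ∈ T, ρ k t ∈ T)
    (hS : S ≤ fixedSubmodule ρ)
    (h : ∀ v ∈ fixedSubmodule ρ, (∀ t ∈ T ⊓ fixedSubmodule ρ, β v t = 0) →
      v ∈ T ⊓ fixedSubmodule ρ) {v : E} (hv : ∀ t ∈ T, β v t = 0) : v ∈ T := by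
  obtain ⟨A, hA1, hA2, hA3, -⟩ := exists_average_fixedSubmodule hρ hβ
  -- The orthogonal of an invariant subspace is invariant, so averaging stays inside it.
  have hAv : ∀ t ∈ T, β (A v) t = 0 := by
    intro t ht
    refine hA2 (LinearMap.ker (β.flip t)) v fun k => ?_
    have h1 := hβ k v (ρ k⁻¹ t)
    rw [hv _ (hT _ t ht)] at h1
    have h2 : ρ k (ρ k⁻¹ t) = t := by
      rw [← mul_apply_eq_comp, ← map_mul, mul_inv_cancel, map_one]
      rfl
    rw [h2] at h1
    exact h1
  have h1 : A v ∈ T := (h _ (hA1 v) fun t ht => hAv t ht.1).1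
  -- The group acts trivially modulo `T`, so the component along `S` is invariant, and `v` and `A v`
  -- agree modulo `T`.
  have h2 : S.projection T hTS.symm (A v) = S.projection T hTS.symm v := by
    refine (Module.forall_dual_apply_eq_zero_iff ℝ _).1 (fun l => ?_) |> sub_eq_zero.1
    rw [map_sub, sub_eq_zero]
    refine hA3 (l ∘ₗ S.projection T hTS.symm).toContinuousLinearMap (fun k w => ?_) v
    simp only [LinearMap.coe_toContinuousLinearMap', LinearMap.comp_apply]
    congr 1
    have h3 : ρ k w = ρ k (T.projection S hTS w) + S.projection T hTS.symm w := by
      rw [← hS (S.projection_apply_mem hTS.symm w) k, ← map_add]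
      congr 1
      have := T.projection_add_projection_eq_self hTS w
      exact this.symm
    rw [h3, map_add, S.projection_apply_right hTS.symm
        ⟨_, hT k _ (T.projection_apply_mem hTS w)⟩,
      S.projection_apply_left hTS.symm ⟨_, S.projection_apply_mem hTS.symm w⟩, zero_add]
  rw [S.projection_apply_right hTS.symm ⟨_, h1⟩] at h2
  have := S.sub_projection_mem hTS.symm v
  rwa [← h2, sub_zero] at this

end LinearAlgebra

/-! ### The stratum `M^H` and the orbits in a slice chart -/

section Stratum

variable {EG : Type*} [NormedAddCommGroup EG] [NormedSpace ℝ EG] [FiniteDimensional ℝ EG]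
  {G : Type*} [Group G] [TopologicalSpace G] [ChartedSpace EG G] [LieGroup 𝓘(ℝ, EG) ∞ G]
  {E : Type*} [NormedAddCommGroup E] [NormedSpace ℝ E] [FiniteDimensional ℝ E]
  {M : Type*} [TopologicalSpace M] [ChartedSpace E M] [IsManifold 𝓘(ℝ, E) ∞ M] [T2Space M]
  [MulAction G M] [ContMDiffSMul 𝓘(ℝ, EG) 𝓘(ℝ, E) ∞ G M] [ProperSMul G M]

theorem image_source_inter_eq_iff {X Y : Type*} [TopologicalSpace X] [TopologicalSpace Y]
    (e : OpenPartialHomeomorph X Y) {A : Set X} {F : Set Y} :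
    e '' (e.source ∩ A) = e.target ∩ F ↔ ∀ y ∈ e.source, (y ∈ A ↔ e y ∈ F) := by
  constructor
  · intro h y hy
    constructor
    · intro hyA
      exact (h ▸ mem_image_of_mem e ⟨hy, hyA⟩ : e y ∈ e.target ∩ F).2
    · intro hyF
      obtain ⟨w, ⟨hw, hwA⟩, hwy⟩ := (h.symm ▸ ⟨e.map_source hy, hyF⟩ : e y ∈ e '' (e.source ∩ A))
      rwa [← e.injOn hw hy hwy]
  · intro h
    apply Subset.antisymm
    · rintro _ ⟨y, ⟨hy, hyA⟩, rfl⟩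
      exact ⟨e.map_source hy, (h y hy).1 hyA⟩
    · rintro t ⟨ht, htF⟩
      refine ⟨e.symm t, ⟨e.map_target ht, (h _ (e.map_target ht)).2 ?_⟩, e.right_inv ht⟩
      rwa [e.right_inv ht]

/-- A restriction of the chart of a slice flattens the isotropy stratum and the orbit. -/
theorem LinearSlice.exists_flat_chart
    (hsm : ContMDiff (𝓘(ℝ, EG).prod 𝓘(ℝ, E)) 𝓘(ℝ, E) ∞ fun p : G × M => p.1 • p.2)
    {x : M} (sl : LinearSlice G E x) :
    ∃ e ∈ IsManifold.maximalAtlas 𝓘(ℝ, E) ∞ M, x ∈ e.source ∧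
      (∀ (k : MulAction.stabilizer G x), ∀ᶠ y in 𝓝 x, e ((k : G) • y) = sl.ρ k (e y)) ∧
      e '' (e.source ∩ isotropyStratum M (MulAction.stabilizer G x)) =
        e.target ∩ (fixedSubmodule sl.ρ : Set E) ∧
      e '' (e.source ∩ MulAction.orbit G x) = e.target ∩ (sl.T : Set E) ∧
      e '' (e.source ∩ (isotropyStratum M (MulAction.stabilizer G x) ∩ MulAction.orbit G x)) =
        e.target ∩ ((sl.T ⊓ fixedSubmodule sl.ρ : Submodule ℝ E) : Set E) := by
  -- On `O`, containing `G_x` already means having isotropy `G_x`, so the stratum is the fixed-point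
  -- set of `G_x`, which is linear in the chart.
  obtain ⟨O, hO, hOo, hxO⟩ := eventually_nhds_iff.1 (sl.eventually_stabilizer_eq hsm)
  have h1 : ∀ y ∈ (sl.e.restrOpen O hOo).source,
      (y ∈ isotropyStratum M (MulAction.stabilizer G x) ↔
        sl.e.restrOpen O hOo y ∈ (fixedSubmodule sl.ρ : Set E)) := by
    intro y hy
    change _ ↔ sl.e y ∈ fixedSubmodule sl.ρ
    have hmem : ∀ k : MulAction.stabilizer G x,
        (k : G) ∈ MulAction.stabilizer G y ↔ sl.ρ k (sl.e y) = sl.e y := fun k => by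
      have := sl.mem_stabilizer_symm_iff k (sl.e.map_source hy.1)
      rwa [sl.e.left_inv hy.1] at this
    constructor
    · intro h k
      exact (hmem k).1 ((show MulAction.stabilizer G y = _ from h).ge k.2)
    · intro h
      exact hO y hy.2 fun g hg => (hmem ⟨g, hg⟩).2 (h ⟨g, hg⟩)
  have h2 : ∀ y ∈ (sl.e.restrOpen O hOo).source,
      (y ∈ MulAction.orbit G x ↔ sl.e.restrOpen O hOo y ∈ (sl.T : Set E)) := fun y hy =>
    (image_source_inter_eq_iff sl.e).1 sl.orbit_flat y hy.1
  refine ⟨sl.e.restrOpen O hOo, restrOpen_mem_maximalAtlas sl.e_mem hOo, ⟨sl.z_mem, hxO⟩,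
    fun k => ?_, (image_source_inter_eq_iff _).2 h1, (image_source_inter_eq_iff _).2 h2,
    (image_source_inter_eq_iff _).2 fun y hy => ?_⟩
  · filter_upwards [sl.e.open_source.mem_nhds sl.z_mem] with y hy
    exact sl.e_smul k y hy
  · rw [mem_inter_iff, h1 y hy, h2 y hy, and_comm]
    rfl

/-- The tangent spaces to the isotropy stratum and to the orbit at the centre of a slice. -/
theorem LinearSlice.exists_tangentEquiv
    (hsm : ContMDiff (𝓘(ℝ, EG).prod 𝓘(ℝ, E)) 𝓘(ℝ, E) ∞ fun p : G × M => p.1 • p.2)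
    {x : M} (sl : LinearSlice G E x) : ∃ D : E ≃L[ℝ] E,
      (∀ v : E, v ∈ tangentSet (E := E) (isotropyStratum M (MulAction.stabilizer G x)) x ↔
        D v ∈ fixedSubmodule sl.ρ) ∧
      (∀ v : E, v ∈ tangentSet (E := E) (MulAction.orbit G x) x ↔ D v ∈ sl.T) ∧
      (∀ v : E, v ∈ tangentSet (E := E)
          (isotropyStratum M (MulAction.stabilizer G x) ∩ MulAction.orbit G x) x ↔
        D v ∈ sl.T ⊓ fixedSubmodule sl.ρ) ∧
      ∀ (k : MulAction.stabilizer G x) (v : E), D ((mfderiv 𝓘(ℝ, E) 𝓘(ℝ, E)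
        (fun y : M => (k : G) • y) x : E →L[ℝ] E) v) = sl.ρ k (D v) := by
  obtain ⟨e, he, hx, heq, h1, h2, h3⟩ := sl.exists_flat_chart hsm
  have hMD := mdifferentiable_of_mem_maximalAtlas he
  have hxN : x ∈ isotropyStratum M (MulAction.stabilizer G x) := rfl
  have hxO : x ∈ MulAction.orbit G x := MulAction.mem_orbit_self x
  have hxNO : x ∈ isotropyStratum M (MulAction.stabilizer G x) ∩ MulAction.orbit G x := ⟨hxN, hxO⟩
  refine ⟨hMD.mfderiv hx, mem_tangentSet_iff he hx hxN h1, mem_tangentSet_iff he hx hxO h2,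
    mem_tangentSet_iff he hx hxNO h3, fun k v => ?_⟩
  have hkx : (k : G) • x = x := k.2
  have hk : MDifferentiableAt 𝓘(ℝ, E) 𝓘(ℝ, E) (fun y : M => (k : G) • y) x := by
    have hc : ContMDiff 𝓘(ℝ, E) (𝓘(ℝ, EG).prod 𝓘(ℝ, E)) ∞ fun y : M => ((k : G), y) :=
      contMDiff_const.prodMk contMDiff_id
    exact ((hsm.comp hc).mdifferentiable (by simp)) x
  have hd : ∀ y ∈ e.source, MDifferentiableAt 𝓘(ℝ, E) 𝓘(ℝ, E) e y := fun y hy =>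
    hMD.mdifferentiableAt hy
  have h4 := mfderiv_comp (I' := 𝓘(ℝ, E)) x (g := e) (f := fun y : M => (k : G) • y)
    (by simp only [hkx]; exact hd x hx) hk
  have h5 : mfderiv 𝓘(ℝ, E) 𝓘(ℝ, E) (e ∘ fun y : M => (k : G) • y) x =
      mfderiv 𝓘(ℝ, E) 𝓘(ℝ, E) (sl.ρ k ∘ e) x := Filter.EventuallyEq.mfderiv_eq (heq k)
  have h6 := mfderiv_comp (I' := 𝓘(ℝ, E)) x (g := sl.ρ k) (f := e)
    (sl.ρ k).differentiableAt.mdifferentiableAt (hd x hx)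
  rw [ContinuousLinearMap.mfderiv_eq] at h6
  have h7 : ∀ y, y = x → (mfderiv 𝓘(ℝ, E) 𝓘(ℝ, E) e y : E →L[ℝ] E) =
      mfderiv 𝓘(ℝ, E) 𝓘(ℝ, E) e x := by
    rintro _ rfl
    rfl
  have h8 : ((mfderiv 𝓘(ℝ, E) 𝓘(ℝ, E) e ((k : G) • x) : E →L[ℝ] E).comp
      (mfderiv 𝓘(ℝ, E) 𝓘(ℝ, E) (fun y : M => (k : G) • y) x : E →L[ℝ] E)) =
      (sl.ρ k).comp (mfderiv 𝓘(ℝ, E) 𝓘(ℝ, E) e x : E →L[ℝ] E) :=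
    h4.symm.trans (h5.trans h6)
  rw [h7 _ hkx] at h8
  exact congrArg (fun L : E →L[ℝ] E => L v) h8

theorem isSubmanifold_isotropyStratum
    (hsm : ContMDiff (𝓘(ℝ, EG).prod 𝓘(ℝ, E)) 𝓘(ℝ, E) ∞ fun p : G × M => p.1 • p.2)
    (H : Subgroup G) : IsSubmanifold (E := E) (isotropyStratum M H) := by
  rintro x rfl
  obtain ⟨sl⟩ := exists_linearSlice (G := G) hsm x
  obtain ⟨e, he, hx, -, h1, -, -⟩ := sl.exists_flat_chart hsm
  exact ⟨e, he, hx, _, h1⟩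

theorem isSubmanifold_orbit
    (hsm : ContMDiff (𝓘(ℝ, EG).prod 𝓘(ℝ, E)) 𝓘(ℝ, E) ∞ fun p : G × M => p.1 • p.2)
    (z : M) : IsSubmanifold (E := E) (MulAction.orbit G z) := by
  intro x hx
  rw [← MulAction.orbit_eq_iff.2 hx]
  obtain ⟨sl⟩ := exists_linearSlice (G := G) hsm x
  exact ⟨sl.e, sl.e_mem, sl.z_mem, _, sl.orbit_flat⟩

theorem isSubmanifold_isotropyStratum_inter_orbit
    (hsm : ContMDiff (𝓘(ℝ, EG).prod 𝓘(ℝ, E)) 𝓘(ℝ, E) ∞ fun p : G × M => p.1 • p.2)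
    (H : Subgroup G) (z : M) :
    IsSubmanifold (E := E) (isotropyStratum M H ∩ MulAction.orbit G z) := by
  rintro x ⟨rfl, hx⟩
  rw [← MulAction.orbit_eq_iff.2 hx]
  obtain ⟨sl⟩ := exists_linearSlice (G := G) hsm x
  obtain ⟨e, he, hx, -, -, -, h3⟩ := sl.exists_flat_chart hsm
  exact ⟨e, he, hx, _, h3⟩

/-- If `x` and `g • x` both have isotropy group `H`, then `g` normalizes `H`. -/
theorem image_val_orbit_normalizerQuotient {H : Subgroup G} (x : isotropyStratum M H) :
    Subtype.val '' MulAction.orbit (NormalizerQuotient H) x =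
      isotropyStratum M H ∩ MulAction.orbit G (x : M) := by
  apply Subset.antisymm
  · rintro _ ⟨y, ⟨l, rfl⟩, rfl⟩
    refine ⟨Subtype.coe_prop _, ?_⟩
    obtain ⟨n, rfl⟩ := QuotientGroup.mk_surjective l
    exact ⟨n, (mk_smul_coe H n x).symm⟩
  · rintro _ ⟨hy, g, rfl⟩
    have hx : MulAction.stabilizer G (x : M) = H := x.2
    have hy' : MulAction.stabilizer G (g • (x : M)) = H := hy
    have hg : g ∈ Subgroup.normalizer (H : Set G) := by
      refine Subgroup.mem_normalizer_iff''.2 fun h => ?_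
      conv_lhs => rw [← hy']
      rw [mem_stabilizer_smul_iff, hx]
    exact ⟨_, ⟨QuotientGroup.mk ⟨g, hg⟩, rfl⟩, mk_smul_coe H ⟨g, hg⟩ x⟩

end Stratum

/-! ### Transfer of coisotropy between `M` and `M^H` -/

section Symplectic

variable {EG : Type*} [NormedAddCommGroup EG] [NormedSpace ℝ EG] [FiniteDimensional ℝ EG]
  {G : Type*} [Group G] [TopologicalSpace G] [ChartedSpace EG G] [LieGroup 𝓘(ℝ, EG) ∞ G]
  {E : Type*} [NormedAddCommGroup E] [NormedSpace ℝ E] [FiniteDimensional ℝ E]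
  {M : Type*} [TopologicalSpace M] [ChartedSpace E M] [IsManifold 𝓘(ℝ, E) ∞ M] [T2Space M]
  [MulAction G M] [ContMDiffSMul 𝓘(ℝ, EG) 𝓘(ℝ, E) ∞ G M] [ProperSMul G M]
  {Ω : ∀ x : M, TangentSpace 𝓘(ℝ, E) x [⋀^Fin 2]→L[ℝ] ℝ}

/-- The tangent space at `x` as a symplectic representation of the isotropy group. -/
theorem LinearSlice.exists_bilinForm
    (hsm : ContMDiff (𝓘(ℝ, EG).prod 𝓘(ℝ, E)) 𝓘(ℝ, E) ∞ fun p : G × M => p.1 • p.2)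
    (hG : IsSymplecticAction G Ω) {x : M} (sl : LinearSlice G E x) :
    ∃ D : E ≃L[ℝ] E, ∃ β : LinearMap.BilinForm ℝ E,
      (∀ v : E, v ∈ tangentSet (E := E) (isotropyStratum M (MulAction.stabilizer G x)) x ↔
        D v ∈ fixedSubmodule sl.ρ) ∧
      (∀ v : E, v ∈ tangentSet (E := E) (MulAction.orbit G x) x ↔ D v ∈ sl.T) ∧
      (∀ v : E, v ∈ tangentSet (E := E)
          (isotropyStratum M (MulAction.stabilizer G x) ∩ MulAction.orbit G x) x ↔
        D v ∈ sl.T ⊓ fixedSubmodule sl.ρ) ∧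
      (∀ k v w, β (sl.ρ k v) (sl.ρ k w) = β v w) ∧
      ∀ v w : E, β (D v) (D w) = Ω x ![v, w] := by
  obtain ⟨D, h1, h2, h3, h4⟩ := sl.exists_tangentEquiv hsm
  obtain ⟨β, hβ⟩ : ∃ β : LinearMap.BilinForm ℝ E, ∀ v w : E, β (D v) (D w) = Ω x ![v, w] := by
    let f : E [⋀^Fin 2]→L[ℝ] ℝ := Ω x
    refine ⟨(bilinOfAlternating f).compl₁₂ (D.symm : E →ₗ[ℝ] E) (D.symm : E →ₗ[ℝ] E), fun v w => ?_⟩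
    change f ![D.symm (D v), D.symm (D w)] = f ![v, w]
    rw [D.symm_apply_apply, D.symm_apply_apply]
  refine ⟨D, β, h1, h2, h3, fun k v w => ?_, hβ⟩
  obtain ⟨v, rfl⟩ := D.surjective v
  obtain ⟨w, rfl⟩ := D.surjective w
  rw [← h4, ← h4]
  refine (hβ _ _).trans (Eq.trans ?_ (hβ v w).symm)
  have hkx : (k : G) • x = x := k.2
  have h5 : ∀ y, y = x → (Ω y : E [⋀^Fin 2]→L[ℝ] ℝ) = Ω x := by
    rintro _ rfl
    rfl
  have h6 := congrArg (fun f : E [⋀^Fin 2]→L[ℝ] ℝ => f ![v, w]) (hG (k : G) x)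
  have h7 : (Ω ((k : G) • x) : E [⋀^Fin 2]→L[ℝ] ℝ)
      ((mfderiv 𝓘(ℝ, E) 𝓘(ℝ, E) (fun y : M => (k : G) • y) x : E →L[ℝ] E) ∘ ![v, w]) =
      Ω x ![v, w] := h6
  rw [h5 _ hkx] at h7
  refine Eq.trans ?_ h7
  congr 1
  ext i
  fin_cases i <;> rfl

theorem isSymplecticSubmanifold_isotropyStratum
    (hsm : ContMDiff (𝓘(ℝ, EG).prod 𝓘(ℝ, E)) 𝓘(ℝ, E) ∞ fun p : G × M => p.1 • p.2)
    (hΩ : IsSymplecticForm Ω) (hG : IsSymplecticAction G Ω) (H : Subgroup G) :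
    IsSymplecticSubmanifold Ω (isotropyStratum M H) := by
  refine ⟨isSubmanifold_isotropyStratum hsm H, ?_⟩
  rintro x rfl v hv h
  have _ : IsTopologicalGroup G := topologicalGroup_of_lieGroup 𝓘(ℝ, EG) ∞
  have _ : CompactSpace (MulAction.stabilizer G x) :=
    isCompact_iff_compactSpace.1 (isCompact_stabilizer x)
  obtain ⟨sl⟩ := exists_linearSlice (G := G) hsm x
  obtain ⟨D, β, h1, -, -, h4, h5⟩ := sl.exists_bilinForm hsm hG
  have h6 : D v = 0 := by
    refine eq_zero_of_mem_fixedSubmodule sl.continuous_ρ h4 (fun a ha => ?_) ((h1 v).1 hv)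
      fun w hw => ?_
    · obtain ⟨a, rfl⟩ := D.surjective a
      have : a = 0 := hΩ.nondegenerate x a fun w => (h5 a w).symm.trans (ha _)
      rw [this, map_zero]
    · obtain ⟨w, rfl⟩ := D.surjective w
      exact (h5 v w).trans (h w ((h1 w).2 hw))
  exact D.map_eq_zero_iff.1 h6

theorem isCoisotropicIn_of_isCoisotropic
    (hsm : ContMDiff (𝓘(ℝ, EG).prod 𝓘(ℝ, E)) 𝓘(ℝ, E) ∞ fun p : G × M => p.1 • p.2)
    (hG : IsSymplecticAction G Ω) {H : Subgroup G} {z : M}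
    (hz : IsCoisotropic Ω (MulAction.orbit G z)) :
    IsCoisotropicIn Ω (isotropyStratum M H) (isotropyStratum M H ∩ MulAction.orbit G z) := by
  refine ⟨inter_subset_left, isSubmanifold_isotropyStratum_inter_orbit hsm H z, ?_⟩
  rintro x ⟨rfl, hx⟩ v hv h
  have hco := hz.2 x hx
  rw [← MulAction.orbit_eq_iff.2 hx] at h hco ⊢
  have _ : IsTopologicalGroup G := topologicalGroup_of_lieGroup 𝓘(ℝ, EG) ∞
  have _ : CompactSpace (MulAction.stabilizer G x) :=
    isCompact_iff_compactSpace.1 (isCompact_stabilizer x)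
  obtain ⟨sl⟩ := exists_linearSlice (G := G) hsm x
  obtain ⟨D, β, h1, h2, h3, h4, h5⟩ := sl.exists_bilinForm hsm hG
  refine (h3 v).2 (mem_of_coisotropic sl.continuous_ρ h4 sl.T_inv (fun a ha => ?_) ((h1 v).1 hv)
    fun t ht => ?_)
  · obtain ⟨a, rfl⟩ := D.surjective a
    refine (h2 a).1 (hco a fun w hw => ?_)
    exact (h5 a w).symm.trans (ha _ ((h2 w).1 hw))
  · obtain ⟨t, rfl⟩ := D.surjective t
    exact (h5 v t).trans (h t ((h3 t).2 ht))

/-- The differential of `g` is a symplectic isomorphism preserving the tangent spaces of the orbit,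
so coisotropy at one point spreads along the orbit. -/
theorem mem_tangentSet_orbit_of_smul
    (hsm : ContMDiff (𝓘(ℝ, EG).prod 𝓘(ℝ, E)) 𝓘(ℝ, E) ∞ fun p : G × M => p.1 • p.2)
    (hG : IsSymplecticAction G Ω) {x : M}
    (hx : ∀ v : TangentSpace 𝓘(ℝ, E) x,
      (∀ w ∈ tangentSet (E := E) (MulAction.orbit G x) x, Ω x ![v, w] = 0) →
        v ∈ tangentSet (E := E) (MulAction.orbit G x) x) (g : G)
    (v : TangentSpace 𝓘(ℝ, E) (g • x))
    (hv : ∀ w ∈ tangentSet (E := E) (MulAction.orbit G x) (g • x), Ω (g • x) ![v, w] = 0) :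
    v ∈ tangentSet (E := E) (MulAction.orbit G x) (g • x) := by
  have hs : ∀ a : G, ContMDiff 𝓘(ℝ, E) 𝓘(ℝ, E) ∞ fun y : M => a • y := fun a => by
    have hc : ContMDiff 𝓘(ℝ, E) (𝓘(ℝ, EG).prod 𝓘(ℝ, E)) ∞ fun y : M => (a, y) :=
      contMDiff_const.prodMk contMDiff_id
    exact hsm.comp hc
  have hO : ∀ a : G, MapsTo (fun y : M => a • y) (MulAction.orbit G x) (MulAction.orbit G x) :=
    fun a y hy => MulAction.mem_orbit_of_mem_orbit a hy
  have hd := fun a : G => (hs a).mdifferentiable (by simp)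
  set P : E →L[ℝ] E := mfderiv 𝓘(ℝ, E) 𝓘(ℝ, E) (fun y : M => g • y) x with hP
  obtain ⟨v', hv'⟩ : ∃ v' : E, P v' = v := by
    have h1 := mfderiv_comp (I' := 𝓘(ℝ, E)) (g • x) (g := fun y : M => g • y)
      (f := fun y : M => g⁻¹ • y) (hd g _) (hd g⁻¹ _)
    have h2 : ((fun y : M => g • y) ∘ fun y : M => g⁻¹ • y) = id := by
      ext y
      simp
    rw [h2, mfderiv_id] at h1
    have h3 : ∀ y, y = x →
        (mfderiv 𝓘(ℝ, E) 𝓘(ℝ, E) (fun y : M => g • y) y : E →L[ℝ] E) = P := by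
      rintro _ rfl
      rfl
    refine ⟨(mfderiv 𝓘(ℝ, E) 𝓘(ℝ, E) (fun y : M => g⁻¹ • y) (g • x) : E →L[ℝ] E) v, ?_⟩
    rw [← h3 _ (inv_smul_smul g x)]
    exact congrArg (fun L : E →L[ℝ] E => L v) h1.symm
  rw [← hv']
  refine mfderiv_mem_tangentSet (hs g) (hO g) (hx v' fun w hw => ?_)
  have h1 := hv _ (mfderiv_mem_tangentSet (hs g) (hO g) hw)
  have h2 := congrArg (fun f : E [⋀^Fin 2]→L[ℝ] ℝ => f ![v', w]) (hG g x)
  refine h2.symm.trans (Eq.trans ?_ h1)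
  change (Ω (g • x) : E [⋀^Fin 2]→L[ℝ] ℝ) (P ∘ ![v', w]) =
    (Ω (g • x) : E [⋀^Fin 2]→L[ℝ] ℝ) ![v, P w]
  congr 1
  ext i
  fin_cases i
  · exact hv'
  · rfl

/-- Principality `hP` makes the slice complement consist of fixed vectors, as
`mem_of_coisotropic_fixed` requires. -/
theorem isCoisotropic_of_isCoisotropicIn
    (hsm : ContMDiff (𝓘(ℝ, EG).prod 𝓘(ℝ, E)) 𝓘(ℝ, E) ∞ fun p : G × M => p.1 • p.2)
    (hG : IsSymplecticAction G Ω) {x : M}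
    (hP : x ∈ interior (subconjugateSet M (MulAction.stabilizer G x)))
    (hx : IsCoisotropicIn Ω (isotropyStratum M (MulAction.stabilizer G x))
      (isotropyStratum M (MulAction.stabilizer G x) ∩ MulAction.orbit G x)) :
    IsCoisotropic Ω (MulAction.orbit G x) := by
  refine ⟨isSubmanifold_orbit hsm x, ?_⟩
  rintro _ ⟨g, rfl⟩
  refine mem_tangentSet_orbit_of_smul hsm hG (fun v hv => ?_) g
  have _ : IsTopologicalGroup G := topologicalGroup_of_lieGroup 𝓘(ℝ, EG) ∞
  have _ : CompactSpace (MulAction.stabilizer G x) :=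
    isCompact_iff_compactSpace.1 (isCompact_stabilizer x)
  obtain ⟨sl⟩ := exists_linearSlice (G := G) hsm x
  obtain ⟨D, β, h1, h2, h3, h4, h5⟩ := sl.exists_bilinForm hsm hG
  have hco := hx.2.2 x ⟨rfl, MulAction.mem_orbit_self x⟩
  refine (h2 v).2 (mem_of_coisotropic_fixed sl.continuous_ρ h4 sl.isCompl sl.T_inv
    (fun s hs k => sl.map_eq_of_mem_interior hsm hP k hs) (fun a ha h => ?_) fun t ht => ?_)
  · obtain ⟨a, rfl⟩ := D.surjective a
    refine (h3 a).1 (hco a ((h1 a).2 ha) fun w hw => ?_)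
    exact (h5 a w).symm.trans (h _ ((h3 w).1 hw))
  · obtain ⟨t, rfl⟩ := D.surjective t
    exact (h5 v t).trans (hv t ((h2 t).2 ht))

/-- Near a point of a principal stratum, all orbits meet the stratum near this point. -/
theorem eventually_exists_smul_mem
    (hsm : ContMDiff (𝓘(ℝ, EG).prod 𝓘(ℝ, E)) 𝓘(ℝ, E) ∞ fun p : G × M => p.1 • p.2)
    {H : Subgroup G} (hH : ∀ y : M, y ∈ subconjugateSet M H) {x : M}
    (hx : x ∈ isotropyStratum M H) {O : Set M} (hO : O ∈ 𝓝 x) :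
    ∀ᶠ y in 𝓝 x, ∃ g : G, g • y ∈ isotropyStratum M H ∩ O := by
  have hx' : MulAction.stabilizer G x = H := hx
  subst hx'
  obtain ⟨sl⟩ := exists_linearSlice (G := G) hsm x
  have hP : x ∈ interior (subconjugateSet M (MulAction.stabilizer G x)) :=
    mem_interior_iff_mem_nhds.2 (Eventually.of_forall hH)
  filter_upwards [sl.orbit_near O hO] with y hy
  obtain ⟨g, s, hs, hst, hsO, rfl⟩ := hy
  refine ⟨g⁻¹, ?_⟩
  rw [inv_smul_smul]
  exact ⟨sl.stabilizer_symm_eq_of_mem_interior hsm hP hs hst, hsO⟩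

theorem actsCoisotropicallyOn_of_actsCoisotropically
    (hsm : ContMDiff (𝓘(ℝ, EG).prod 𝓘(ℝ, E)) 𝓘(ℝ, E) ∞ fun p : G × M => p.1 • p.2)
    (hG : IsSymplecticAction G Ω) {H : Subgroup G} (hH : ∀ y : M, y ∈ subconjugateSet M H)
    (h : ActsCoisotropically G Ω) :
    ActsCoisotropicallyOn (NormalizerQuotient H) (isotropyStratum M H) Ω := by
  obtain ⟨U, hUo, hUd, hU⟩ := h
  have _ : IsTopologicalGroup G := topologicalGroup_of_lieGroup 𝓘(ℝ, EG) ∞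
  -- `U` need not be invariant and might miss `M^H`, so it is saturated first. Density uses that
  -- orbits near a point of `M^H` meet `M^H` near this point.
  refine ⟨{x | ∃ g : G, g • (x : M) ∈ U}, ?_, ?_, ?_⟩
  · simp only [ofPred_exists]
    exact isOpen_iUnion fun g =>
      hUo.preimage ((continuous_const_smul g).comp continuous_subtype_val)
  · intro x
    rw [mem_closure_iff_nhds]
    intro W hW
    obtain ⟨O, hO, hOW⟩ := mem_nhds_subtype _ _ _ |>.1 hW
    obtain ⟨y, ⟨g, hgN, hgO⟩, hyU⟩ :=
      mem_closure_iff_nhds.1 (hUd (x : M)) _ (eventually_exists_smul_mem hsm hH x.2 hO)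
    exact ⟨⟨g • y, hgN⟩, hOW hgO, g⁻¹, by rwa [inv_smul_smul]⟩
  · rintro x ⟨g, hg⟩
    rw [image_val_orbit_normalizerQuotient]
    refine isCoisotropicIn_of_isCoisotropic hsm hG ?_
    have := hU _ hg
    rwa [MulAction.orbit_smul] at this

theorem actsCoisotropically_of_actsCoisotropicallyOn
    (hsm : ContMDiff (𝓘(ℝ, EG).prod 𝓘(ℝ, E)) 𝓘(ℝ, E) ∞ fun p : G × M => p.1 • p.2)
    (hG : IsSymplecticAction G Ω) {H : Subgroup G} (hH : ∀ y : M, y ∈ subconjugateSet M H)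
    (hd : Dense (orbitTypeSet M H))
    (h : ActsCoisotropicallyOn (NormalizerQuotient H) (isotropyStratum M H) Ω) :
    ActsCoisotropically G Ω := by
  obtain ⟨U, hUo, hUd, hU⟩ := h
  have _ : IsTopologicalGroup G := topologicalGroup_of_lieGroup 𝓘(ℝ, EG) ∞
  -- The saturation of `U` in `M`: it is open because all orbits near a point of `M^H` meet `M^H`
  -- nearby, and dense because points with isotropy conjugate to `H` are dense in `M` and `U` is
  -- dense in `M^H`.
  refine ⟨{y | ∃ g : G, ∃ hg : g • y ∈ isotropyStratum M H, (⟨g • y, hg⟩ : isotropyStratum M H) ∈ U},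
    isOpen_iff_mem_nhds.2 ?_, ?_, ?_⟩
  · rintro y ⟨g, hg, hgU⟩
    obtain ⟨O, hO, hOU⟩ := (mem_nhds_subtype _ _ _).1 (hUo.mem_nhds hgU)
    have h1 := (continuous_const_smul g).continuousAt.eventually
      (eventually_exists_smul_mem hsm hH hg hO)
    filter_upwards [h1] with w hw
    obtain ⟨a, haN, haO⟩ := hw
    rw [← mul_smul] at haN haO
    exact ⟨a * g, haN, hOU haO⟩
  · intro y
    rw [mem_closure_iff]
    intro O hO hyO
    obtain ⟨w, hwO, g, hg⟩ := mem_closure_iff.1 (hd y) O hO hyO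
    have h1 : IsOpen {n : isotropyStratum M H | g⁻¹ • (n : M) ∈ O} :=
      hO.preimage ((continuous_const_smul g⁻¹).comp continuous_subtype_val)
    obtain ⟨n, hnO, hnU⟩ := mem_closure_iff.1 (hUd ⟨g • w, hg⟩) _ h1
      (by rw [mem_ofPred_eq, inv_smul_smul]; exact hwO)
    refine ⟨g⁻¹ • (n : M), hnO, g, ?_⟩
    rw [smul_inv_smul]
    exact ⟨n.2, hnU⟩
  · rintro y ⟨g, hg, hgU⟩
    have h1 := hU _ hgU
    rw [image_val_orbit_normalizerQuotient] at h1
    have hg' : MulAction.stabilizer G (g • y) = H := hg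
    subst hg'
    rw [← MulAction.orbit_smul g y]
    exact isCoisotropic_of_isCoisotropicIn hsm hG
      (mem_interior_iff_mem_nhds.2 (Eventually.of_forall hH)) h1

end Symplectic

end SymplecticAction

open SymplecticAction in
theorem proposition4p7
    {EG : Type*} [NormedAddCommGroup EG] [NormedSpace ℝ EG] [FiniteDimensional ℝ EG]
    {G : Type*} [Group G] [TopologicalSpace G] [ChartedSpace EG G]
    [LieGroup 𝓘(ℝ, EG) ∞ G] [ConnectedSpace G]
    {E : Type*} [NormedAddCommGroup E] [NormedSpace ℝ E] [FiniteDimensional ℝ E]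
    {M : Type*} [TopologicalSpace M] [ChartedSpace E M] [IsManifold 𝓘(ℝ, E) ∞ M]
    [T2Space M] [SecondCountableTopology M] [ConnectedSpace M]
    (Ω : ∀ x : M, TangentSpace 𝓘(ℝ, E) x [⋀^Fin 2]→L[ℝ] ℝ) (hΩ : IsSymplecticForm Ω)
    [MulAction G M] [ContMDiffSMul 𝓘(ℝ, EG) 𝓘(ℝ, E) ∞ G M] [ProperSMul G M]
    (hG : IsSymplecticAction G Ω)
    (H : Subgroup G) (hH : IsPrincipalIsotropy M H) :
    IsSymplecticSubmanifold Ω (isotropyStratum M H) ∧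
      (ActsCoisotropically G Ω ↔
        ActsCoisotropicallyOn (NormalizerQuotient H) (isotropyStratum M H) Ω) := by
  have hsm : ContMDiff (𝓘(ℝ, EG).prod 𝓘(ℝ, E)) 𝓘(ℝ, E) ∞ fun p : G × M => p.1 • p.2 :=
    contMDiff_smul
  obtain ⟨hd, hP⟩ := exists_le_stabilizer_smul hsm hH
  exact ⟨isSymplecticSubmanifold_isotropyStratum hsm hΩ hG H,
    actsCoisotropicallyOn_of_actsCoisotropically hsm hG hP,
    actsCoisotropically_of_actsCoisotropicallyOn hsm hG hP hd⟩
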